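/- Let $M$ be a compact $n$-dimensional topological manifold (without boundary) with a finite simplicial structure $S$, i.e. a homeomorphism from the underlying space of a finite simplicial complex to $M$. For each $j$ let $C_j$ be the $\mathbb Z_2$-vector space with basis the set $S_j$ of $j$-simplices of $S$, let $Z_j\subseteq C_j$ be the cycles and $B_j\subseteq Z_j$ the boundaries, and let $\perp$ denote the orthogonal complement in $C_j\cong\mathbb Z_2^{S_j}$ for the scalar product $v\cdot w=\sum_e v_ew_e$. Let $S^*$ be the Poincaré dual cellulation, whose $(n-j)$-cells are the closed blocks dual to the $j$-simplices of $S$ (the unions of the simplices of the barycentric subdivision spanned by barycentres of chains of simplices that all contain the given one); the mod 2 boundary of a dual cell is the sum of the dual cells of one dimension less contained in it. For $X=S$ or $X=S^*$, the combinatorial systole $\mathrm{csys}_j(M,X)$ is the least number of cells in a $\mathbb Z_2$-cycle of dimension $j$ of $X$ that is not a boundary of $X$. For orthogonal subspaces $V_1,V_2\subseteq\mathbb Z_2^m$, the CSS code of $(V_1,V_2)$ is the subspace of $(\mathbb C^2)^{\otimes m}$ of all vectors fixed by $\bigotimes_e X^{v_e}$ for $v\in V_1$ and by $\bigotimes_e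 Z^{w_e}$ for $w\in V_2$, where $X$ and $Z$ are the Pauli matrices. A subspace $\mathcal C\subseteq(\mathbb C^2)^{\otimes m}$ is a quantum code with parameters $[[m,k,d]]$ if $\dim_{\mathbb C}\mathcal C=2^k$ and $d$ is the least weight (number of tensor factors different from $I$) of an operator $E\in\{I,X,Z,iY\}^{\otimes m}$ for which there is no constant $c$ with $\langle\varphi|E|\psi\rangle=c\,\langle\varphi|\psi\rangle$ for all $\varphi,\psi\in\mathcal C$. **Theorem.** Let $0\le i\le n$ and suppose that the singular homology group $H_i(M,\mathbb Z_2)$ is non-zero. Then $H_i(M,\mathbb Z_2)$ is finite-dimensional, the subspaces $V_1=Z_i^\perp$ and $V_2=B_i$ of $C_i$ are orthogonal, and their CSS code is a quantum code with parameters $$[[\,|S_i|,\ \dim_{\mathbb Z_2} H_i(M,\mathbb Z_2),\ \min\{\mathrm{csys}_i(M,S),\ \mathrm{csys}_{n-i}(M,S^*)\}\,]].$$ -/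

import Mathlib

open CategoryTheory

universe u

noncomputable section

/-! ### Qubits, Pauli operators and quantum codes -/

/-- The state space of the qubits labelled by `ι`: the Hilbert space with orthonormal basis the
kets labelled by the bit strings `ι → ZMod 2`. -/
abbrev QubitSpace (ι : Type*) [Fintype ι] [DecidableEq ι] : Type _ :=
  EuclideanSpace ℂ (ι → ZMod 2)

/-- The one-qubit bit flip `X`. -/
def pauliX : Matrix (ZMod 2) (ZMod 2) ℂ :=
  Matrix.of fun a b => if a = b then 0 else 1

/-- The one-qubit phase flip `Z`. -/
def pauliZ : Matrix (ZMod 2) (ZMod 2) ℂ :=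
  Matrix.diagonal fun a => if a = 0 then 1 else -1

/-- The one-qubit operators `I`, `X`, `Z`, `iY = ZX`, labelled by
`(0, 0)`, `(1, 0)`, `(0, 1)`, `(1, 1)`. -/
def singlePauli (q : ZMod 2 × ZMod 2) : Matrix (ZMod 2) (ZMod 2) ℂ :=
  pauliZ ^ q.2.val * pauliX ^ q.1.val

section Qubits

variable {ι : Type*} [Fintype ι] [DecidableEq ι]

/-- The tensor product over all qubits of the one-qubit operators labelled by `p`. -/
def pauliMatrix (p : ι → ZMod 2 × ZMod 2) : Matrix (ι → ZMod 2) (ι → ZMod 2) ℂ :=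
  Matrix.of fun x y => ∏ e, singlePauli (p e) (x e) (y e)

/-- A Pauli operator (without sign) acting on the qubit space. -/
def pauliOp (p : ι → ZMod 2 × ZMod 2) : QubitSpace ι →ₗ[ℂ] QubitSpace ι :=
  Matrix.toEuclideanLin (pauliMatrix p)

/-- The weight of a Pauli operator: the number of qubits on which it acts non-trivially. -/
def pauliWeight (p : ι → ZMod 2 × ZMod 2) : ℕ :=
  (Finset.univ.filter fun e => p e ≠ 0).card

/-- The operator labelled by `p` has, on the subspace `C`, matrix elements
`⟨φ|E|ψ⟩ = c ⟨φ|ψ⟩` with one constant `c`. -/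
def ActsAsScalar (C : Submodule ℂ (QubitSpace ι)) (p : ι → ZMod 2 × ZMod 2) : Prop :=
  ∃ c : ℂ, ∀ φ ∈ C, ∀ ψ ∈ C, inner ℂ φ (pauliOp p ψ) = c * inner ℂ φ ψ

/-- The subspace `C` is a quantum code with parameters `[[n, k, d]]`: there are `n` qubits, `C` has
dimension `2 ^ k`, and `d` is the least weight of a Pauli operator whose matrix elements on `C` are
not a constant multiple of the inner product. -/
structure IsQuantumCode (C : Submodule ℂ (QubitSpace ι)) (n k d : ℕ) : Prop where
  card_eq : Fintype.card ι = n
  finrank_eq : Module.finrank ℂ C = 2 ^ k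
  isLeast_weight :
    IsLeast {w : ℕ | ∃ p : ι → ZMod 2 × ZMod 2, ¬ ActsAsScalar C p ∧ pauliWeight p = w} d

/-- The subspace of all vectors fixed by every Pauli operator with a label in `T`. -/
def stabilizerCode (T : Set (ι → ZMod 2 × ZMod 2)) : Submodule ℂ (QubitSpace ι) where
  carrier := {ψ | ∀ p ∈ T, pauliOp p ψ = ψ}
  add_mem' := fun ha hb p hp => by rw [map_add, ha p hp, hb p hp]
  zero_mem' := fun p _ => map_zero _
  smul_mem' := fun c ψ h p hp => by rw [map_smul, h p hp]

/-- The orthogonal complement for the scalar product `∑ e, v e * w e` on `𝔽₂^ι`. -/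
def perp (V : Submodule (ZMod 2) (ι → ZMod 2)) : Submodule (ZMod 2) (ι → ZMod 2) where
  carrier := {w | ∀ v ∈ V, v ⬝ᵥ w = 0}
  add_mem' := fun ha hb v hv => by rw [dotProduct_add, ha v hv, hb v hv, add_zero]
  zero_mem' := fun v _ => dotProduct_zero v
  smul_mem' := fun c w h v hv => by rw [dotProduct_smul, h v hv, smul_zero]

/-- The CSS code of two subspaces: the vectors fixed by the products of `X`'s over the supports of
the elements of `V₁` and by the products of `Z`'s over the supports of the elements of `V₂`. -/
def cssCode (V₁ V₂ : Submodule (ZMod 2) (ι → ZMod 2)) : Submodule ℂ (QubitSpace ι) :=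
  stabilizerCode ({p | ∃ v ∈ V₁, p = fun e => (v e, 0)} ∪ {p | ∃ w ∈ V₂, p = fun e => (0, w e)})

end Qubits

/-! ### Cells, chains modulo two and combinatorial systoles -/

/-- Finitely many closed cells in a space `M`, sorted by dimension. Only used for the simplices of
a triangulation and for the cells dual to them. -/
structure CellFamily (M : Type u) where
  /-- the labels of the cells of a given dimension -/
  Cell : ℕ → Type
  fintypeCell : ∀ j, Fintype (Cell j)
  /-- the closed cell with a given label, as a set of points -/
  closedCell : ∀ {j}, Cell j → Set M

namespace CellFamily

variable {M : Type u} (X : CellFamily M)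

instance (j : ℕ) : Fintype (X.Cell j) := X.fintypeCell j

instance (j : ℕ) : DecidableEq (X.Cell j) := Classical.decEq _

/-- The chains of dimension `j` modulo two, with the cells of dimension `j` as basis. -/
abbrev Chain (j : ℕ) : Type := X.Cell j → ZMod 2

open Classical in
/-- The boundary modulo two: the boundary of a cell is the sum of the cells of codimension one that
are contained in it. For the simplices of a triangulation and for the cells of the dual cellulation
of a closed manifold this is the cellular boundary, all these incidence numbers being odd. -/
def boundary (j : ℕ) : X.Chain (j + 1) →ₗ[ZMod 2] X.Chain j where
  toFun c := fun τ => ∑ σ : X.Cell (j + 1), if X.closedCell τ ⊆ X.closedCell σ then c σ else 0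
  map_add' a b := by
    funext τ
    simp only [Pi.add_apply, ← Finset.sum_add_distrib]
    refine Finset.sum_congr rfl fun σ _ => ?_
    split_ifs <;> simp
  map_smul' r a := by
    funext τ
    simp only [Pi.smul_apply, RingHom.id_apply, Finset.smul_sum]
    refine Finset.sum_congr rfl fun σ _ => ?_
    split_ifs <;> simp

/-- The space of cycles `Z_j`. -/
def cycles : (j : ℕ) → Submodule (ZMod 2) (X.Chain j)
  | 0 => ⊤
  | j + 1 => LinearMap.ker (X.boundary j)

/-- The space of boundaries `B_j`. -/
def boundaries (j : ℕ) : Submodule (ZMod 2) (X.Chain j) :=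
  LinearMap.range (X.boundary j)

/-- The combinatorial systole: the least number of cells in a cycle of dimension `j` that is not a
boundary. -/
def csys (j : ℕ) : ℕ :=
  sInf {w : ℕ | ∃ c ∈ X.cycles j, c ∉ X.boundaries j ∧ hammingNorm c = w}

end CellFamily

/-! ### Triangulations and their dual cellulations -/

/-- A (finite) simplicial structure on `M`: a homeomorphism with `M` of the underlying space of a
finite simplicial complex in some Euclidean space. -/
structure SimplicialStructure (M : Type u) [TopologicalSpace M] where
  N : ℕ
  K : Geometry.SimplicialComplex ℝ (EuclideanSpace ℝ (Fin N))
  finite_faces : K.faces.Finite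
  homeo : K.space ≃ₜ M

namespace SimplicialStructure

variable {M : Type u} [TopologicalSpace M] (S : SimplicialStructure M)

/-- The subset of `M` that corresponds to a set of points of the ambient Euclidean space. -/
def toM (A : Set (EuclideanSpace ℝ (Fin S.N))) : Set M :=
  S.homeo '' {x | (x : EuclideanSpace ℝ (Fin S.N)) ∈ A}

/-- The simplices of the triangulation as closed cells. -/
def simplices : CellFamily M where
  Cell j := {s : Finset (EuclideanSpace ℝ (Fin S.N)) // s ∈ S.K.faces ∧ s.card = j + 1}
  fintypeCell _ := (S.finite_faces.subset fun _ h => h.1).fintype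
  closedCell s := S.toM (convexHull ℝ (s.1 : Set (EuclideanSpace ℝ (Fin S.N))))

/-- The closed block dual to `s`: the union of the simplices of the barycentric subdivision spanned
by the barycentres of the members of a chain of simplices all of which contain `s`. -/
def dualBlock (s : Finset (EuclideanSpace ℝ (Fin S.N))) : Set (EuclideanSpace ℝ (Fin S.N)) :=
  ⋃ C ∈ {C : Set (Finset (EuclideanSpace ℝ (Fin S.N))) |
      C ⊆ S.K.faces ∧ IsChain (· ⊆ ·) C ∧ ∀ t ∈ C, s ⊆ t},
    convexHull ℝ ((fun t : Finset (EuclideanSpace ℝ (Fin S.N)) => t.centroid ℝ id) '' C)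

/-- The dual cellulation of a triangulated manifold of dimension `n`: its cells of dimension `j`
are the closed blocks dual to the simplices of dimension `n - j`, that is, with `n - j + 1`
vertices. -/
def dual (n : ℕ) : CellFamily M where
  Cell j := {s : Finset (EuclideanSpace ℝ (Fin S.N)) // s ∈ S.K.faces ∧ s.card + j = n + 1}
  fintypeCell _ := (S.finite_faces.subset fun _ h => h.1).fintype
  closedCell s := S.toM (S.dualBlock s.1)

end SimplicialStructure

/-! ### Homology of a space -/

/-- Singular homology with coefficients in the field with two elements. -/
abbrev HomologyZ2 (i : ℕ) (M : Type u) [TopologicalSpace M] : ModuleCat.{u} (ZMod 2) :=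
  ((AlgebraicTopology.singularHomologyFunctor (ModuleCat.{u} (ZMod 2)) i).obj
    (ModuleCat.of (ZMod 2) (ULift.{u} (ZMod 2)))).obj (TopCat.of M)

end

/-! Write a state as a function `ψ` on bit strings. A product of `X`'s translates the argument and a
product of `Z`'s multiplies by a character. So `ψ` lies in the CSS code of `V₁`, `V₂` iff it is
`V₁`-invariant and supported on `V₂^⊥` (`mem_cssCode_iff`). For `V₁ ≤ V₂^⊥` the code is thus the
space of functions on `V₂^⊥ / V₁`. With `V₁ = Z_i^⊥` and `V₂ = B_i` this quotient `B_i^⊥ / Z_i^⊥`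
has the dimension of `Z_i / B_i`, which gives the number of encoded qubits.

A Pauli operator with `X`-part `a` and `Z`-part `b` fails to act as a scalar iff `a ∈ V₂^⊥`, `b ∈
V₁^⊥` and not both `a ∈ V₁` and `b ∈ V₂` (`not_actsAsScalar_iff`). Dropping one of the two parts
never raises the weight, so the distance is the smaller of the least weights in `V₁^⊥ \ V₂ = Z_i \
B_i` and in `V₂^⊥ \ V₁ = B_i^⊥ \ Z_i^⊥`. The first is the systole of the triangulation. For the
second, inclusion of dual blocks reverses inclusion of simplices (`closedCell_dual_subset`), so the
dual boundary is the transposed incidence matrix. Its cycles and boundaries in dimension `n - i` are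
`B_i^⊥` and `Z_i^⊥`. This is linear algebra and needs no Poincaré duality theorem.

Two topological facts remain. In dual dimension `0` every chain is a cycle, so for `i = n` there
must be no `(n+1)`-simplices (`SimplicialStructure.isEmpty_cell`). If a `k`-simplex embedded in `ℝⁿ`
with `n < k`, a smooth approximate inverse `ℝⁿ → ℝᵏ` would have a range with dense complement.
Composed with the embedding it would be close to the identity, hence hit all points near the
barycentre. The latter follows from Sperner's lemma by way of the lemma of Knaster, Kuratowski and
Mazurkiewicz.

Secondly, `Z_i / B_i` is singular homology (`SimplicialStructure.homologyEquiv`). Singular cycles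
are subdivided until they are small. A Lebesgue number for the cover by open stars then labels
points by vertices, which turns small singular chains into simplicial ones. Acyclic carriers show
that this inverts the affine realisation up to homology. Modulo two, simplices are plain finite sets
and no orientations occur. Chains are indexed by the number of vertices, so that complexes are
augmented and cones contract them. -/

noncomputable section

/-! ### Augmented singular chains modulo two -/

namespace stdSimplex

/-- The face inclusion of the standard simplex which omits the vertex `i`. -/
def face {n : ℕ} (i : Fin (n + 1)) : C(stdSimplex ℝ (Fin n), stdSimplex ℝ (Fin (n + 1))) :=
  ⟨stdSimplex.map i.succAbove, stdSimplex.continuous_map _⟩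

lemma map_apply_of_injective {α β : Type*} [Fintype α] [Fintype β] {f : α → β}
    (hf : Function.Injective f) (t : stdSimplex ℝ α) (a : α) : stdSimplex.map f t (f a) = t a := by
  classical
  rw [map_coe, FunOnFinite.linearMap_apply_apply]
  rw [Finset.sum_eq_single a] <;> grind [hf.eq_iff]

@[simp] lemma face_apply_succAbove {n : ℕ} (i : Fin (n + 1)) (t : stdSimplex ℝ (Fin n))
    (j : Fin n) : face i t (i.succAbove j) = t j :=
  map_apply_of_injective Fin.succAbove_right_injective t j

@[simp] lemma face_apply_self {n : ℕ} (i : Fin (n + 1)) (t : stdSimplex ℝ (Fin n)) :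
    face i t i = 0 := by
  classical
  change stdSimplex.map _ _ _ = _
  rw [map_coe, FunOnFinite.linearMap_apply_apply]
  refine Finset.sum_eq_zero fun j hj => ?_
  simp at hj

/-- The same two vertices are omitted in the two possible orders. In this form the exchange is an
involution on the pairs `(i, j)`, which cancels the terms of `boundary_boundary`. -/
lemma face_comp_face {n : ℕ} (i : Fin (n + 2)) (j : Fin (n + 1)) :
    (face (i.succAbove j)).comp (face (j.predAbove i)) = (face i).comp (face j) := by
  ext1 t
  change stdSimplex.map _ (stdSimplex.map _ _) = stdSimplex.map _ (stdSimplex.map _ _)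
  rw [map_comp_apply, map_comp_apply]
  congr 1
  funext k
  exact Fin.succAbove_succAbove_succAbove_predAbove i j k

lemma ext_face {n : ℕ} (i : Fin (n + 1)) {s t : stdSimplex ℝ (Fin (n + 1))} (h : s i = t i)
    (h' : ∀ j, s (i.succAbove j) = t (i.succAbove j)) : s = t := by
  ext k
  rcases Fin.eq_self_or_eq_succAbove i k with rfl | ⟨j, rfl⟩
  exacts [h, h' j]

instance : IsEmpty (stdSimplex ℝ (Fin 0)) := ⟨fun t => by simpa using stdSimplex.sum_eq_one t⟩

/-- The parametrisation of a simplex as the join of its vertex `0` and the opposite face. -/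
def join {n : ℕ} : C(stdSimplex ℝ (Fin n) × unitInterval, stdSimplex ℝ (Fin (n + 1))) where
  toFun x := ⟨Fin.cons (1 - x.2) (fun j => x.2 * x.1 j), by
    constructor
    · intro i
      refine Fin.cases ?_ (fun j => ?_) i
      · simpa using x.2.2.2
      · simpa using mul_nonneg x.2.2.1 (stdSimplex.zero_le x.1 j)
    · rw [Fin.sum_univ_succ]
      simp [← Finset.mul_sum]⟩
  continuous_toFun := by
    refine Continuous.subtype_mk (continuous_pi fun i => ?_) _
    refine Fin.cases ?_ (fun j => ?_) i
    · simp only [Fin.cons_zero]; fun_prop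
    · simp only [Fin.cons_succ]
      have : Continuous fun x : stdSimplex ℝ (Fin n) × unitInterval => x.1.1 j :=
        (continuous_apply j).comp (continuous_subtype_val.comp continuous_fst)
      exact (continuous_subtype_val.comp continuous_snd).mul this

@[simp] lemma join_apply_zero {n : ℕ} (x : stdSimplex ℝ (Fin n) × unitInterval) :
    join x 0 = 1 - x.2 := rfl

@[simp] lemma join_apply_succ {n : ℕ} (x : stdSimplex ℝ (Fin n) × unitInterval) (j : Fin n) :
    join x j.succ = x.2 * x.1 j := rfl

lemma join_surjective {n : ℕ} : Function.Surjective (join (n := n + 1)) := by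
  intro t
  have h0 : ∑ j : Fin (n + 1), t j.succ = 1 - t 0 := by
    rw [eq_sub_iff_add_eq', ← Fin.sum_univ_succ]; exact stdSimplex.sum_eq_one t
  -- At vertex `0` the parameter vanishes and any point of the opposite face will do; elsewhere the
  -- remaining coordinates are divided by their sum.
  by_cases h : t 0 = 1
  · refine ⟨(Classical.arbitrary _, 0), ext_face 0 (by simp [h]) fun j => ?_⟩
    have : t j.succ = 0 := by
      rw [h, sub_self, Finset.sum_eq_zero_iff_of_nonneg (fun _ _ => stdSimplex.zero_le t _)] at h0
      exact h0 j (Finset.mem_univ _)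
    simp [this]
  · have h1 : 0 < 1 - t 0 := by
      have := stdSimplex.le_one t 0
      exact sub_pos.2 (lt_of_le_of_ne this h)
    refine ⟨(⟨fun j => t j.succ / (1 - t 0),
      fun j => div_nonneg (stdSimplex.zero_le t _) h1.le, ?_⟩,
      ⟨1 - t 0, h1.le, by linarith [stdSimplex.zero_le t 0]⟩), ext_face 0 (by simp) fun j => ?_⟩
    · rw [← Finset.sum_div, h0, div_self h1.ne']
    · rw [Fin.succAbove_zero, join_apply_succ]
      exact mul_div_cancel₀ _ h1.ne'

/-- A continuous surjection from a compact space onto a Hausdorff space is closed. This lets cones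
over singular simplices be defined by descent along `join`. -/
lemma join_isQuotientMap {n : ℕ} : Topology.IsQuotientMap (join (n := n + 1)) :=
  join.continuous.isClosedMap.isQuotientMap join.continuous join_surjective

lemma face_zero_eq_join {n : ℕ} (t : stdSimplex ℝ (Fin n)) : face 0 t = join (t, 1) := by
  refine ext_face 0 (by rw [face_apply_self]; simp) fun j => ?_
  rw [face_apply_succAbove]; simp

lemma face_succ_join {n : ℕ} (i : Fin (n + 1)) (t : stdSimplex ℝ (Fin n)) (r : unitInterval) :
    face i.succ (join (t, r)) = join (face i t, r) := by
  refine ext_face i.succ (by rw [face_apply_self]; simp) fun j => ?_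
  rw [face_apply_succAbove]
  refine Fin.cases ?_ (fun j => ?_) j <;> simp

end stdSimplex

open stdSimplex (face)

/-- The singular chains modulo two of the simplices with `n` vertices. For `n = 0` there is exactly
one such simplex, so that this is the augmented singular chain complex. -/
abbrev SingularChain (n : ℕ) (Y : Type*) [TopologicalSpace Y] : Type _ :=
  C(stdSimplex ℝ (Fin n), Y) →₀ ZMod 2

namespace SingularChain

variable {X Y Z : Type*} [TopologicalSpace X] [TopologicalSpace Y] [TopologicalSpace Z]

/-- The boundary modulo two. -/
def boundary (n : ℕ) (Y : Type*) [TopologicalSpace Y] :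
    SingularChain (n + 1) Y →ₗ[ZMod 2] SingularChain n Y :=
  ∑ i, Finsupp.lmapDomain _ _ fun σ : C(stdSimplex ℝ (Fin (n + 1)), Y) => σ.comp (face i)

lemma boundary_single {n : ℕ} (σ : C(stdSimplex ℝ (Fin (n + 1)), Y)) (a : ZMod 2) :
    boundary n Y (Finsupp.single σ a) = ∑ i, Finsupp.single (σ.comp (face i)) a := by
  simp [boundary, LinearMap.sum_apply, Finsupp.mapDomain_single]

lemma boundary_boundary {n : ℕ} (c : SingularChain (n + 2) Y) :
    boundary n Y (boundary (n + 1) Y c) = 0 := by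
  induction c using Finsupp.induction_linear with
  | zero => simp
  | add f g hf hg => simp [hf, hg]
  | single σ a =>
    simp only [boundary_single, map_sum]
    rw [Finset.sum_sigma']
    refine Finset.sum_involution
      (fun x _ => (⟨x.1.succAbove x.2, x.2.predAbove x.1⟩ : (_ : Fin (n + 2)) × Fin (n + 1)))
      ?_ ?_ (fun _ _ => by simp) ?_
    · rintro ⟨i, j⟩ -
      simp only [ContinuousMap.comp_assoc, stdSimplex.face_comp_face]
      exact ZModModule.add_self _
    · rintro ⟨i, j⟩ - - h
      exact Fin.succAbove_ne i j (congrArg Sigma.fst h)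
    · rintro ⟨i, j⟩ -
      simp only [Fin.succAbove_succAbove_predAbove, Fin.predAbove_predAbove_succAbove]

/-- The push-forward of chains along a continuous map. -/
def push (n : ℕ) (g : C(Y, Z)) : SingularChain n Y →ₗ[ZMod 2] SingularChain n Z :=
  Finsupp.lmapDomain _ _ fun σ => g.comp σ

@[simp] lemma push_single {n : ℕ} (g : C(Y, Z)) (σ : C(stdSimplex ℝ (Fin n), Y)) (a : ZMod 2) :
    push n g (Finsupp.single σ a) = Finsupp.single (g.comp σ) a := by
  simp [push, Finsupp.mapDomain_single]

lemma push_push {n : ℕ} (g : C(Y, Z)) (f : C(X, Y)) (c : SingularChain n X) :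
    push n g (push n f c) = push n (g.comp f) c := by
  induction c using Finsupp.induction_linear with
  | zero => simp
  | add f g hf hg => simp [hf, hg]
  | single σ a => simp [ContinuousMap.comp_assoc]

lemma push_boundary {n : ℕ} (g : C(Y, Z)) (c : SingularChain (n + 1) Y) :
    push n g (boundary n Y c) = boundary n Z (push (n + 1) g c) := by
  induction c using Finsupp.induction_linear with
  | zero => simp
  | add f g hf hg => simp [hf, hg]
  | single σ a => simp [boundary_single, ContinuousMap.comp_assoc]

end SingularChain

/-- A contraction of a space to a point which is fixed at the final time. -/
structure Contraction (Y : Type*) [TopologicalSpace Y] where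
  toMap : C(Y × unitInterval, Y)
  pt : Y
  map_zero : ∀ y, toMap (y, 0) = pt
  map_one : ∀ y, toMap (y, 1) = y

namespace Contraction

variable {Y : Type*} [TopologicalSpace Y] (H : Contraction Y)

/-- The parameter can be read off from coordinate `0`, and `join` identifies distinct points only at
parameter `0`, where the contraction is constant. -/
lemma factorsThrough_join {n : ℕ} (σ : C(stdSimplex ℝ (Fin n), Y)) :
    Function.FactorsThrough (H.toMap.comp (σ.prodMap (ContinuousMap.id unitInterval)))
      (stdSimplex.join (n := n)) := by
  rintro ⟨x, r⟩ ⟨y, s⟩ h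
  obtain rfl : r = s := by
    have := congrArg (fun t : stdSimplex ℝ (Fin (n + 1)) => t 0) h
    ext
    simpa using this
  by_cases hr : r = 0
  · subst hr
    simp [H.map_zero]
  · have : x = y := by
      ext j
      have := congrArg (fun t : stdSimplex ℝ (Fin (n + 1)) => t j.succ) h
      have hr' : (r : ℝ) ≠ 0 := fun h => hr (Subtype.ext h)
      simpa [hr'] using this
    rw [this]

/-- The cone over a singular simplex. -/
def cone : {n : ℕ} → C(stdSimplex ℝ (Fin n), Y) → C(stdSimplex ℝ (Fin (n + 1)), Y)
  | 0, _ => ContinuousMap.const _ H.pt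
  | _ + 1, σ => stdSimplex.join_isQuotientMap.lift
      (H.toMap.comp (σ.prodMap (ContinuousMap.id _))) (H.factorsThrough_join σ)

lemma cone_join {n : ℕ} (σ : C(stdSimplex ℝ (Fin (n + 1)), Y)) (t : stdSimplex ℝ (Fin (n + 1)))
    (r : unitInterval) : H.cone σ (stdSimplex.join (t, r)) = H.toMap (σ t, r) :=
  DFunLike.congr_fun (Topology.IsQuotientMap.lift_comp stdSimplex.join_isQuotientMap
    (H.toMap.comp (σ.prodMap (ContinuousMap.id _))) (H.factorsThrough_join σ)) (t, r)

lemma cone_zero (σ : C(stdSimplex ℝ (Fin 0), Y)) (t : stdSimplex ℝ (Fin 1)) :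
    H.cone σ t = H.pt := rfl

lemma cone_face_zero {n : ℕ} (σ : C(stdSimplex ℝ (Fin n), Y)) : (H.cone σ).comp (face 0) = σ := by
  ext t
  cases n with
  | zero => exact isEmptyElim t
  | succ n => rw [ContinuousMap.comp_apply, stdSimplex.face_zero_eq_join, cone_join, H.map_one]

/-- When `σ` has one vertex, the face in question is the apex, which is the cone over the empty
simplex; this dictates the first clause of `cone`. -/
lemma cone_face_succ {n : ℕ} (σ : C(stdSimplex ℝ (Fin (n + 1)), Y)) (i : Fin (n + 1)) :
    (H.cone σ).comp (face i.succ) = H.cone (σ.comp (face i)) := by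
  ext t
  cases n with
  | zero =>
    obtain rfl : i = 0 := Subsingleton.elim (α := Fin 1) _ _
    have : face (Fin.succ 0) t = stdSimplex.join (t, 0) := by
      refine stdSimplex.ext_face 1 ?_ fun j => ?_
      · exact (stdSimplex.face_apply_self _ _).trans (by
          simpa using (stdSimplex.join_apply_succ (t, 0) 0).symm)
      · obtain rfl : j = 0 := Subsingleton.elim (α := Fin 1) _ _
        exact (stdSimplex.face_apply_succAbove _ _ _).trans
          ((stdSimplex.eq_one_of_unique (X := Fin 1) t 0).trans
            (by simp))
    rw [ContinuousMap.comp_apply, this, cone_join, H.map_zero]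
    rfl
  | succ n =>
    obtain ⟨⟨t, r⟩, rfl⟩ := stdSimplex.join_surjective t
    rw [ContinuousMap.comp_apply, stdSimplex.face_succ_join, cone_join, cone_join]
    rfl

open SingularChain

/-- The cone over a chain. -/
def coneChain (n : ℕ) : SingularChain n Y →ₗ[ZMod 2] SingularChain (n + 1) Y :=
  Finsupp.lmapDomain _ _ H.cone

@[simp] lemma coneChain_single {n : ℕ} (σ : C(stdSimplex ℝ (Fin n), Y)) (a : ZMod 2) :
    H.coneChain n (Finsupp.single σ a) = Finsupp.single (H.cone σ) a := by
  simp [coneChain, Finsupp.mapDomain_single]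

lemma boundary_coneChain_zero (c : SingularChain 0 Y) : boundary 0 Y (H.coneChain 0 c) = c := by
  induction c using Finsupp.induction_linear with
  | zero => simp
  | add f g hf hg => simp [hf, hg]
  | single σ a => simp [boundary_single, cone_face_zero]

/-- The face opposite the apex is the simplex itself and the others are cones over its faces. Hence
every cycle of the augmented complex bounds its cone. -/
lemma boundary_coneChain_succ {n : ℕ} (c : SingularChain (n + 1) Y) :
    boundary (n + 1) Y (H.coneChain (n + 1) c) = c + H.coneChain n (boundary n Y c) := by
  induction c using Finsupp.induction_linear with
  | zero => simp
  | add f g hf hg => simp only [map_add, hf, hg]; abel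
  | single σ a =>
    simp only [coneChain_single, boundary_single, map_sum]
    rw [Fin.sum_univ_succ, cone_face_zero]
    simp only [cone_face_succ]

end Contraction

/-! ### Barycentric subdivision of singular chains -/

namespace stdSimplex

/-- The straight-line contraction of a simplex to its barycentre. -/
def contraction (n : ℕ) : Contraction (stdSimplex ℝ (Fin (n + 1))) where
  toMap :=
    { toFun := fun x => ⟨fun k => x.2 * x.1 k + (1 - x.2) * (n + 1 : ℝ)⁻¹,
        fun k => add_nonneg (mul_nonneg x.2.2.1 (stdSimplex.zero_le x.1 k))
          (mul_nonneg (sub_nonneg.2 x.2.2.2) (by positivity)), by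
        rw [Finset.sum_add_distrib, ← Finset.mul_sum, stdSimplex.sum_eq_one]
        have : (n + 1 : ℝ) ≠ 0 := by positivity
        simp
        field_simp
        ring⟩
      continuous_toFun := by
        refine Continuous.subtype_mk (continuous_pi fun k => ?_) _
        have h : Continuous fun x : stdSimplex ℝ (Fin (n + 1)) × unitInterval => x.1.1 k :=
          (continuous_apply k).comp (continuous_subtype_val.comp continuous_fst)
        have h' : Continuous fun x : stdSimplex ℝ (Fin (n + 1)) × unitInterval => (x.2 : ℝ) :=
          continuous_subtype_val.comp continuous_snd
        exact (h'.mul h).add ((continuous_const.sub h').mul continuous_const) }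
  pt := barycenter
  map_zero y := by
    ext k
    change (0 : ℝ) * _ + (1 - 0) * _ = (Fintype.card (Fin (n + 1)) : ℝ)⁻¹
    simp
  map_one y := by
    ext k
    change (1 : ℝ) * _ + (1 - 1) * _ = _
    simp

lemma contraction_apply {n : ℕ} (t : stdSimplex ℝ (Fin (n + 1))) (r : unitInterval)
    (k : Fin (n + 1)) :
    (contraction n).toMap (t, r) k = r * t k + (1 - r) * (n + 1 : ℝ)⁻¹ := rfl

lemma contraction_pt_apply {n : ℕ} (k : Fin (n + 1)) :
    (contraction n).pt k = (n + 1 : ℝ)⁻¹ := by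
  change (Fintype.card (Fin (n + 1)) : ℝ)⁻¹ = _
  simp

/-- The distance of two points of a simplex for the `ℓ¹`-norm. -/
def l1Dist {n : ℕ} (x y : stdSimplex ℝ (Fin n)) : ℝ := ∑ k, |x k - y k|

lemma l1Dist_comm {n : ℕ} (x y : stdSimplex ℝ (Fin n)) : l1Dist x y = l1Dist y x :=
  Finset.sum_congr rfl fun _ _ => abs_sub_comm _ _

lemma l1Dist_self {n : ℕ} (x : stdSimplex ℝ (Fin n)) : l1Dist x x = 0 := by
  simp [l1Dist]

lemma l1Dist_le_two {n : ℕ} (x y : stdSimplex ℝ (Fin n)) : l1Dist x y ≤ 2 := by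
  have : l1Dist x y ≤ ∑ k, (x k + y k) := Finset.sum_le_sum fun k _ => by
    rw [abs_le]
    constructor <;> linarith [stdSimplex.zero_le x k, stdSimplex.zero_le y k]
  rw [Finset.sum_add_distrib, stdSimplex.sum_eq_one, stdSimplex.sum_eq_one] at this
  linarith

lemma l1Dist_nonneg {n : ℕ} (x y : stdSimplex ℝ (Fin n)) : 0 ≤ l1Dist x y :=
  Finset.sum_nonneg fun _ _ => abs_nonneg _

lemma dist_le_l1Dist {n : ℕ} (x y : stdSimplex ℝ (Fin n)) : dist x y ≤ l1Dist x y := by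
  rw [Subtype.dist_eq, dist_pi_le_iff (l1Dist_nonneg x y)]
  intro k
  exact Finset.single_le_sum (f := fun k => |x k - y k|) (fun _ _ => abs_nonneg _)
    (Finset.mem_univ k)

lemma l1Dist_face {n : ℕ} (i : Fin (n + 1)) (x y : stdSimplex ℝ (Fin n)) :
    l1Dist (face i x) (face i y) = l1Dist x y := by
  simp [l1Dist, Fin.sum_univ_succAbove _ i]

/-- Some coordinate `k₀` is at least `1 / (n + 1)` and contributes `x k₀ - 1 / (n + 1)`; the others
contribute at most `n / (n + 1) + (1 - x k₀)`. -/
lemma l1Dist_barycenter_le {n : ℕ} (x : stdSimplex ℝ (Fin (n + 1))) :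
    l1Dist (contraction n).pt x ≤ 2 * (n / (n + 1)) := by
  obtain ⟨k₀, hk₀⟩ : ∃ k, (n + 1 : ℝ)⁻¹ ≤ x k := by
    by_contra! h
    have := Finset.sum_lt_sum_of_nonempty (s := Finset.univ) Finset.univ_nonempty
      fun k _ => h k
    rw [stdSimplex.sum_eq_one] at this
    simp at this
    rw [mul_inv_cancel₀ (by positivity)] at this
    exact lt_irrefl _ this
  have hs := stdSimplex.sum_eq_one x
  rw [Fin.sum_univ_succAbove _ k₀] at hs
  simp only [l1Dist, contraction_pt_apply]
  rw [Fin.sum_univ_succAbove _ k₀, abs_of_nonpos (by linarith)]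
  have : ∑ j : Fin n, |(n + 1 : ℝ)⁻¹ - x (k₀.succAbove j)| ≤
      ∑ j : Fin n, ((n + 1 : ℝ)⁻¹ + x (k₀.succAbove j)) := Finset.sum_le_sum fun j _ => by
    have h1 : (0 : ℝ) ≤ (n + 1 : ℝ)⁻¹ := by positivity
    have h2 := stdSimplex.zero_le x (k₀.succAbove j)
    rw [abs_le]
    constructor <;> linarith
  rw [Finset.sum_add_distrib] at this
  have e : (n / (n + 1) : ℝ) = n * (n + 1 : ℝ)⁻¹ := div_eq_mul_inv _ _
  have e' : (n : ℝ) * (n + 1 : ℝ)⁻¹ = 1 - (n + 1 : ℝ)⁻¹ := by field_simp; ring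
  simp only [Finset.sum_const, Finset.card_univ, Fintype.card_fin, nsmul_eq_mul] at this
  rw [e]
  linarith

/-- The map `u` of simplices is affine, with the given images of the vertices. -/
def IsAffine {m n : ℕ} (u : C(stdSimplex ℝ (Fin m), stdSimplex ℝ (Fin n)))
    (w : Fin m → stdSimplex ℝ (Fin n)) : Prop :=
  ∀ t k, u t k = ∑ j, t j * w j k

/-- This is a transport argument. The positive and negative parts `p`, `q` of `x - y` have the same
mass `μ`, half the distance of `x` and `y`. Therefore `μ (u x - u y) = ∑ p i q j (w i - w j)`, whose
norm is at most `2 r μ²`. -/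
lemma IsAffine.l1Dist_le {m n : ℕ} {u : C(stdSimplex ℝ (Fin m), stdSimplex ℝ (Fin n))}
    {w : Fin m → stdSimplex ℝ (Fin n)} (h : IsAffine u w) {r : ℝ}
    (hw : ∀ i j, l1Dist (w i) (w j) ≤ 2 * r) (x y : stdSimplex ℝ (Fin m)) :
    l1Dist (u x) (u y) ≤ r * l1Dist x y := by
  set p : Fin m → ℝ := fun j => max (x j - y j) 0 with hp
  set q : Fin m → ℝ := fun j => max (y j - x j) 0 with hq
  have hp0 : ∀ j, 0 ≤ p j := fun j => le_max_right _ _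
  have hq0 : ∀ j, 0 ≤ q j := fun j => le_max_right _ _
  have hpq : ∀ j, p j - q j = x j - y j := fun j => by
    simp only [hp, hq]
    rcases le_total (x j) (y j) with h | h
    · rw [max_eq_right (by linarith), max_eq_left (by linarith)]; ring
    · rw [max_eq_left (by linarith), max_eq_right (by linarith)]; ring
  have hpq' : ∀ j, p j + q j = |x j - y j| := fun j => by
    simp only [hp, hq]
    rcases le_total (x j) (y j) with h | h
    · rw [max_eq_right (by linarith), max_eq_left (by linarith), abs_of_nonpos (by linarith)]; ring
    · rw [max_eq_left (by linarith), max_eq_right (by linarith), abs_of_nonneg (by linarith)]; ring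
  set μ := ∑ j, p j with hμ
  have hμq : ∑ j, q j = μ := by
    have : ∑ j, (p j - q j) = 0 := by
      simp [hpq, Finset.sum_sub_distrib]
    rw [Finset.sum_sub_distrib] at this
    linarith
  have hd : l1Dist x y = 2 * μ := by
    have : l1Dist x y = ∑ j, (p j + q j) := Finset.sum_congr rfl fun j _ => (hpq' j).symm
    rw [this, Finset.sum_add_distrib, hμq]; ring
  have hμ0 : 0 ≤ μ := Finset.sum_nonneg fun j _ => hp0 j
  have key : ∀ k, μ * (u x k - u y k) = ∑ i, ∑ j, p i * q j * (w i k - w j k) := fun k => by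
    have e1 : u x k - u y k = ∑ j, p j * w j k - ∑ j, q j * w j k := by
      rw [h, h, ← Finset.sum_sub_distrib, ← Finset.sum_sub_distrib]
      refine Finset.sum_congr rfl fun j _ => ?_
      rw [← sub_mul, ← sub_mul, hpq]
    have e2 : ∑ i, ∑ j, p i * q j * w i k = μ * ∑ i, p i * w i k := by
      rw [Finset.mul_sum]
      refine Finset.sum_congr rfl fun i _ => ?_
      rw [← Finset.sum_mul, ← Finset.mul_sum, hμq]; ring
    have e3 : ∑ i, ∑ j, p i * q j * w j k = μ * ∑ j, q j * w j k := by
      rw [hμ, Finset.sum_mul]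
      refine Finset.sum_congr rfl fun i _ => ?_
      rw [Finset.mul_sum]
      exact Finset.sum_congr rfl fun j _ => by ring
    simp only [mul_sub, Finset.sum_sub_distrib]
    rw [e2, e3, ← mul_sub, ← mul_sub, e1]
  rcases hμ0.eq_or_lt with h0 | h0
  · have : x = y := by
      rw [← h0, mul_zero] at hd
      ext k
      have := (Finset.sum_eq_zero_iff_of_nonneg fun _ _ => abs_nonneg _).1 hd k (Finset.mem_univ k)
      exact sub_eq_zero.1 (abs_eq_zero.1 this)
    subst this
    rw [l1Dist_self, l1Dist_self, mul_zero]
  · have : μ * l1Dist (u x) (u y) ≤ μ * (r * l1Dist x y) := by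
      calc μ * l1Dist (u x) (u y) = ∑ k, |μ * (u x k - u y k)| := by
            rw [l1Dist, Finset.mul_sum]
            exact Finset.sum_congr rfl fun k _ => by rw [abs_mul, abs_of_pos h0]
        _ ≤ ∑ k, ∑ i, ∑ j, p i * q j * |w i k - w j k| := Finset.sum_le_sum fun k _ => by
            rw [key]
            refine (Finset.abs_sum_le_sum_abs _ _).trans (Finset.sum_le_sum fun i _ => ?_)
            refine (Finset.abs_sum_le_sum_abs _ _).trans (Finset.sum_le_sum fun j _ => ?_)
            rw [abs_mul, abs_of_nonneg (mul_nonneg (hp0 i) (hq0 j))]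
        _ = ∑ i, ∑ j, p i * q j * l1Dist (w i) (w j) := by
            rw [Finset.sum_comm]
            refine Finset.sum_congr rfl fun i _ => ?_
            rw [Finset.sum_comm]
            exact Finset.sum_congr rfl fun j _ => by rw [l1Dist, Finset.mul_sum]
        _ ≤ ∑ i, ∑ j, p i * q j * (2 * r) := Finset.sum_le_sum fun i _ =>
            Finset.sum_le_sum fun j _ =>
              mul_le_mul_of_nonneg_left (hw i j) (mul_nonneg (hp0 i) (hq0 j))
        _ = μ * (r * l1Dist x y) := by
            rw [hd]
            simp only [← Finset.sum_mul, ← Finset.mul_sum, hμq, ← hμ]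
            ring
    exact le_of_mul_le_mul_left this h0

lemma IsAffine.cone {m n : ℕ} {u : C(stdSimplex ℝ (Fin m), stdSimplex ℝ (Fin (n + 1)))}
    {w : Fin m → stdSimplex ℝ (Fin (n + 1))} (h : IsAffine u w) :
    IsAffine ((contraction n).cone u) (Fin.cons (contraction n).pt w) := by
  intro t k
  cases m with
  | zero =>
    rw [Contraction.cone_zero, Fin.sum_univ_succ]
    simp [stdSimplex.eq_one_of_unique (X := Fin 1) t 0]
  | succ m =>
    obtain ⟨⟨t, r⟩, rfl⟩ := join_surjective t
    rw [Contraction.cone_join, contraction_apply, h, Fin.sum_univ_succ (n := m + 1)]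
    simp only [join_apply_zero, Fin.cons_zero, contraction_pt_apply, join_apply_succ, Fin.cons_succ,
      Finset.mul_sum, mul_assoc]
    ring

lemma IsAffine.face_comp {m n : ℕ} {u : C(stdSimplex ℝ (Fin m), stdSimplex ℝ (Fin n))}
    {w : Fin m → stdSimplex ℝ (Fin n)} (h : IsAffine u w) (i : Fin (n + 1)) :
    IsAffine ((face i).comp u) (fun j => face i (w j)) := by
  intro t k
  rw [ContinuousMap.comp_apply]
  rcases Fin.eq_self_or_eq_succAbove i k with rfl | ⟨k, rfl⟩
  · simp only [face_apply_self, mul_zero, Finset.sum_const_zero]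
  · simp only [face_apply_succAbove, h t k]

end stdSimplex

namespace SingularChain

variable {Y Z : Type*} [TopologicalSpace Y] [TopologicalSpace Z]

/-- The natural operation on singular chains with a given value on the universal simplex. -/
def natural {m n : ℕ} (a : SingularChain m (stdSimplex ℝ (Fin n))) (Y : Type*)
    [TopologicalSpace Y] : SingularChain n Y →ₗ[ZMod 2] SingularChain m Y :=
  Finsupp.linearCombination (ZMod 2) fun σ => push m σ a

lemma natural_single {m n : ℕ} (a : SingularChain m (stdSimplex ℝ (Fin n)))
    (σ : C(stdSimplex ℝ (Fin n), Y)) (r : ZMod 2) :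
    natural a Y (Finsupp.single σ r) = r • push m σ a := by
  simp [natural]

lemma push_natural {m n : ℕ} (a : SingularChain m (stdSimplex ℝ (Fin n))) (g : C(Y, Z))
    (c : SingularChain n Y) : push m g (natural a Y c) = natural a Z (push n g c) := by
  induction c using Finsupp.induction_linear with
  | zero => simp
  | add f g hf hg => simp [hf, hg]
  | single σ r => simp [natural_single, push_push]

/-- The universal simplex as a singular chain. -/
def universal (n : ℕ) : SingularChain n (stdSimplex ℝ (Fin n)) :=
  Finsupp.single (ContinuousMap.id _) 1

@[simp] lemma push_universal {n : ℕ} (σ : C(stdSimplex ℝ (Fin n), Y)) :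
    push n σ (universal n) = Finsupp.single σ 1 := by
  simp [universal]

lemma hom_ext_single {n : ℕ} {M : Type*} [AddCommMonoid M] [Module (ZMod 2) M]
    {f g : SingularChain n Y →ₗ[ZMod 2] M}
    (h : ∀ σ, f (Finsupp.single σ 1) = g (Finsupp.single σ 1)) : f = g :=
  Finsupp.lhom_ext' fun σ => LinearMap.ext_ring (h σ)

/-- The barycentric subdivision of the universal simplex. -/
def sdModel : (n : ℕ) → SingularChain n (stdSimplex ℝ (Fin n))
  | 0 => universal 0
  | n + 1 => (stdSimplex.contraction n).coneChain n
      (natural (sdModel n) _ (boundary n _ (universal (n + 1))))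

/-- The barycentric subdivision of singular chains. -/
def sd (n : ℕ) (Y : Type*) [TopologicalSpace Y] : SingularChain n Y →ₗ[ZMod 2] SingularChain n Y :=
  natural (sdModel n) Y

lemma sdModel_succ (n : ℕ) : sdModel (n + 1) = (stdSimplex.contraction n).coneChain n
    (sd n _ (boundary n _ (universal (n + 1)))) := rfl

lemma sd_single {n : ℕ} (σ : C(stdSimplex ℝ (Fin n), Y)) :
    sd n Y (Finsupp.single σ 1) = push n σ (sdModel n) := by
  simp [sd, natural_single]

lemma push_sd {n : ℕ} (g : C(Y, Z)) (c : SingularChain n Y) :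
    push n g (sd n Y c) = sd n Z (push n g c) := push_natural _ _ _

/-- By naturality it suffices to check the universal simplex. The hypothesis is kept separate
because the induction for it uses this conclusion one dimension lower. -/
lemma boundary_sd_of_model {n : ℕ}
    (h : boundary n _ (sdModel (n + 1)) = sd n _ (boundary n _ (universal (n + 1))))
    (c : SingularChain (n + 1) Y) : boundary n Y (sd (n + 1) Y c) = sd n Y (boundary n Y c) := by
  refine LinearMap.congr_fun (f := boundary n Y ∘ₗ sd (n + 1) Y) (g := sd n Y ∘ₗ boundary n Y)
    (hom_ext_single fun σ => ?_) c
  rw [LinearMap.comp_apply, LinearMap.comp_apply, sd_single, ← push_boundary, h, push_sd,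
    push_boundary, push_universal]

/-- The subdivided boundary is a cycle, since subdivision commutes with the boundary one dimension
lower; so it is the boundary of its cone. -/
lemma boundary_sdModel (n : ℕ) :
    boundary n _ (sdModel (n + 1)) = sd n _ (boundary n _ (universal (n + 1))) := by
  induction n with
  | zero => rw [sdModel_succ, Contraction.boundary_coneChain_zero]
  | succ n ih =>
    rw [sdModel_succ, Contraction.boundary_coneChain_succ, boundary_sd_of_model ih,
      boundary_boundary, map_zero, map_zero, add_zero]

lemma boundary_sd {n : ℕ} (c : SingularChain (n + 1) Y) :
    boundary n Y (sd (n + 1) Y c) = sd n Y (boundary n Y c) :=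
  boundary_sd_of_model (boundary_sdModel n) c

lemma sd_zero (c : SingularChain 0 Y) : sd 0 Y c = c := by
  refine LinearMap.congr_fun (f := sd 0 Y) (g := LinearMap.id) (hom_ext_single fun σ => ?_) c
  rw [sd_single, sdModel, push_universal]
  rfl

/-- The value on the universal simplex of the homotopy from the subdivision to the identity. -/
def sdHomotopyModel : (n : ℕ) → SingularChain (n + 1) (stdSimplex ℝ (Fin n))
  | 0 => 0
  | n + 1 => (stdSimplex.contraction n).coneChain (n + 1) (sdModel (n + 1) + universal (n + 1) +
      natural (sdHomotopyModel n) _ (boundary n _ (universal (n + 1))))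

/-- The homotopy from the barycentric subdivision to the identity. -/
def sdHomotopy (n : ℕ) (Y : Type*) [TopologicalSpace Y] :
    SingularChain n Y →ₗ[ZMod 2] SingularChain (n + 1) Y :=
  natural (sdHomotopyModel n) Y

lemma sdHomotopyModel_succ (n : ℕ) : sdHomotopyModel (n + 1) =
    (stdSimplex.contraction n).coneChain (n + 1) (sdModel (n + 1) + universal (n + 1) +
      sdHomotopy n _ (boundary n _ (universal (n + 1)))) := rfl

lemma sdHomotopy_single {n : ℕ} (σ : C(stdSimplex ℝ (Fin n), Y)) :
    sdHomotopy n Y (Finsupp.single σ 1) = push (n + 1) σ (sdHomotopyModel n) := by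
  simp [sdHomotopy, natural_single]

lemma push_sdHomotopy {n : ℕ} (g : C(Y, Z)) (c : SingularChain n Y) :
    push (n + 1) g (sdHomotopy n Y c) = sdHomotopy n Z (push n g c) := push_natural _ _ _

lemma sdHomotopy_zero (c : SingularChain 0 Y) : sdHomotopy 0 Y c = 0 := by
  refine LinearMap.congr_fun (f := sdHomotopy 0 Y) (g := 0) (hom_ext_single fun σ => ?_) c
  rw [sdHomotopy_single, sdHomotopyModel, map_zero]
  rfl

lemma boundary_sdHomotopy_of_model {n : ℕ}
    (h : boundary (n + 1) _ (sdHomotopyModel (n + 1)) = sdModel (n + 1) + universal (n + 1) +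
      sdHomotopy n _ (boundary n _ (universal (n + 1)))) (c : SingularChain (n + 1) Y) :
    boundary (n + 1) Y (sdHomotopy (n + 1) Y c) =
      sd (n + 1) Y c + c + sdHomotopy n Y (boundary n Y c) := by
  refine LinearMap.congr_fun (f := boundary (n + 1) Y ∘ₗ sdHomotopy (n + 1) Y)
    (g := sd (n + 1) Y + LinearMap.id + sdHomotopy n Y ∘ₗ boundary n Y)
    (hom_ext_single fun σ => ?_) c
  simp only [LinearMap.comp_apply, LinearMap.add_apply, LinearMap.id_apply]
  rw [sdHomotopy_single, ← push_boundary, h, map_add, map_add, push_sdHomotopy,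
    push_boundary, push_universal, sd_single]

lemma boundary_sdHomotopyModel (n : ℕ) :
    boundary (n + 1) _ (sdHomotopyModel (n + 1)) = sdModel (n + 1) + universal (n + 1) +
      sdHomotopy n _ (boundary n _ (universal (n + 1))) := by
  -- The chain to be coned off is a cycle: writing `T` for the homotopy, the formula one dimension
  -- lower gives `∂ T ∂ = sd ∂ + ∂ + T ∂ ∂ = sd ∂ + ∂`, and this cancels the boundaries of the first
  -- two terms.
  have key : boundary n _ (sdModel (n + 1) + universal (n + 1) +
      sdHomotopy n _ (boundary n _ (universal (n + 1)))) = 0 := by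
    cases n with
    | zero =>
      rw [sdHomotopy_zero, add_zero, map_add, boundary_sdModel, sd_zero, ZModModule.add_self]
    | succ n =>
      rw [map_add, map_add, boundary_sdModel,
        boundary_sdHomotopy_of_model (boundary_sdHomotopyModel n), boundary_boundary, map_zero,
        add_zero, ZModModule.add_self]
  rw [sdHomotopyModel_succ, Contraction.boundary_coneChain_succ, key, map_zero, add_zero]

lemma boundary_sdHomotopy {n : ℕ} (c : SingularChain (n + 1) Y) :
    boundary (n + 1) Y (sdHomotopy (n + 1) Y c) =
      sd (n + 1) Y c + c + sdHomotopy n Y (boundary n Y c) :=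
  boundary_sdHomotopy_of_model (boundary_sdHomotopyModel n) c

/-! ### Chains supported on a set of simplices, cycles -/

/-- The chains of simplices with values in a subset. -/
def chainsIn (n : ℕ) (P : Set Y) : Submodule (ZMod 2) (SingularChain n Y) :=
  Finsupp.supported (ZMod 2) (ZMod 2) {σ | ∀ t, σ t ∈ P}

lemma single_mem_chainsIn {n : ℕ} {P : Set Y} {σ : C(stdSimplex ℝ (Fin n), Y)}
    (h : ∀ t, σ t ∈ P) (a : ZMod 2) : Finsupp.single σ a ∈ chainsIn n P :=
  Finsupp.single_mem_supported _ _ h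

lemma chainsIn_mono {n : ℕ} {P Q : Set Y} (h : P ⊆ Q) : chainsIn n P ≤ chainsIn n Q :=
  Finsupp.supported_mono fun _ hσ t => h (hσ t)

end SingularChain

/-- A linear map on a space of finitely supported functions maps the functions supported on a set
into a submodule as soon as it does so for the basis vectors. -/
lemma Finsupp.map_mem_of_mem_supported {α M : Type*} [AddCommGroup M] [Module (ZMod 2) M]
    {f : (α →₀ ZMod 2) →ₗ[ZMod 2] M} {s : Set α} {p : Submodule (ZMod 2) M}
    (h : ∀ a ∈ s, f (Finsupp.single a 1) ∈ p) {c : α →₀ ZMod 2}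
    (hc : c ∈ Finsupp.supported (ZMod 2) (ZMod 2) s) : f c ∈ p := by
  rw [Finsupp.supported_eq_span_single] at hc
  induction hc using Submodule.span_induction with
  | mem x hx => obtain ⟨a, ha, rfl⟩ := hx; exact h a ha
  | zero => simp
  | add x y _ _ hx hy => rw [map_add]; exact add_mem hx hy
  | smul r x _ hx => rw [map_smul]; exact p.smul_mem r hx

namespace SingularChain

variable {Y Z : Type*} [TopologicalSpace Y] [TopologicalSpace Z]

lemma push_mem_supported {n m : ℕ} {a : SingularChain m (stdSimplex ℝ (Fin n))}
    {s : Set C(stdSimplex ℝ (Fin m), stdSimplex ℝ (Fin n))}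
    (ha : a ∈ Finsupp.supported (ZMod 2) (ZMod 2) s)
    {s' : Set C(stdSimplex ℝ (Fin m), Y)} {σ : C(stdSimplex ℝ (Fin n), Y)}
    (h : ∀ u ∈ s, σ.comp u ∈ s') : push m σ a ∈ Finsupp.supported (ZMod 2) (ZMod 2) s' :=
  Finsupp.map_mem_of_mem_supported (fun u hu => by
    rw [push_single]; exact Finsupp.single_mem_supported _ _ (h u hu)) ha

lemma natural_mem_chainsIn {m n : ℕ} (a : SingularChain m (stdSimplex ℝ (Fin n))) {P : Set Y}
    {c : SingularChain n Y} (hc : c ∈ chainsIn n P) : natural a Y c ∈ chainsIn m P :=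
  Finsupp.map_mem_of_mem_supported (fun σ hσ => by
    rw [natural_single, one_smul]
    exact push_mem_supported (s := Set.univ) (by simp) fun u _ t => hσ (u t)) hc

lemma sd_mem_chainsIn {n : ℕ} {P : Set Y} {c : SingularChain n Y} (hc : c ∈ chainsIn n P) :
    sd n Y c ∈ chainsIn n P := natural_mem_chainsIn _ hc

lemma iterate_sd_mem_chainsIn {n : ℕ} {P : Set Y} {c : SingularChain n Y} (hc : c ∈ chainsIn n P)
    (N : ℕ) : (sd n Y ^ N) c ∈ chainsIn n P := by
  induction N with
  | zero => simpa using hc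
  | succ N ih => rw [pow_succ']; exact sd_mem_chainsIn ih

lemma boundary_iterate_sd {n : ℕ} (c : SingularChain (n + 1) Y) (N : ℕ) :
    boundary n Y ((sd (n + 1) Y ^ N) c) = (sd n Y ^ N) (boundary n Y c) := by
  induction N with
  | zero => simp
  | succ N ih => simp only [pow_succ', Module.End.mul_apply, boundary_sd, ih]

/-- The (unaugmented) cycles of dimension `i`. -/
def cycles : (i : ℕ) → (Y : Type*) → [TopologicalSpace Y] →
    Submodule (ZMod 2) (SingularChain (i + 1) Y)
  | 0, _, _ => ⊤
  | i + 1, Y, _ => LinearMap.ker (boundary (i + 1) Y)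

lemma sd_add_self_of_mem_cycles {i : ℕ} {c : SingularChain (i + 1) Y} (hc : c ∈ cycles i Y) :
    sd (i + 1) Y c + c = boundary (i + 1) Y (sdHomotopy (i + 1) Y c) := by
  rw [boundary_sdHomotopy]
  cases i with
  | zero => rw [sdHomotopy_zero, add_zero]
  | succ i => rw [LinearMap.mem_ker.1 hc, map_zero, add_zero]

lemma iterate_sd_mem_cycles {i : ℕ} {c : SingularChain (i + 1) Y} (hc : c ∈ cycles i Y) (N : ℕ) :
    (sd (i + 1) Y ^ N) c ∈ cycles i Y := by
  cases i with
  | zero => trivial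
  | succ i => exact LinearMap.mem_ker.2 (by
      rw [boundary_iterate_sd, LinearMap.mem_ker.1 hc, map_zero])

lemma exists_iterate_sd_add_self {i : ℕ} {P : Set Y} {c : SingularChain (i + 1) Y}
    (hc : c ∈ cycles i Y) (hP : c ∈ chainsIn (i + 1) P) (N : ℕ) :
    ∃ w ∈ chainsIn (i + 2) P, boundary (i + 1) Y w = (sd (i + 1) Y ^ N) c + c := by
  induction N with
  | zero => exact ⟨0, zero_mem _, by simp [ZModModule.add_self]⟩
  | succ N ih =>
    obtain ⟨w, hw, hw'⟩ := ih
    refine ⟨sdHomotopy (i + 1) Y ((sd (i + 1) Y ^ N) c) + w,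
      add_mem (natural_mem_chainsIn _ (iterate_sd_mem_chainsIn hP N)) hw, ?_⟩
    rw [map_add, hw', ← sd_add_self_of_mem_cycles (iterate_sd_mem_cycles hc N), pow_succ',
      Module.End.mul_apply, add_assoc, ← add_assoc ((sd (i + 1) Y ^ N) c), ZModModule.add_self,
      zero_add]

/-! ### The mesh of iterated subdivisions -/

/-- The simplices of the subdivided universal simplex are affine of small diameter. -/
lemma sdModel_mem_supported (n : ℕ) : sdModel n ∈ Finsupp.supported (ZMod 2) (ZMod 2)
    {u | ∃ w, stdSimplex.IsAffine u w ∧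
      ∀ i j, stdSimplex.l1Dist (w i) (w j) ≤ 2 * ((n : ℝ) / (n + 1))} := by
  induction n with
  | zero =>
    exact Finsupp.single_mem_supported _ _ ⟨finZeroElim, fun t => isEmptyElim t, finZeroElim⟩
  | succ n ih =>
    rw [sdModel_succ]
    set s : Set C(stdSimplex ℝ (Fin n), stdSimplex ℝ (Fin (n + 1))) :=
      {u | ∃ w, stdSimplex.IsAffine u w ∧
        ∀ i j, stdSimplex.l1Dist (w i) (w j) ≤ 2 * ((n : ℝ) / (n + 1))} with hs
    -- The bound increases with the dimension, so edges within a face still satisfy it; the new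
    -- edges all end at the barycentre.
    have hr : (n : ℝ) / (n + 1) ≤ (n + 1) / (n + 1 + 1) := by
      rw [div_le_div_iff₀ (by positivity) (by positivity)]; nlinarith
    have h1 : sd n _ (boundary n _ (universal (n + 1))) ∈
        Finsupp.supported (ZMod 2) (ZMod 2) s := by
      rw [universal, boundary_single, map_sum]
      refine Submodule.sum_mem _ fun i _ => ?_
      rw [sd_single]
      refine push_mem_supported ih ?_
      rintro u ⟨w, hw, hw'⟩
      exact ⟨_, hw.face_comp i, fun j k => by rw [stdSimplex.l1Dist_face]; exact hw' j k⟩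
    refine Finsupp.map_mem_of_mem_supported ?_ h1
    rintro u ⟨w, hw, hw'⟩
    rw [Contraction.coneChain_single]
    refine Finsupp.single_mem_supported _ _ ⟨_, hw.cone, fun i j => ?_⟩
    push_cast
    refine le_trans ?_ (mul_le_mul_of_nonneg_left hr zero_le_two)
    refine Fin.cases ?_ (fun i => ?_) i <;> refine Fin.cases ?_ (fun j => ?_) j
    · simp only [Fin.cons_zero, stdSimplex.l1Dist_self]; positivity
    · exact stdSimplex.l1Dist_barycenter_le _
    · rw [stdSimplex.l1Dist_comm]; exact stdSimplex.l1Dist_barycenter_le _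
    · exact hw' i j

/-- The iterated subdivision of a simplex consists of restrictions of it along strong
contractions. -/
lemma iterate_sd_single_mem {n : ℕ} (σ : C(stdSimplex ℝ (Fin n), Y)) (N : ℕ) :
    (sd n Y ^ N) (Finsupp.single σ 1) ∈ Finsupp.supported (ZMod 2) (ZMod 2)
      {τ | ∃ u : C(stdSimplex ℝ (Fin n), stdSimplex ℝ (Fin n)), τ = σ.comp u ∧
        ∀ x y, stdSimplex.l1Dist (u x) (u y) ≤
          ((n : ℝ) / (n + 1)) ^ N * stdSimplex.l1Dist x y} := by
  induction N with
  | zero => exact Finsupp.single_mem_supported _ _ ⟨ContinuousMap.id _, rfl, by simp⟩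
  | succ N ih =>
    rw [pow_succ' (sd n Y), Module.End.mul_apply]
    refine Finsupp.map_mem_of_mem_supported ?_ ih
    rintro _ ⟨v, rfl, hv⟩
    rw [sd_single]
    refine push_mem_supported (sdModel_mem_supported n) ?_
    rintro u ⟨w, hw, hw'⟩
    refine ⟨v.comp u, rfl, fun x y => (hv _ _).trans ?_⟩
    rw [pow_succ, mul_assoc]
    exact mul_le_mul_of_nonneg_left (hw.l1Dist_le hw' x y) (by positivity)

end SingularChain

namespace SingularChain

variable {Y : Type*} [PseudoMetricSpace Y]

/-- The simplices of diameter less than `δ`. -/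
def smallSimplices (n : ℕ) (Y : Type*) [PseudoMetricSpace Y] (δ : ℝ) :
    Set C(stdSimplex ℝ (Fin n), Y) :=
  {σ | ∀ x y, dist (σ x) (σ y) < δ}

/-- Singular simplices are uniformly continuous and the contraction factors tend to `0`. Having all
`N ≥ N₀` makes the claim additive in the chain. -/
lemma exists_iterate_sd_small {n : ℕ} (c : SingularChain n Y) {δ : ℝ} (hδ : 0 < δ) :
    ∃ N₀, ∀ N ≥ N₀,
      (sd n Y ^ N) c ∈ Finsupp.supported (ZMod 2) (ZMod 2) (smallSimplices n Y δ) := by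
  induction c using Finsupp.induction_linear with
  | zero => exact ⟨0, fun N _ => by simp⟩
  | add f g hf hg =>
    obtain ⟨a, ha⟩ := hf
    obtain ⟨b, hb⟩ := hg
    refine ⟨max a b, fun N hN => ?_⟩
    rw [map_add]
    exact add_mem (ha N (le_trans (le_max_left _ _) hN)) (hb N (le_trans (le_max_right _ _) hN))
  | single σ r =>
    obtain ⟨η, hη, h⟩ := Metric.uniformContinuous_iff.1
      (CompactSpace.uniformContinuous_of_continuous σ.continuous) δ hδ
    have hlim : Filter.Tendsto (fun N : ℕ => ((n : ℝ) / (n + 1)) ^ N) Filter.atTop (nhds 0) :=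
      tendsto_pow_atTop_nhds_zero_of_lt_one (by positivity)
        ((div_lt_one (by positivity)).2 (by linarith))
    -- Half of `η` suffices because the `ℓ¹`-diameter of a simplex is at most `2`.
    obtain ⟨N₀, hN₀⟩ := Filter.eventually_atTop.1 (hlim.eventually (gt_mem_nhds (half_pos hη)))
    refine ⟨N₀, fun N hN => ?_⟩
    rw [show Finsupp.single σ r = r • Finsupp.single σ (1 : ZMod 2) by simp, map_smul]
    refine Submodule.smul_mem _ _ (Finsupp.supported_mono ?_ (iterate_sd_single_mem σ N))
    rintro _ ⟨u, rfl, hu⟩ x y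
    refine h (lt_of_le_of_lt (stdSimplex.dist_le_l1Dist _ _) ((hu x y).trans_lt ?_))
    have h1 := hN₀ N hN
    have h2 : (0 : ℝ) ≤ ((n : ℝ) / (n + 1)) ^ N := by positivity
    nlinarith [stdSimplex.l1Dist_le_two x y]

end SingularChain

/-! ### Simplicial chains modulo two, with finite sets as simplices -/

namespace FinsetChain

open Classical in
/-- The (augmented) boundary modulo two of a chain of finite sets. -/
def boundary (α : Type*) : (Finset α →₀ ZMod 2) →ₗ[ZMod 2] (Finset α →₀ ZMod 2) :=
  Finsupp.linearCombination (ZMod 2) fun s => ∑ v ∈ s, Finsupp.single (s.erase v) 1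

variable {α : Type*}

open Classical in
lemma boundary_single (s : Finset α) :
    boundary α (Finsupp.single s 1) = ∑ v ∈ s, Finsupp.single (s.erase v) 1 := by
  simp [boundary]

lemma boundary_boundary (c : Finset α →₀ ZMod 2) : boundary α (boundary α c) = 0 := by
  classical
  refine LinearMap.congr_fun (f := boundary α ∘ₗ boundary α) (g := 0)
    (Finsupp.lhom_ext' fun s => LinearMap.ext_ring ?_) c
  change boundary α (boundary α (Finsupp.single s 1)) = 0
  simp only [boundary_single, map_sum]
  rw [Finset.sum_sigma']
  refine Finset.sum_involution (fun x _ => ⟨x.2, x.1⟩) ?_ ?_ ?_ ?_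
  · rintro ⟨v, w⟩ -
    simp only [Finset.erase_right_comm (a := v) (b := w)]
    exact ZModModule.add_self _
  · rintro ⟨v, w⟩ h - h'
    simp only [Finset.mem_sigma, Finset.mem_erase] at h
    exact h.2.1 (congrArg Sigma.fst h')
  · rintro ⟨v, w⟩ h
    simp only [Finset.mem_sigma, Finset.mem_erase] at h ⊢
    exact ⟨h.2.2, h.2.1.symm, h.1⟩
  · rintro ⟨v, w⟩ -
    rfl

open Classical in
/-- The cone with apex `v`. -/
def cone (v : α) : (Finset α →₀ ZMod 2) →ₗ[ZMod 2] (Finset α →₀ ZMod 2) :=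
  Finsupp.linearCombination (ZMod 2) fun s => if v ∈ s then 0 else Finsupp.single (insert v s) 1

open Classical in
lemma cone_single (v : α) (s : Finset α) :
    cone v (Finsupp.single s 1) = if v ∈ s then 0 else Finsupp.single (insert v s) 1 := by
  simp [cone]

/-- No condition on `c` is needed: if `v` is already a vertex of a simplex, its cone is zero, and
among its faces only the one opposite `v` has a non-zero cone, namely the simplex. -/
lemma boundary_cone (v : α) (c : Finset α →₀ ZMod 2) :
    boundary α (cone v c) = c + cone v (boundary α c) := by
  classical
  refine LinearMap.congr_fun (f := boundary α ∘ₗ cone v) (g := LinearMap.id + cone v ∘ₗ boundary α)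
    (Finsupp.lhom_ext' fun s => LinearMap.ext_ring ?_) c
  change boundary α (cone v (Finsupp.single s 1)) =
    Finsupp.single s 1 + cone v (boundary α (Finsupp.single s 1))
  by_cases h : v ∈ s
  · rw [cone_single, if_pos h, map_zero, boundary_single, map_sum,
      Finset.sum_eq_single_of_mem v h, cone_single, if_neg (Finset.notMem_erase v s),
      Finset.insert_erase h, ZModModule.add_self]
    intro w hw hwv
    rw [cone_single, if_pos (Finset.mem_erase.2 ⟨hwv.symm, h⟩)]
  · rw [cone_single, if_neg h, boundary_single, boundary_single, Finset.sum_insert h,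
      Finset.erase_insert h, map_sum]
    congr 1
    refine Finset.sum_congr rfl fun w hw => ?_
    have hvw : v ≠ w := fun e => h (e ▸ hw)
    rw [cone_single, if_neg (fun h' => h (Finset.mem_of_mem_erase h')),
      Finset.erase_insert_of_ne hvw]

open Classical in
/-- The simplex spanned by a tuple of vertices, or zero if it is degenerate. -/
def tuple {n : ℕ} (w : Fin n → α) : Finset α →₀ ZMod 2 :=
  if Function.Injective w then Finsupp.single (Finset.univ.image w) 1 else 0

/-- If `w a = w b` with `a ≠ b`, omitting any other index leaves a repetition, while omitting `a` or
`b` gives the same simplex, or zero both times; these two terms cancel modulo two. -/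
lemma boundary_tuple {n : ℕ} (w : Fin (n + 1) → α) :
    boundary α (tuple w) = ∑ i : Fin (n + 1), tuple (w ∘ i.succAbove) := by
  classical
  have himage : ∀ i : Fin (n + 1), Finset.univ.image (w ∘ i.succAbove) =
      (Finset.univ.erase i).image w := fun i => by
    rw [← Finset.image_image]
    congr 1
    ext k
    simp
  by_cases hw : Function.Injective w
  · rw [tuple, if_pos hw, boundary_single, Finset.sum_image hw.injOn]
    refine Finset.sum_congr rfl fun i _ => ?_
    rw [tuple, if_pos (hw.comp Fin.succAbove_right_injective), himage, Finset.image_erase hw]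
  · rw [tuple, if_neg hw, map_zero]
    obtain ⟨a, b, hab, hne⟩ : ∃ a b, w a = w b ∧ a ≠ b := by
      simpa [Function.Injective] using hw
    symm
    rw [← Finset.sum_subset (Finset.subset_univ {a, b}), Finset.sum_pair hne]
    · have aux : ∀ {a b : Fin (n + 1)}, w a = w b → a ≠ b →
          Function.Injective (w ∘ a.succAbove) → Function.Injective (w ∘ b.succAbove) := by
        intro a b hab hne h
        have h' : ∀ k l, k ≠ a → l ≠ a → w k = w l → k = l := by
          intro k l hk hl hkl
          obtain ⟨k, rfl⟩ := Fin.exists_succAbove_eq hk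
          obtain ⟨l, rfl⟩ := Fin.exists_succAbove_eq hl
          rw [h hkl]
        intro k l hkl
        refine Fin.succAbove_right_injective (p := b) ?_
        have hk := Fin.succAbove_ne b k
        have hl := Fin.succAbove_ne b l
        change w (b.succAbove k) = w (b.succAbove l) at hkl
        by_cases hka : b.succAbove k = a <;> by_cases hla : b.succAbove l = a
        · rw [hka, hla]
        · exact absurd (h' _ _ hla hne.symm (by rw [← hkl, hka, hab])) hl
        · exact absurd (h' _ _ hka hne.symm (by rw [hkl, hla, hab])) hk
        · exact h' _ _ hka hla hkl
      have himg : (Finset.univ.erase a).image w = (Finset.univ.erase b).image w := by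
        have aux' : ∀ {a b : Fin (n + 1)}, w a = w b → a ≠ b →
            (Finset.univ.erase a).image w ⊆ (Finset.univ.erase b).image w := by
          intro a b hab hne x hx
          simp only [Finset.mem_image, Finset.mem_erase, Finset.mem_univ, and_true] at hx ⊢
          obtain ⟨k, hk, rfl⟩ := hx
          by_cases hkb : k = b
          · exact ⟨a, hne, by rw [hab, hkb]⟩
          · exact ⟨k, hkb, rfl⟩
        exact (aux' hab hne).antisymm (aux' hab.symm hne.symm)
      by_cases h : Function.Injective (w ∘ a.succAbove)
      · rw [tuple, if_pos h, tuple, if_pos (aux hab hne h), himage, himage, himg,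
          ZModModule.add_self]
      · rw [tuple, if_neg h, tuple, if_neg fun h' => h (aux hab.symm hne.symm h'), add_zero]
    · intro i _ hi
      simp only [Finset.mem_insert, Finset.mem_singleton, not_or] at hi
      rw [tuple, if_neg]
      intro h
      obtain ⟨k, hk⟩ := Fin.exists_succAbove_eq (Ne.symm hi.1)
      obtain ⟨l, hl⟩ := Fin.exists_succAbove_eq (Ne.symm hi.2)
      refine hne ?_
      rw [← hk, ← hl, h (show (w ∘ i.succAbove) k = (w ∘ i.succAbove) l by simp [hk, hl, hab])]

lemma tuple_mem_supported {n : ℕ} {w : Fin n → α} {s : Set (Finset α)}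
    (h : ∀ t : Finset α, (∀ a, a ∈ t ↔ ∃ j, w j = a) → t.card = n → t ∈ s) :
    tuple w ∈ Finsupp.supported (ZMod 2) (ZMod 2) s := by
  classical
  rw [tuple]
  split_ifs with hw
  · refine Finsupp.single_mem_supported _ _ (h _ (fun a => by simp) ?_)
    rw [Finset.card_image_of_injective _ hw, Finset.card_univ, Fintype.card_fin]
  · exact zero_mem _

end FinsetChain

namespace SingularChain

variable {Y : Type*} [TopologicalSpace Y] {α : Type*}

/-- The simplicial chain obtained from a singular chain by labelling the vertices. -/
def label (v : Y → α) (n : ℕ) : SingularChain n Y →ₗ[ZMod 2] (Finset α →₀ ZMod 2) :=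
  Finsupp.linearCombination (ZMod 2) fun σ => FinsetChain.tuple fun j => v (σ (stdSimplex.vertex j))

lemma label_single (v : Y → α) {n : ℕ} (σ : C(stdSimplex ℝ (Fin n), Y)) :
    label v n (Finsupp.single σ 1) = FinsetChain.tuple fun j => v (σ (stdSimplex.vertex j)) := by
  simp [label]

lemma boundary_label (v : Y → α) {n : ℕ} (c : SingularChain (n + 1) Y) :
    FinsetChain.boundary α (label v (n + 1) c) = label v n (boundary n Y c) := by
  refine LinearMap.congr_fun (f := FinsetChain.boundary α ∘ₗ label v (n + 1))
    (g := label v n ∘ₗ boundary n Y) (hom_ext_single fun σ => ?_) c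
  rw [LinearMap.comp_apply, LinearMap.comp_apply, label_single, FinsetChain.boundary_tuple,
    boundary_single, map_sum]
  refine Finset.sum_congr rfl fun i _ => ?_
  rw [label_single]
  congr 1
  funext j
  change _ = v (σ (stdSimplex.map _ _))
  rw [stdSimplex.map_vertex]
  rfl

end SingularChain

/-! ### Acyclic carriers -/

/-- Two chain maps modulo two with a common acyclic carrier are homotopic; here `f` is the sum of
the two maps, and the carrier is only given on a family `P` of basis elements. -/
lemma exists_homotopy_of_acyclic_carrier {β D : ℕ → Type*} [∀ n, AddCommGroup (D n)]
    [∀ n, Module (ZMod 2) (D n)] (dβ : ∀ n, (β (n + 1) →₀ ZMod 2) →ₗ[ZMod 2] (β n →₀ ZMod 2))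
    (hdβ : ∀ n c, dβ n (dβ (n + 1) c) = 0) (dD : ∀ n, D (n + 1) →ₗ[ZMod 2] D n)
    (P : ∀ n, Set (β n)) (C : ∀ n, β n → ∀ m, Submodule (ZMod 2) (D m))
    (hP : ∀ n, ∀ b ∈ P (n + 1), dβ n (Finsupp.single b 1) ∈
      Finsupp.supported (ZMod 2) (ZMod 2) {b' | b' ∈ P n ∧ ∀ m, C n b' m ≤ C (n + 1) b m})
    (hC : ∀ n, ∀ b ∈ P (n + 1), ∀ z ∈ C (n + 1) b (n + 1), dD n z = 0 →
      ∃ w ∈ C (n + 1) b (n + 2), dD (n + 1) w = z)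
    (f : ∀ n, (β n →₀ ZMod 2) →ₗ[ZMod 2] D n) (hf : ∀ n c, dD n (f (n + 1) c) = f n (dβ n c))
    (hf0 : ∀ b ∈ P 0, f 0 (Finsupp.single b 1) = 0)
    (hfC : ∀ n, ∀ b ∈ P n, f n (Finsupp.single b 1) ∈ C n b n) (n : ℕ) :
    ∃ (h : (β n →₀ ZMod 2) →ₗ[ZMod 2] D (n + 1))
      (h' : (β (n + 1) →₀ ZMod 2) →ₗ[ZMod 2] D (n + 2)),
      (∀ b ∈ P (n + 1), h' (Finsupp.single b 1) ∈ C (n + 1) b (n + 2)) ∧ (n = 0 → h = 0) ∧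
      ∀ c ∈ Finsupp.supported (ZMod 2) (ZMod 2) (P (n + 1)),
        f (n + 1) c = dD (n + 1) (h' c) + h (dβ n c) := by
  -- The homotopy is extended by choosing, for each basis element in `P`, a filling inside its
  -- acyclic carrier.
  have step : ∀ (n : ℕ) (h : (β n →₀ ZMod 2) →ₗ[ZMod 2] D (n + 1))
      (_ : ∀ b ∈ P (n + 1), f (n + 1) (Finsupp.single b 1) + h (dβ n (Finsupp.single b 1)) ∈
        C (n + 1) b (n + 1))
      (_ : ∀ b ∈ P (n + 1), dD n (f (n + 1) (Finsupp.single b 1) +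
        h (dβ n (Finsupp.single b 1))) = 0),
      ∃ h' : (β (n + 1) →₀ ZMod 2) →ₗ[ZMod 2] D (n + 2),
        (∀ b ∈ P (n + 1), h' (Finsupp.single b 1) ∈ C (n + 1) b (n + 2)) ∧
        ∀ c ∈ Finsupp.supported (ZMod 2) (ZMod 2) (P (n + 1)),
          f (n + 1) c = dD (n + 1) (h' c) + h (dβ n c) := by
    intro n h h1 h2
    choose! w hw hw' using fun b (hb : b ∈ P (n + 1)) => hC n b hb _ (h1 b hb) (h2 b hb)
    refine ⟨Finsupp.linearCombination (ZMod 2) w, fun b hb => by simpa using hw b hb,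
      fun c hc => ?_⟩
    refine sub_eq_zero.1 ((Submodule.mem_bot (ZMod 2)).1 (Finsupp.map_mem_of_mem_supported
      (f := f (n + 1) - (dD (n + 1) ∘ₗ Finsupp.linearCombination (ZMod 2) w + h ∘ₗ dβ n))
      (p := ⊥) (fun b hb => ?_) hc))
    simp only [LinearMap.sub_apply, LinearMap.add_apply, LinearMap.comp_apply,
      Finsupp.linearCombination_single, one_smul, hw' b hb, Submodule.mem_bot]
    rw [add_assoc, ZModModule.add_self, add_zero, sub_self]
  induction n with
  | zero =>
    -- The homotopy may start with zero, because `f` vanishes on `P 0`. Recording this makes the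
    -- result usable for unaugmented cycles of dimension `0`, whose augmented boundary need not
    -- vanish.
    obtain ⟨h', h1, h2⟩ := step 0 0 (fun b hb => by simpa using hfC 1 b hb) (fun b hb => by
      rw [LinearMap.zero_apply, add_zero, hf]
      exact (Submodule.mem_bot (ZMod 2)).1 (Finsupp.map_mem_of_mem_supported
        (fun b' hb' => (Submodule.mem_bot _).2 (hf0 b' hb'.1)) (hP 0 b hb)))
    exact ⟨0, h', h1, fun _ => rfl, h2⟩
  | succ n ih =>
    obtain ⟨h, h', h1, -, h2⟩ := ih
    have carried : ∀ b ∈ P (n + 2), f (n + 2) (Finsupp.single b 1) +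
        h' (dβ (n + 1) (Finsupp.single b 1)) ∈ C (n + 2) b (n + 2) := fun b hb =>
      add_mem (hfC _ b hb) (Finsupp.map_mem_of_mem_supported
        (fun b' hb' => hb'.2 _ (h1 b' hb'.1)) (hP _ b hb))
    have closed : ∀ b ∈ P (n + 2), dD (n + 1) (f (n + 2) (Finsupp.single b 1) +
        h' (dβ (n + 1) (Finsupp.single b 1))) = 0 := fun b hb => by
      have hs := h2 _ (Finsupp.supported_mono (fun b' hb' => hb'.1) (hP _ b hb))
      rw [hdβ, map_zero, add_zero] at hs
      rw [map_add, hf, hs, ZModModule.add_self]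
    obtain ⟨h'', h3, h4⟩ := step (n + 1) h' carried closed
    exact ⟨h', h'', h3, fun h => absurd h (Nat.succ_ne_zero n), h4⟩

/-- The form of `exists_homotopy_of_acyclic_carrier` for a cycle, or for a chain of the lowest
dimension. -/
lemma exists_boundary_eq_of_acyclic_carrier {β D : ℕ → Type*} [∀ n, AddCommGroup (D n)]
    [∀ n, Module (ZMod 2) (D n)] (dβ : ∀ n, (β (n + 1) →₀ ZMod 2) →ₗ[ZMod 2] (β n →₀ ZMod 2))
    (hdβ : ∀ n c, dβ n (dβ (n + 1) c) = 0) (dD : ∀ n, D (n + 1) →ₗ[ZMod 2] D n)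
    (P : ∀ n, Set (β n)) (C : ∀ n, β n → ∀ m, Submodule (ZMod 2) (D m))
    (hP : ∀ n, ∀ b ∈ P (n + 1), dβ n (Finsupp.single b 1) ∈
      Finsupp.supported (ZMod 2) (ZMod 2) {b' | b' ∈ P n ∧ ∀ m, C n b' m ≤ C (n + 1) b m})
    (hC : ∀ n, ∀ b ∈ P (n + 1), ∀ z ∈ C (n + 1) b (n + 1), dD n z = 0 →
      ∃ w ∈ C (n + 1) b (n + 2), dD (n + 1) w = z)
    (f : ∀ n, (β n →₀ ZMod 2) →ₗ[ZMod 2] D n) (hf : ∀ n c, dD n (f (n + 1) c) = f n (dβ n c))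
    (hf0 : ∀ b ∈ P 0, f 0 (Finsupp.single b 1) = 0)
    (hfC : ∀ n, ∀ b ∈ P n, f n (Finsupp.single b 1) ∈ C n b n) {n : ℕ}
    {Q : Submodule (ZMod 2) (D (n + 2))} (hQ : ∀ b ∈ P (n + 1), C (n + 1) b (n + 2) ≤ Q)
    {c : β (n + 1) →₀ ZMod 2} (hc : c ∈ Finsupp.supported (ZMod 2) (ZMod 2) (P (n + 1)))
    (hc' : n = 0 ∨ dβ n c = 0) : ∃ w ∈ Q, dD (n + 1) w = f (n + 1) c := by
  obtain ⟨h, h', h1, h0, h2⟩ :=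
    exists_homotopy_of_acyclic_carrier dβ hdβ dD P C hP hC f hf hf0 hfC n
  refine ⟨h' c, Finsupp.map_mem_of_mem_supported (fun b hb => hQ b hb (h1 b hb)) hc, ?_⟩
  rw [h2 c hc]
  rcases hc' with hn | hc'
  · rw [h0 hn, LinearMap.zero_apply, add_zero]
  · rw [hc', map_zero, add_zero]

lemma submoduleOf_le_comap_restrict {R A A' : Type*} [Ring R] [AddCommGroup A] [Module R A]
    [AddCommGroup A'] [Module R A'] (f : A →ₗ[R] A') {Z B : Submodule R A} {Z' B' : Submodule R A'}
    (hZ : ∀ z ∈ Z, f z ∈ Z') (hB : ∀ z ∈ B, f z ∈ B') :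
    B.submoduleOf Z ≤ (B'.submoduleOf Z').comap (f.restrict hZ) := fun z hz => hB z.1 hz

/-- The quotient of a submodule by (its intersection with) another one. -/
abbrev Subquotient {R A : Type*} [Ring R] [AddCommGroup A] [Module R A] (Z B : Submodule R A) :
    Type _ := Z ⧸ B.submoduleOf Z

/-- Linear maps which induce a bijection of subquotients give a linear equivalence of them. -/
def subquotientEquiv {R A A' : Type*} [Ring R] [AddCommGroup A] [Module R A] [AddCommGroup A']
    [Module R A'] (f : A →ₗ[R] A') {Z B : Submodule R A} {Z' B' : Submodule R A'}
    (hZ : ∀ z ∈ Z, f z ∈ Z') (hB : ∀ z ∈ B, f z ∈ B') (hinj : ∀ z ∈ Z, f z ∈ B' → z ∈ B)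
    (hsurj : ∀ z' ∈ Z', ∃ z ∈ Z, f z - z' ∈ B') :
    Subquotient Z B ≃ₗ[R] Subquotient Z' B' :=
  LinearEquiv.ofBijective
    (Submodule.mapQ (B.submoduleOf Z) (B'.submoduleOf Z') (f.restrict hZ)
      (submoduleOf_le_comap_restrict f hZ hB)) (by
      constructor
      · rw [← LinearMap.ker_eq_bot, LinearMap.ker_eq_bot']
        intro x hx
        obtain ⟨z, rfl⟩ := Submodule.Quotient.mk_surjective _ x
        rw [Submodule.mapQ_apply, Submodule.Quotient.mk_eq_zero] at hx
        exact (Submodule.Quotient.mk_eq_zero _).2 (hinj z.1 z.2 hx)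
      · intro x
        obtain ⟨z', rfl⟩ := Submodule.Quotient.mk_surjective _ x
        obtain ⟨z, hz, hz'⟩ := hsurj z'.1 z'.2
        refine ⟨Submodule.Quotient.mk ⟨z, hz⟩, ?_⟩
        rw [Submodule.mapQ_apply]
        exact (Submodule.Quotient.eq _).2 hz')

/-! ### The comparison of simplicial and singular homology -/

section Affine

variable {E : Type*} [NormedAddCommGroup E] [NormedSpace ℝ E]

/-- The straight-line contraction of a normed space to a point. -/
def lineContraction (p : E) : Contraction E where
  toMap := ⟨fun x => p + (x.2 : ℝ) • (x.1 - p), by fun_prop⟩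
  pt := p
  map_zero y := by simp
  map_one y := by simp

lemma lineContraction_apply (p y : E) (r : unitInterval) :
    (lineContraction p).toMap (y, r) = p + (r : ℝ) • (y - p) := rfl

namespace SingularChain

lemma coneChain_mem_chainsIn {p : E} {P : Set E} (hP : StarConvex ℝ p P) (hp : p ∈ P) {n : ℕ}
    {c : SingularChain n E} (hc : c ∈ chainsIn n P) :
    (lineContraction p).coneChain n c ∈ chainsIn (n + 1) P := by
  refine Finsupp.map_mem_of_mem_supported (fun σ hσ => ?_) hc
  rw [Contraction.coneChain_single]
  refine single_mem_chainsIn (fun t => ?_) _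
  cases n with
  | zero => exact hp
  | succ n =>
    obtain ⟨⟨t, r⟩, rfl⟩ := stdSimplex.join_surjective t
    rw [Contraction.cone_join, lineContraction_apply]
    have := hP (hσ t) (sub_nonneg.2 r.2.2) r.2.1 (sub_add_cancel 1 (r : ℝ))
    convert this using 1
    module

lemma exists_boundary_eq_of_starConvex {p : E} {P : Set E} (hP : StarConvex ℝ p P) (hp : p ∈ P)
    {n : ℕ} {z : SingularChain (n + 1) E} (hz : z ∈ chainsIn (n + 1) P)
    (hz' : boundary n E z = 0) : ∃ w ∈ chainsIn (n + 2) P, boundary (n + 1) E w = z :=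
  ⟨_, coneChain_mem_chainsIn hP hp hz, by
    rw [Contraction.boundary_coneChain_succ, hz', map_zero, add_zero]⟩

end SingularChain

namespace FinsetChain

open SingularChain (chainsIn)

open Classical in
/-- A vertex of a non-empty finite set. -/
def apex (s : Finset E) : E := if h : s.Nonempty then h.choose else 0

omit [NormedSpace ℝ E] in
lemma apex_mem {s : Finset E} (h : s.Nonempty) : apex s ∈ s := by
  rw [apex, dif_pos h]; exact h.choose_spec

open Classical in
/-- The affine realisation of simplicial chains, built by coning off the boundary of a simplex. -/
def realize : (n : ℕ) → (Finset E →₀ ZMod 2) →ₗ[ZMod 2] SingularChain n E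
  | 0 => Finsupp.linearCombination (ZMod 2) fun s =>
      if s = ∅ then Finsupp.single ⟨isEmptyElim, continuous_of_discreteTopology⟩ 1 else 0
  | n + 1 => Finsupp.linearCombination (ZMod 2) fun s =>
      (lineContraction (apex s)).coneChain n (realize n (boundary E (Finsupp.single s 1)))

lemma realize_succ_single (n : ℕ) (s : Finset E) : realize (n + 1) (Finsupp.single s 1) =
    (lineContraction (apex s)).coneChain n (realize n (boundary E (Finsupp.single s 1))) := by
  simp [realize]

/-- By induction the realised boundary of a simplex is a cycle, so its cone fills it. Cardinalities
play no role here; they only matter for the carrier in `realize_single_mem`. -/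
lemma boundary_realize (n : ℕ) (c : Finset E →₀ ZMod 2) :
    SingularChain.boundary n E (realize (n + 1) c) = realize n (boundary E c) := by
  induction n generalizing c with
  | zero =>
    refine LinearMap.congr_fun (f := SingularChain.boundary 0 E ∘ₗ realize 1)
      (g := realize 0 ∘ₗ boundary E) (Finsupp.lhom_ext' fun s => LinearMap.ext_ring ?_) c
    change SingularChain.boundary 0 E (realize 1 (Finsupp.single s 1)) =
      realize 0 (boundary E (Finsupp.single s 1))
    rw [realize_succ_single, Contraction.boundary_coneChain_zero]
  | succ n ih =>
    refine LinearMap.congr_fun (f := SingularChain.boundary (n + 1) E ∘ₗ realize (n + 2))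
      (g := realize (n + 1) ∘ₗ boundary E) (Finsupp.lhom_ext' fun s => LinearMap.ext_ring ?_) c
    change SingularChain.boundary (n + 1) E (realize (n + 2) (Finsupp.single s 1)) =
      realize (n + 1) (boundary E (Finsupp.single s 1))
    rw [realize_succ_single, Contraction.boundary_coneChain_succ, ih, boundary_boundary, map_zero,
      map_zero, add_zero]

lemma boundary_single_mem_supported {α : Type*} {s : Finset α} {S : Set (Finset α)}
    (h : ∀ t ⊆ s, t.card + 1 = s.card → t ∈ S) :
    boundary α (Finsupp.single s 1) ∈ Finsupp.supported (ZMod 2) (ZMod 2) S := by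
  classical
  rw [boundary_single]
  refine Submodule.sum_mem _ fun v hv => Finsupp.single_mem_supported _ _
    (h _ (Finset.erase_subset v s) (Finset.card_erase_add_one hv))

lemma realize_single_mem {n : ℕ} {s : Finset E} (hs : s.card = n) :
    realize n (Finsupp.single s 1) ∈ chainsIn n (convexHull ℝ (s : Set E)) := by
  induction n generalizing s with
  | zero => exact fun σ _ t => isEmptyElim t
  | succ n ih =>
    have hne : s.Nonempty := Finset.card_pos.1 (by omega)
    have hv : apex s ∈ convexHull ℝ (s : Set E) := subset_convexHull ℝ _ (apex_mem hne)
    rw [realize_succ_single]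
    refine SingularChain.coneChain_mem_chainsIn ((convex_convexHull ℝ _).starConvex hv) hv ?_
    refine Finsupp.map_mem_of_mem_supported (s := {t | t ⊆ s ∧ t.card = n}) (fun t ht => ?_)
      (boundary_single_mem_supported fun t ht ht' => ⟨ht, by omega⟩)
    exact SingularChain.chainsIn_mono (convexHull_mono (by exact_mod_cast ht.1)) (ih ht.2)

end FinsetChain

end Affine

/-! ### Star labellings, and the comparison for a finite complex -/

namespace Geometry.SimplicialComplex

variable {E : Type*} [NormedAddCommGroup E] [NormedSpace ℝ E] (K : SimplicialComplex ℝ E)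

/-- A labelling of the points of a complex by vertices such that the open star of the label
contains all points at distance less than `δ`. -/
def IsStarLabelling (v : E → E) (δ : ℝ) : Prop :=
  ∀ x ∈ K.space, ∀ y ∈ K.space, dist x y < δ → ∀ t ∈ K.faces, y ∈ convexHull ℝ (t : Set E) → v x ∈ t

variable {K}

/-- Take a face of least cardinality around `x`: its intersection with any other face around `x` is
again such a face, so minimality forces equality. -/
lemma exists_carrier {x : E} (hx : x ∈ K.space) : ∃ s ∈ K.faces, x ∈ convexHull ℝ (s : Set E) ∧
    ∀ t ∈ K.faces, x ∈ convexHull ℝ (t : Set E) → s ⊆ t := by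
  classical
  have hex : ∃ n, ∃ s ∈ K.faces, x ∈ convexHull ℝ (s : Set E) ∧ s.card = n := by
    obtain ⟨s, hs, hxs⟩ := mem_space_iff.1 hx
    exact ⟨_, s, hs, hxs, rfl⟩
  obtain ⟨s, hs, hxs, hcard⟩ := Nat.find_spec hex
  refine ⟨s, hs, hxs, fun t ht hxt => ?_⟩
  have hst := K.inter_subset_convexHull hs ht ⟨hxs, hxt⟩
  rw [← Finset.coe_inter] at hst
  have hne : (s ∩ t).Nonempty := by
    rw [← Finset.coe_nonempty, ← convexHull_nonempty_iff (𝕜 := ℝ)]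
    exact ⟨x, hst⟩
  have hmin := Nat.find_min' hex
    ⟨s ∩ t, K.down_closed hs Finset.inter_subset_left hne, hst, rfl⟩
  rw [← hcard] at hmin
  exact Finset.inter_eq_left.1 (Finset.eq_of_subset_of_card_le Finset.inter_subset_left hmin)

lemma isCompact_space (hK : K.faces.Finite) : IsCompact K.space :=
  hK.isCompact_biUnion fun s _ => s.finite_toSet.isCompact_convexHull ℝ

/-- The open star of `v` is the complement of the closed simplices that omit `v`. These stars cover
the compact space, since `x` lies in the star of each vertex of its carrier, and `δ` is a Lebesgue
number. -/
lemma exists_isStarLabelling (hK : K.faces.Finite) : ∃ δ > 0, ∃ v, K.IsStarLabelling v δ := by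
  obtain ⟨δ, hδ, h⟩ := lebesgue_number_lemma_of_metric (isCompact_space hK)
    (c := fun v : E => (⋃ t ∈ {t ∈ K.faces | v ∉ t}, convexHull ℝ (t : Set E))ᶜ)
    (fun v => ((hK.subset (Set.sep_subset _ _)).isCompact_biUnion fun t _ =>
      t.finite_toSet.isCompact_convexHull ℝ).isClosed.isOpen_compl) (fun x hx => by
        obtain ⟨s, hs, -, hs'⟩ := exists_carrier hx
        obtain ⟨v, hv⟩ := nonempty_of_mem_faces hs
        simp only [Set.mem_iUnion, Set.mem_compl_iff, not_exists]
        exact ⟨v, fun t ht hxt => ht.2 (hs' t ht.1 hxt hv)⟩)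
  choose! v hv using h
  refine ⟨δ, hδ, v, fun x hx y hy hxy t ht hyt => ?_⟩
  by_contra hvt
  exact hv x hx (Metric.mem_ball'.2 hxy) (Set.mem_biUnion (show t ∈ {t ∈ K.faces | v x ∉ t} from
    ⟨ht, hvt⟩) hyt)

variable (K)

/-- The simplices with `n` vertices of a complex, for `n = 0` including the empty one. -/
def facesOfCard (n : ℕ) : Set (Finset E) := {s | (s.Nonempty → s ∈ K.faces) ∧ s.card = n}

/-- The chains of simplices with `n` vertices. -/
def simplicialChains (n : ℕ) : Submodule (ZMod 2) (Finset E →₀ ZMod 2) :=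
  Finsupp.supported (ZMod 2) (ZMod 2) (K.facesOfCard n)

/-- The (unaugmented) simplicial cycles of dimension `i`. -/
def simplicialCycles : ℕ → Submodule (ZMod 2) (Finset E →₀ ZMod 2)
  | 0 => K.simplicialChains 1
  | i + 1 => K.simplicialChains (i + 2) ⊓ LinearMap.ker (FinsetChain.boundary E)

/-- The simplicial boundaries of dimension `i`. -/
def simplicialBoundaries (i : ℕ) : Submodule (ZMod 2) (Finset E →₀ ZMod 2) :=
  (K.simplicialChains (i + 2)).map (FinsetChain.boundary E)

variable {K}

lemma mem_simplicialCycles_iff {i : ℕ} {c : Finset E →₀ ZMod 2} : c ∈ K.simplicialCycles i ↔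
    c ∈ K.simplicialChains (i + 1) ∧ (i = 0 ∨ FinsetChain.boundary E c = 0) := by
  cases i <;> simp [simplicialCycles]

lemma mem_facesOfCard_of_subset {n m : ℕ} {s t : Finset E} (hs : s ∈ K.facesOfCard n) (hts : t ⊆ s)
    (ht : t.card = m) : t ∈ K.facesOfCard m :=
  ⟨fun h => K.down_closed (hs.1 (h.mono hts)) hts h, ht⟩

open SingularChain

lemma convexHull_subset_space_of_mem_facesOfCard {n : ℕ} {s : Finset E}
    (hs : s ∈ K.facesOfCard n) : convexHull ℝ (s : Set E) ⊆ K.space := by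
  rcases s.eq_empty_or_nonempty with rfl | h
  · simp
  · exact convexHull_subset_space (hs.1 h)

lemma realize_mem_chainsIn {n : ℕ} {c : Finset E →₀ ZMod 2} (hc : c ∈ K.simplicialChains n) :
    FinsetChain.realize n c ∈ chainsIn n K.space :=
  Finsupp.map_mem_of_mem_supported (fun _ hs => chainsIn_mono
    (convexHull_subset_space_of_mem_facesOfCard hs) (FinsetChain.realize_single_mem hs.2)) hc

variable {v : E → E} {δ : ℝ}

/-- A point lies within `δ` of itself, so its label is a vertex of every face containing it. Hence
no smallness of the chain is required. -/
lemma label_mem_of_mem_chainsIn_convexHull (hδ : 0 < δ) (hv : K.IsStarLabelling v δ) {n : ℕ}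
    {s : Finset E} (hs : s ∈ K.facesOfCard n) {m : ℕ} {c : SingularChain m E}
    (hc : c ∈ chainsIn m (convexHull ℝ (s : Set E))) :
    label v m c ∈ Finsupp.supported (ZMod 2) (ZMod 2) {t | t ⊆ s ∧ t.card = m} := by
  refine Finsupp.map_mem_of_mem_supported (fun σ hσ => ?_) hc
  rw [label_single]
  refine FinsetChain.tuple_mem_supported fun t ht ht' => ⟨fun a ha => ?_, ht'⟩
  obtain ⟨j, rfl⟩ := (ht a).1 ha
  have hmem := hσ (stdSimplex.vertex j)
  have hne : s.Nonempty := by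
    rw [← Finset.coe_nonempty, ← convexHull_nonempty_iff (𝕜 := ℝ)]
    exact ⟨_, hmem⟩
  have hsp := convexHull_subset_space_of_mem_facesOfCard hs hmem
  exact hv _ hsp _ hsp (by simpa using hδ) s (hs.1 hne) hmem

variable (K) in
/-- The singular simplices in a complex of diameter less than `δ`. -/
def smallSimplices (δ : ℝ) (n : ℕ) : Set C(stdSimplex ℝ (Fin n), E) :=
  {σ | (∀ t, σ t ∈ K.space) ∧ σ ∈ SingularChain.smallSimplices n E δ}

variable (K) in
/-- The union of the closed simplices which meet the image of a singular simplex. -/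
def neighbourhood {n : ℕ} (σ : C(stdSimplex ℝ (Fin n), E)) : Set E :=
  ⋃ t ∈ {t ∈ K.faces | ∃ x, σ x ∈ convexHull ℝ (t : Set E)}, convexHull ℝ (t : Set E)

/-- As `σ` has diameter below `δ`, the label of each of its vertices belongs to every face that its
image meets. -/
lemma label_single_mem_supported (hv : K.IsStarLabelling v δ) {n : ℕ}
    {σ : C(stdSimplex ℝ (Fin n), E)} (hσ : σ ∈ K.smallSimplices δ n) :
    label v n (Finsupp.single σ 1) ∈ Finsupp.supported (ZMod 2) (ZMod 2)
      {s | s.card = n ∧ ∀ x, ∀ t ∈ K.faces, σ x ∈ convexHull ℝ (t : Set E) → s ⊆ t} := by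
  rw [label_single]
  refine FinsetChain.tuple_mem_supported fun s hs hs' => ⟨hs', fun x t ht hxt a ha => ?_⟩
  obtain ⟨j, rfl⟩ := (hs a).1 ha
  exact hv _ (hσ.1 _) _ (hσ.1 x) (hσ.2 _ _) t ht hxt

lemma label_mem_simplicialChains (hv : K.IsStarLabelling v δ) {n : ℕ} {c : SingularChain (n + 1) E}
    (hc : c ∈ Finsupp.supported (ZMod 2) (ZMod 2) (K.smallSimplices δ (n + 1))) :
    label v (n + 1) c ∈ K.simplicialChains (n + 1) := by
  refine Finsupp.map_mem_of_mem_supported (fun σ hσ => ?_) hc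
  refine Finsupp.supported_mono ?_ (label_single_mem_supported hv hσ)
  rintro s ⟨hcard, hs⟩
  obtain ⟨t, ht, hxt⟩ := mem_space_iff.1 (hσ.1 (stdSimplex.vertex 0))
  exact ⟨fun hne => K.down_closed ht (hs _ t ht hxt) hne, hcard⟩

/-- Realising the labels of an iterated subdivision of a realised simplicial cycle gives a
homologous cycle. -/
lemma exists_boundary_eq_label_realize (hδ : 0 < δ) (hv : K.IsStarLabelling v δ) (N : ℕ) {i : ℕ}
    {c : Finset E →₀ ZMod 2} (hc : c ∈ K.simplicialCycles i) :
    label v (i + 1) ((sd (i + 1) E ^ N) (FinsetChain.realize (i + 1) c)) + c ∈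
      K.simplicialBoundaries i := by
  classical
  rw [mem_simplicialCycles_iff] at hc
  -- The carrier of a face consists of the chains on its subsets, and is acyclic by coning from one
  -- of its vertices. Both `label ∘ sd ^ N ∘ realize` and the identity respect it, and they agree on
  -- the empty simplex.
  obtain ⟨w, hw, hw'⟩ := exists_boundary_eq_of_acyclic_carrier (β := fun _ => Finset E)
    (D := fun _ => Finset E →₀ ZMod 2) (fun _ => FinsetChain.boundary E)
    (fun _ => FinsetChain.boundary_boundary) (fun _ => FinsetChain.boundary E) K.facesOfCard
    (fun _ s m => Finsupp.supported (ZMod 2) (ZMod 2) {t | t ⊆ s ∧ t.card = m})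
    (fun n s hs => FinsetChain.boundary_single_mem_supported fun t hts ht =>
      ⟨mem_facesOfCard_of_subset hs hts (by have := hs.2; omega), fun m =>
        Finsupp.supported_mono fun u hu => ⟨hu.1.trans hts, hu.2⟩⟩)
    (fun n s hs z hz hz' => by
      obtain ⟨a, ha⟩ : s.Nonempty := Finset.card_pos.1 (by have := hs.2; omega)
      refine ⟨FinsetChain.cone a z, ?_, by
        rw [FinsetChain.boundary_cone, hz', map_zero, add_zero]⟩
      refine Finsupp.map_mem_of_mem_supported (fun t ht => ?_) hz
      rw [FinsetChain.cone_single]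
      split_ifs with hat
      · exact zero_mem _
      · refine Finsupp.single_mem_supported _ _ ⟨Finset.insert_subset ha ht.1, ?_⟩
        rw [Finset.card_insert_of_notMem hat, ht.2])
    (fun n => label v n ∘ₗ (sd n E ^ N) ∘ₗ FinsetChain.realize n + LinearMap.id)
    (fun n c => by
      simp only [LinearMap.add_apply, LinearMap.comp_apply, LinearMap.id_apply, map_add,
        boundary_label, boundary_iterate_sd, FinsetChain.boundary_realize])
    (fun s hs => by
      obtain rfl : s = ∅ := Finset.card_eq_zero.1 hs.2
      have h0 : ∀ c : SingularChain 0 E, (sd 0 E ^ N) c = c := fun c => by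
        induction N with
        | zero => rfl
        | succ N ih => rw [pow_succ', Module.End.mul_apply, sd_zero, ih]
      simp only [LinearMap.add_apply, LinearMap.comp_apply, h0, FinsetChain.realize,
        Finsupp.linearCombination_single, one_smul, if_true, label_single, LinearMap.id_apply,
        FinsetChain.tuple]
      rw [if_pos (Function.injective_of_subsingleton _)]
      exact ZModModule.add_self _)
    (fun n s hs => add_mem (label_mem_of_mem_chainsIn_convexHull hδ hv hs
      (iterate_sd_mem_chainsIn (FinsetChain.realize_single_mem hs.2) N))
      (Finsupp.single_mem_supported _ _ ⟨subset_rfl, hs.2⟩))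
    (Q := K.simplicialChains (i + 2))
    (fun s hs => Finsupp.supported_mono fun t ht => mem_facesOfCard_of_subset hs ht.1 ht.2)
    hc.1 hc.2
  exact ⟨w, hw, hw'⟩

lemma neighbourhood_subset_space {n : ℕ} (σ : C(stdSimplex ℝ (Fin n), E)) :
    K.neighbourhood σ ⊆ K.space :=
  Set.iUnion₂_subset fun _ ht => convexHull_subset_space ht.1

lemma neighbourhood_comp_subset {n m : ℕ} (σ : C(stdSimplex ℝ (Fin n), E))
    (u : C(stdSimplex ℝ (Fin m), stdSimplex ℝ (Fin n))) :
    K.neighbourhood (σ.comp u) ⊆ K.neighbourhood σ :=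
  Set.biUnion_subset_biUnion_left fun _ ht => ⟨ht.1, ht.2.imp' u fun _ h => h⟩

/-- Every face that meets the image of `σ` contains the label of vertex `0` of `σ`, so their union
is star-shaped about that label. This provides the acyclic carriers for small singular simplices. -/
lemma starConvex_neighbourhood (hv : K.IsStarLabelling v δ) {n : ℕ}
    {σ : C(stdSimplex ℝ (Fin (n + 1)), E)} (hσ : σ ∈ K.smallSimplices δ (n + 1)) :
    StarConvex ℝ (v (σ (stdSimplex.vertex 0))) (K.neighbourhood σ) ∧
      v (σ (stdSimplex.vertex 0)) ∈ K.neighbourhood σ := by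
  have key : ∀ t ∈ {t ∈ K.faces | ∃ x, σ x ∈ convexHull ℝ (t : Set E)},
      v (σ (stdSimplex.vertex 0)) ∈ convexHull ℝ (t : Set E) := by
    rintro t ⟨ht, x, hx⟩
    exact subset_convexHull ℝ _ (hv _ (hσ.1 _) _ (hσ.1 x) (hσ.2 _ _) t ht hx)
  constructor
  · exact starConvex_iUnion fun t => starConvex_iUnion fun ht =>
      (convex_convexHull ℝ _).starConvex (key t ht)
  · obtain ⟨t, ht, hxt⟩ := mem_space_iff.1 (hσ.1 (stdSimplex.vertex 0))
    exact Set.mem_biUnion (show t ∈ {t ∈ K.faces | ∃ x, σ x ∈ convexHull ℝ (t : Set E)} from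
      ⟨ht, _, hxt⟩) (key t ⟨ht, _, hxt⟩)

/-- Realising the labels of a cycle of small singular simplices gives a homologous cycle. -/
lemma exists_boundary_eq_realize_label (hv : K.IsStarLabelling v δ) {i : ℕ}
    {c : SingularChain (i + 1) E} (hc : c ∈ SingularChain.cycles i E)
    (hc' : c ∈ Finsupp.supported (ZMod 2) (ZMod 2) (K.smallSimplices δ (i + 1))) :
    ∃ w ∈ chainsIn (i + 2) K.space,
      SingularChain.boundary (i + 1) E w = FinsetChain.realize (i + 1) (label v (i + 1) c) + c := by
  classical
  -- The two chain maps compared are `realize ∘ label` and the identity; a small simplex is carried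
  -- by the singular chains in its neighbourhood.
  obtain ⟨w, hw, hw'⟩ := exists_boundary_eq_of_acyclic_carrier
    (β := fun n => C(stdSimplex ℝ (Fin n), E))
    (D := fun n => SingularChain n E) (fun n => SingularChain.boundary n E)
    (fun _ => SingularChain.boundary_boundary) (fun n => SingularChain.boundary n E)
    (K.smallSimplices δ) (fun _ σ m => chainsIn m (K.neighbourhood σ))
    (fun n σ hσ => by
      rw [SingularChain.boundary_single]
      refine Submodule.sum_mem _ fun i _ => Finsupp.single_mem_supported _ _ ⟨⟨fun t => hσ.1 _,
        fun x y => hσ.2 _ _⟩, fun m => chainsIn_mono (neighbourhood_comp_subset σ (face i))⟩)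
    (fun n σ hσ z hz hz' => exists_boundary_eq_of_starConvex (starConvex_neighbourhood hv hσ).1
      (starConvex_neighbourhood hv hσ).2 hz hz')
    (fun n => FinsetChain.realize n ∘ₗ label v n + LinearMap.id)
    (fun n c => by
      simp only [LinearMap.add_apply, LinearMap.comp_apply, LinearMap.id_apply, map_add,
        boundary_label, FinsetChain.boundary_realize])
    (fun σ hσ => by
      simp only [LinearMap.add_apply, LinearMap.comp_apply, FinsetChain.realize,
        label_single, LinearMap.id_apply, FinsetChain.tuple]
      rw [if_pos (Function.injective_of_subsingleton _)]
      simp only [Finsupp.linearCombination_single, one_smul, Finset.univ_eq_empty,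
        Finset.image_empty, if_true]
      rw [show σ = ⟨isEmptyElim, continuous_of_discreteTopology⟩ from
        ContinuousMap.ext fun t => isEmptyElim t]
      exact ZModModule.add_self _)
    (fun n σ hσ => by
      rcases n with - | n
      · exact fun _ _ t => isEmptyElim t
      refine add_mem (Finsupp.map_mem_of_mem_supported
        (f := FinsetChain.realize (n + 1)) (fun s hs => ?_)
        (label_single_mem_supported hv hσ)) (single_mem_chainsIn (fun x => ?_) _)
      · refine chainsIn_mono ?_ (FinsetChain.realize_single_mem hs.1)
        obtain ⟨t, ht, hxt⟩ := mem_space_iff.1 (hσ.1 (stdSimplex.vertex 0))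
        exact (convexHull_mono (by exact_mod_cast hs.2 _ t ht hxt)).trans
          (Set.subset_biUnion_of_mem (show t ∈ {t ∈ K.faces | ∃ x, σ x ∈ convexHull ℝ (t : Set E)}
            from ⟨ht, _, hxt⟩) (u := fun t : Finset E => convexHull ℝ (t : Set E)))
      · obtain ⟨t, ht, hxt⟩ := mem_space_iff.1 (hσ.1 x)
        exact Set.mem_biUnion (show t ∈ {t ∈ K.faces | ∃ x, σ x ∈ convexHull ℝ (t : Set E)} from
          ⟨ht, _, hxt⟩) hxt)
    (Q := chainsIn (i + 2) K.space)
    (fun σ hσ => chainsIn_mono (neighbourhood_subset_space σ))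
    hc' (by
      cases i with
      | zero => exact Or.inl rfl
      | succ i => exact Or.inr hc)
  exact ⟨w, hw, hw'⟩

lemma iterate_sd_mem_smallSimplices {n : ℕ} {c : SingularChain n E} (hc : c ∈ chainsIn n K.space)
    (hδ : 0 < δ) : ∃ N, (sd n E ^ N) c ∈
      Finsupp.supported (ZMod 2) (ZMod 2) (K.smallSimplices δ n) := by
  obtain ⟨N, hN⟩ := exists_iterate_sd_small c hδ
  exact ⟨N, fun σ hσ => ⟨iterate_sd_mem_chainsIn hc N hσ, hN N le_rfl hσ⟩⟩

lemma realize_mem_cycles {i : ℕ} {c : Finset E →₀ ZMod 2} (hc : c ∈ K.simplicialCycles i) :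
    FinsetChain.realize (i + 1) c ∈ SingularChain.cycles i E := by
  rw [mem_simplicialCycles_iff] at hc
  cases i with
  | zero => trivial
  | succ i =>
    refine LinearMap.mem_ker.2 ?_
    rw [FinsetChain.boundary_realize, hc.2.resolve_left (Nat.succ_ne_zero i), map_zero]

lemma label_mem_simplicialCycles (hv : K.IsStarLabelling v δ) {i : ℕ} {c : SingularChain (i + 1) E}
    (hc : c ∈ SingularChain.cycles i E)
    (hc' : c ∈ Finsupp.supported (ZMod 2) (ZMod 2) (K.smallSimplices δ (i + 1))) :
    label v (i + 1) c ∈ K.simplicialCycles i := by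
  refine mem_simplicialCycles_iff.2 ⟨label_mem_simplicialChains hv hc', ?_⟩
  cases i with
  | zero => exact Or.inl rfl
  | succ i =>
    right
    rw [boundary_label, LinearMap.mem_ker.1 hc, map_zero]

/-- The simplicial homology of a finite complex is the singular homology of its space. -/
def simplicialHomologyEquiv (hK : K.faces.Finite) (i : ℕ) :
    Subquotient (K.simplicialCycles i) (K.simplicialBoundaries i) ≃ₗ[ZMod 2]
      Subquotient (SingularChain.cycles i E ⊓ chainsIn (i + 1) K.space)
        ((chainsIn (i + 2) K.space).map (SingularChain.boundary (i + 1) E)) :=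
  subquotientEquiv (FinsetChain.realize (i + 1))
    (fun c hc => ⟨realize_mem_cycles hc, realize_mem_chainsIn (mem_simplicialCycles_iff.1 hc).1⟩)
    (by
      rintro _ ⟨c, hc, rfl⟩
      exact ⟨_, realize_mem_chainsIn hc, FinsetChain.boundary_realize _ _⟩)
    (by
      rintro c hc ⟨w, hw, hwc⟩
      obtain ⟨δ, hδ, v, hv⟩ := exists_isStarLabelling hK
      obtain ⟨N, hN⟩ := iterate_sd_mem_smallSimplices hw hδ
      have h := exists_boundary_eq_label_realize hδ hv N hc
      -- The labels of the subdivided `w` bound the labels of the subdivided realisation of `c`,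
      -- which are homologous to `c`.
      refine ((K.simplicialBoundaries i).add_mem_iff_right ?_).1 h
      refine ⟨_, label_mem_simplicialChains hv hN, ?_⟩
      rw [boundary_label, boundary_iterate_sd, hwc])
    (by
      rintro c ⟨hc, hcX⟩
      obtain ⟨δ, hδ, v, hv⟩ := exists_isStarLabelling hK
      obtain ⟨N, hN⟩ := iterate_sd_mem_smallSimplices hcX hδ
      -- The preimage is the labelling of the subdivided cycle: its realisation is homologous to the
      -- subdivided cycle, which is homologous to `c`.
      have hcN := iterate_sd_mem_cycles hc N
      refine ⟨_, label_mem_simplicialCycles hv hcN hN, ?_⟩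
      obtain ⟨w, hw, hw'⟩ := exists_boundary_eq_realize_label hv hcN hN
      obtain ⟨w', hw₁, hw₂⟩ := exists_iterate_sd_add_self hc hcX N
      refine ⟨w + w', add_mem hw hw₁, ?_⟩
      rw [map_add, hw', hw₂, ZModModule.sub_eq_add, add_assoc, ← add_assoc _ _ c,
        ZModModule.add_self, zero_add])

end Geometry.SimplicialComplex

/-! ### Singular homology in terms of concrete chains -/

namespace SingularChain

section Push

variable {Y Z : Type*} [TopologicalSpace Y] [TopologicalSpace Z]

lemma push_injective {g : C(Y, Z)} (hg : Function.Injective g) (n : ℕ) :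
    Function.Injective (push n g) :=
  Finsupp.mapDomain_injective fun _ _ h => ContinuousMap.ext fun t =>
    hg (DFunLike.congr_fun h t)

lemma map_push_top {g : C(Y, Z)} (hg : Topology.IsEmbedding g) (n : ℕ) :
    LinearMap.range (push n g) = chainsIn n (Set.range g) := by
  apply le_antisymm
  · rintro _ ⟨c, rfl⟩
    exact Finsupp.map_mem_of_mem_supported (s := Set.univ) (fun σ _ => by
      rw [push_single]
      exact single_mem_chainsIn (fun t => Set.mem_range_self (σ t)) _) (by simp)
  · intro c hc
    refine Finsupp.map_mem_of_mem_supported (f := LinearMap.id) (fun σ hσ => ?_) hc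
    choose u hu using hσ
    have hcont : Continuous u := by
      rw [hg.continuous_iff]
      exact σ.continuous.congr fun t => (hu t).symm
    refine ⟨Finsupp.single ⟨u, hcont⟩ 1, ?_⟩
    rw [push_single, LinearMap.id_apply]
    congr 1
    exact ContinuousMap.ext hu

lemma push_mem_cycles_iff {g : C(Y, Z)} (hg : Function.Injective g) {i : ℕ}
    {c : SingularChain (i + 1) Y} : push (i + 1) g c ∈ cycles i Z ↔ c ∈ cycles i Y := by
  cases i with
  | zero => exact Iff.rfl
  | succ i =>
    simp only [cycles, LinearMap.mem_ker, ← push_boundary]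
    exact map_eq_zero_iff _ (push_injective hg _)

/-- An embedding identifies the singular homology of a space with that of its image. -/
def subquotientEquivOfIsEmbedding {g : C(Y, Z)} (hg : Topology.IsEmbedding g) (i : ℕ) :
    Subquotient (cycles i Y) (LinearMap.range (boundary (i + 1) Y)) ≃ₗ[ZMod 2]
      Subquotient (cycles i Z ⊓ chainsIn (i + 1) (Set.range g))
        ((chainsIn (i + 2) (Set.range g)).map (boundary (i + 1) Z)) :=
  subquotientEquiv (push (i + 1) g)
    (fun c hc => ⟨(push_mem_cycles_iff hg.injective).2 hc, by
      rw [← map_push_top hg]; exact ⟨c, rfl⟩⟩)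
    (by
      rintro _ ⟨c, rfl⟩
      rw [← map_push_top hg]
      exact ⟨_, ⟨c, rfl⟩, (push_boundary g c).symm⟩)
    (by
      rintro c - ⟨w, hw, hwc⟩
      rw [← map_push_top hg] at hw
      obtain ⟨w, rfl⟩ := hw
      rw [← push_boundary] at hwc
      exact ⟨w, push_injective hg.injective _ hwc⟩)
    (by
      rintro c ⟨hc, hc'⟩
      rw [← map_push_top hg] at hc'
      obtain ⟨c, rfl⟩ := hc'
      exact ⟨c, (push_mem_cycles_iff hg.injective).1 hc, by rw [sub_self]; exact zero_mem _⟩)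

end Push

variable (M : Type u) [TopologicalSpace M]

/-- The singular chain complex of Mathlib with coefficients in the field with two elements. -/
abbrev chainComplexZ2 : ChainComplex (ModuleCat.{u} (ZMod 2)) ℕ :=
  (TopCat.toSSet.obj (TopCat.of M)).chainComplex (ModuleCat.of (ZMod 2) (ULift.{u} (ZMod 2)))

variable {M} in
/-- A singular simplex as a chain. -/
def ofSimplex {n : ℕ} (σ : C(stdSimplex ℝ (Fin (n + 1)), M)) : (chainComplexZ2 M).X n :=
  ((TopCat.toSSet.obj (TopCat.of M)).ιChainComplex
    (R := ModuleCat.of (ZMod 2) (ULift.{u} (ZMod 2)))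
    ((TopCat.toSSetObjEquiv (TopCat.of M) (.op (SimplexCategory.mk n))).symm σ)).hom ⟨1⟩

/-- The map from concrete chains to chains in the sense of Mathlib. -/
def toChainComplex (n : ℕ) : SingularChain (n + 1) M →ₗ[ZMod 2] (chainComplexZ2 M).X n :=
  Finsupp.linearCombination (ZMod 2) ofSimplex

/-- The map from chains in the sense of Mathlib to concrete chains. -/
def ofChainComplex (n : ℕ) : (chainComplexZ2 M).X n ⟶
    ModuleCat.of (ZMod 2) (SingularChain (n + 1) M) :=
  ((TopCat.toSSet.obj (TopCat.of M)).isColimitChainComplexXCofan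
    (ModuleCat.of (ZMod 2) (ULift.{u} (ZMod 2))) n).desc
    (Limits.Cofan.mk _ fun x => ModuleCat.ofHom
      (Finsupp.lsingle (TopCat.toSSetObjEquiv (TopCat.of M) (.op (SimplexCategory.mk n)) x) ∘ₗ
        (ULift.moduleEquiv (R := ZMod 2) (M := ZMod 2)).toLinearMap))

lemma ι_ofChainComplex (n : ℕ) (x) :
    (TopCat.toSSet.obj (TopCat.of M)).ιChainComplex x ≫ ofChainComplex M n = ModuleCat.ofHom
      (Finsupp.lsingle (TopCat.toSSetObjEquiv (TopCat.of M) (.op (SimplexCategory.mk n)) x) ∘ₗ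
        (ULift.moduleEquiv (R := ZMod 2) (M := ZMod 2)).toLinearMap) :=
  ((TopCat.toSSet.obj (TopCat.of M)).isColimitChainComplexXCofan
    (ModuleCat.of (ZMod 2) (ULift.{u} (ZMod 2))) n).fac _ ⟨x⟩

lemma ofChainComplex_ofSimplex {n : ℕ} (σ : C(stdSimplex ℝ (Fin (n + 1)), M)) :
    (ofChainComplex M n).hom (ofSimplex σ) = Finsupp.single σ 1 := by
  have := congrArg (fun f => f.hom ⟨1⟩) (ι_ofChainComplex M n
    ((TopCat.toSSetObjEquiv (TopCat.of M) (.op (SimplexCategory.mk n))).symm σ))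
  rw [Equiv.apply_symm_apply] at this
  exact this

lemma toChainComplex_single {n : ℕ} (σ : C(stdSimplex ℝ (Fin (n + 1)), M)) :
    toChainComplex M n (Finsupp.single σ 1) = ofSimplex σ := by
  simp [toChainComplex]

/-- The concrete chains are the chains in the sense of Mathlib. -/
def chainEquiv (n : ℕ) : SingularChain (n + 1) M ≃ₗ[ZMod 2] (chainComplexZ2 M).X n :=
  LinearEquiv.ofLinearMap (toChainComplex M n) (ofChainComplex M n).hom
    (by
      have : ofChainComplex M n ≫ ModuleCat.ofHom (toChainComplex M n) = 𝟙 _ := by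
        refine SSet.chainComplex_hom_ext fun x => ?_
        rw [← Category.assoc, ι_ofChainComplex, Category.comp_id]
        ext ⟨a⟩
        change toChainComplex M n (Finsupp.single _ a) = _
        rw [toChainComplex, Finsupp.linearCombination_single, ofSimplex, Equiv.symm_apply_apply,
          ← map_smul]
        congr 1
        exact ULift.ext _ _ (mul_one a)
      exact congrArg ModuleCat.Hom.hom this)
    (hom_ext_single fun σ => by
      rw [LinearMap.comp_apply, toChainComplex_single, ofChainComplex_ofSimplex]
      rfl)

lemma d_ofSimplex {n : ℕ} (σ : C(stdSimplex ℝ (Fin (n + 2)), M)) :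
    ((chainComplexZ2 M).d (n + 1) n).hom (ofSimplex σ) = ∑ i, ofSimplex (σ.comp (face i)) := by
  have := congrArg (fun f => f.hom ⟨1⟩) ((TopCat.toSSet.obj (TopCat.of M)).ιChainComplex_d
    (ModuleCat.of (ZMod 2) (ULift.{u} (ZMod 2)))
    ((TopCat.toSSetObjEquiv (TopCat.of M) (.op (SimplexCategory.mk (n + 1)))).symm σ))
  refine Eq.trans this ?_
  simp only [ModuleCat.hom_sum, LinearMap.sum_apply]
  refine Finset.sum_congr rfl fun i _ => ?_
  have hface : (TopCat.toSSet.obj (TopCat.of M)).δ i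
      ((TopCat.toSSetObjEquiv (TopCat.of M) (.op (SimplexCategory.mk (n + 1)))).symm σ) =
      (TopCat.toSSetObjEquiv (TopCat.of M) (.op (SimplexCategory.mk n))).symm (σ.comp (face i)) :=
    TopCat.toSSetObjEquiv_symm_naturality (X := TopCat.of M) (SimplexCategory.δ i) σ
  rw [hface]
  -- The signs of the alternating sum disappear modulo two.
  rcases neg_one_pow_eq_or ℤ (i : ℕ) with h | h
  · rw [h, one_smul]
    rfl
  · rw [h, neg_smul, one_smul, ModuleCat.hom_neg, LinearMap.neg_apply, ZModModule.neg_eq_self]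
    rfl

lemma d_chainEquiv {n : ℕ} (c : SingularChain (n + 2) M) :
    ((chainComplexZ2 M).d (n + 1) n).hom (chainEquiv M (n + 1) c) =
      chainEquiv M n (boundary (n + 1) M c) := by
  refine LinearMap.congr_fun
    (f := ((chainComplexZ2 M).d (n + 1) n).hom ∘ₗ (chainEquiv M (n + 1)).toLinearMap)
    (g := (chainEquiv M n).toLinearMap ∘ₗ boundary (n + 1) M) (hom_ext_single fun σ => ?_) c
  change ((chainComplexZ2 M).d (n + 1) n).hom (toChainComplex M (n + 1) (Finsupp.single σ 1)) =
    toChainComplex M n (boundary (n + 1) M (Finsupp.single σ 1))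
  rw [toChainComplex_single, d_ofSimplex, boundary_single, map_sum]
  simp only [toChainComplex_single]

/-- The homology of a short complex of modules as a subquotient. -/
def shortComplexHomologyEquiv (S : ShortComplex (ModuleCat.{u} (ZMod 2))) :
    S.homology ≃ₗ[ZMod 2] Subquotient (LinearMap.ker S.g.hom) (LinearMap.range S.f.hom) :=
  S.moduleCatHomologyIso.toLinearEquiv.trans (Submodule.quotEquivOfEq _ _ (by
    ext x
    exact exists_congr fun y => Subtype.ext_iff))

/-- For `i = 0` the truncated predecessor gives `d 0 0`, which is zero by the shape of the complex,
in agreement with all `0`-chains being cycles. -/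
lemma map_chainEquiv_mem_ker_iff (i : ℕ) (c : SingularChain (i + 1) M) :
    chainEquiv M i c ∈ LinearMap.ker ((chainComplexZ2 M).d i (i - 1)).hom ↔ c ∈ cycles i M := by
  cases i with
  | zero =>
    rw [HomologicalComplex.shape _ _ _ (by simp)]
    exact ⟨fun _ => trivial, fun _ => rfl⟩
  | succ i =>
    change ((chainComplexZ2 M).d (i + 1) i).hom (chainEquiv M (i + 1) c) = 0 ↔ boundary _ _ c = 0
    rw [d_chainEquiv, LinearEquiv.map_eq_zero_iff]

/-- Singular homology in terms of concrete chains. -/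
def homologyZ2Equiv (i : ℕ) : HomologyZ2 i M ≃ₗ[ZMod 2]
    Subquotient (cycles i M) (LinearMap.range (boundary (i + 1) M)) :=
  ((chainComplexZ2 M).homologyIsoSc' (i + 1) i (i - 1) (by simp) (by cases i <;> simp)
    ).toLinearEquiv.trans ((shortComplexHomologyEquiv _).trans
    (subquotientEquiv (chainEquiv M i).toLinearMap
      (Z' := LinearMap.ker ((chainComplexZ2 M).d i (i - 1)).hom)
      (B' := LinearMap.range ((chainComplexZ2 M).d (i + 1) i).hom)
      (fun z hz => (map_chainEquiv_mem_ker_iff M i z).2 hz)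
      (by
        rintro _ ⟨c, rfl⟩
        exact ⟨_, d_chainEquiv M c⟩)
      (by
        rintro z - ⟨c, hc⟩
        obtain ⟨c, rfl⟩ := (chainEquiv M (i + 1)).surjective c
        rw [d_chainEquiv] at hc
        exact ⟨c, (chainEquiv M i).injective hc⟩)
      (by
        intro z hz
        obtain ⟨z, rfl⟩ := (chainEquiv M i).surjective z
        exact ⟨z, (map_chainEquiv_mem_ker_iff M i z).1 hz, by
          rw [LinearEquiv.coe_coe, sub_self]; exact zero_mem _⟩)).symm)

end SingularChain

namespace SimplicialStructure

variable {M : Type u} [TopologicalSpace M] (S : SimplicialStructure M)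

/-- The manifold, embedded into the Euclidean space of the simplicial structure. -/
def embedding : C(M, EuclideanSpace ℝ (Fin S.N)) :=
  ⟨fun x => S.homeo.symm x, continuous_subtype_val.comp S.homeo.symm.continuous⟩

lemma isEmbedding_embedding : Topology.IsEmbedding S.embedding :=
  Topology.IsEmbedding.subtypeVal.comp S.homeo.symm.isEmbedding

lemma range_embedding : Set.range S.embedding = S.K.space := by
  change Set.range (Subtype.val ∘ S.homeo.symm) = _
  rw [S.homeo.symm.surjective.range_comp, Subtype.range_coe]

/-- The singular homology of a triangulated space is its simplicial homology. -/
def homologyEquiv (i : ℕ) : HomologyZ2 i M ≃ₗ[ZMod 2]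
    Subquotient (S.K.simplicialCycles i) (S.K.simplicialBoundaries i) :=
  (SingularChain.homologyZ2Equiv M i).trans
    ((SingularChain.subquotientEquivOfIsEmbedding S.isEmbedding_embedding i).trans
      ((range_embedding S).symm ▸ (S.K.simplicialHomologyEquiv S.finite_faces i).symm))

end SimplicialStructure

/-! ### Orthogonal complements modulo two -/

section Perp

variable {ι : Type*} [Fintype ι] [DecidableEq ι]

omit [DecidableEq ι] in
lemma mem_perp {V : Submodule (ZMod 2) (ι → ZMod 2)} {w : ι → ZMod 2} :
    w ∈ perp V ↔ ∀ v ∈ V, v ⬝ᵥ w = 0 := Iff.rfl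

/-- Over `𝔽₂` a subspace may meet its complement. The double complement and the dimension formula
still hold, since they only need non-degeneracy of the form. -/
lemma perp_eq_orthogonal (V : Submodule (ZMod 2) (ι → ZMod 2)) :
    perp V = (Matrix.toBilin' (1 : Matrix ι ι (ZMod 2))).orthogonal V := by
  ext w
  rw [LinearMap.BilinForm.mem_orthogonal_iff, mem_perp]
  simp [Matrix.toBilin'_apply']

lemma perp_perp (V : Submodule (ZMod 2) (ι → ZMod 2)) : perp (perp V) = V := by
  rw [perp_eq_orthogonal, perp_eq_orthogonal]
  refine LinearMap.BilinForm.orthogonal_orthogonal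
    (LinearMap.BilinForm.nondegenerate_toBilin'_of_det_ne_zero' _ (by simp)) ?_ V
  intro v w h
  simpa [Matrix.toBilin'_apply', dotProduct_comm] using h

lemma finrank_perp_add (V : Submodule (ZMod 2) (ι → ZMod 2)) :
    Module.finrank (ZMod 2) (perp V) + Module.finrank (ZMod 2) V = Fintype.card ι := by
  rw [perp_eq_orthogonal, LinearMap.BilinForm.finrank_orthogonal
    (LinearMap.BilinForm.nondegenerate_toBilin'_of_det_ne_zero' _ (by simp)),
    ← Module.finrank_fintype_fun_eq_card (ZMod 2)]
  exact Nat.sub_add_cancel (Submodule.finrank_le V)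

omit [DecidableEq ι] in
lemma perp_anti {V W : Submodule (ZMod 2) (ι → ZMod 2)} (h : V ≤ W) : perp W ≤ perp V :=
  fun _ hw v hv => hw v (h hv)

end Perp

/-! ### Pauli operators in coordinates -/

/-- The character of order two of the field with two elements. -/
def signChar (a : ZMod 2) : ℂ := if a = 0 then 1 else -1

@[simp] lemma signChar_zero : signChar 0 = 1 := by simp [signChar]

@[simp] lemma signChar_one : signChar 1 = -1 := by simp [signChar]

lemma zmod_two_cases (a : ZMod 2) : a = 0 ∨ a = 1 := by
  revert a; decide

lemma signChar_add (a b : ZMod 2) : signChar (a + b) = signChar a * signChar b := by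
  rcases zmod_two_cases a with rfl | rfl <;> rcases zmod_two_cases b with rfl | rfl <;>
    simp [show (1 + 1 : ZMod 2) = 0 from rfl]

lemma signChar_mul_self (a : ZMod 2) : signChar a * signChar a = 1 := by
  rcases zmod_two_cases a with rfl | rfl <;> simp

lemma signChar_ne_zero (a : ZMod 2) : signChar a ≠ 0 := fun h => by
  simpa [h] using signChar_mul_self a

lemma signChar_sum {ι : Type*} (s : Finset ι) (f : ι → ZMod 2) :
    signChar (∑ e ∈ s, f e) = ∏ e ∈ s, signChar (f e) := by
  classical
  induction s using Finset.induction_on with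
  | empty => simp
  | insert a s ha ih => rw [Finset.sum_insert ha, Finset.prod_insert ha, signChar_add, ih]

lemma singlePauli_apply (q : ZMod 2 × ZMod 2) (s t : ZMod 2) :
    singlePauli q s t = if t = s + q.1 then signChar (q.2 * s) else 0 := by
  obtain ⟨a, b⟩ := q
  have h1 : (1 : ZMod 2).val = 1 := rfl
  have h2 : (1 + 1 : ZMod 2) = 0 := rfl
  rcases zmod_two_cases a with rfl | rfl <;> rcases zmod_two_cases b with rfl | rfl <;>
    rcases zmod_two_cases s with rfl | rfl <;> rcases zmod_two_cases t with rfl | rfl <;>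
    simp [singlePauli, pauliX, pauliZ, h1, h2, Matrix.diagonal_mul]

section Pauli

variable {ι : Type*} [Fintype ι] [DecidableEq ι]

omit [DecidableEq ι] in
lemma pauliMatrix_apply (p : ι → ZMod 2 × ZMod 2) (x y : ι → ZMod 2) :
    pauliMatrix p x y =
      if y = x + (fun e => (p e).1) then signChar ((fun e => (p e).2) ⬝ᵥ x) else 0 := by
  simp only [pauliMatrix, Matrix.of_apply, singlePauli_apply]
  split_ifs with h
  · rw [dotProduct, signChar_sum]
    refine Finset.prod_congr rfl fun e _ => if_pos ?_
    rw [h, Pi.add_apply]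
  · obtain ⟨e, he⟩ := Function.ne_iff.1 h
    exact Finset.prod_eq_zero (Finset.mem_univ e) (if_neg he)

lemma pauliOp_apply (p : ι → ZMod 2 × ZMod 2) (ψ : QubitSpace ι) (x : ι → ZMod 2) :
    pauliOp p ψ x = signChar ((fun e => (p e).2) ⬝ᵥ x) * ψ (x + fun e => (p e).1) := by
  rw [pauliOp, Matrix.ofLp_toLpLin, Matrix.toLin'_apply, Matrix.mulVec, dotProduct]
  simp [pauliMatrix_apply]

lemma inner_eq_sum (φ ψ : QubitSpace ι) : inner ℂ φ ψ = ∑ x, star (φ x) * ψ x := by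
  simp [PiLp.inner_apply, mul_comm]

/-! ### The CSS code in coordinates -/

variable {V₁ V₂ : Submodule (ZMod 2) (ι → ZMod 2)}

/-- The operators from `V₁` are translations. Those from `V₂` are characters, and `ψ` is fixed by a
character iff it vanishes where the character is `-1`. -/
lemma mem_cssCode_iff {ψ : QubitSpace ι} : ψ ∈ cssCode V₁ V₂ ↔
    (∀ v ∈ V₁, ∀ x, ψ (x + v) = ψ x) ∧ ∀ x ∉ perp V₂, ψ x = 0 := by
  have h : ψ ∈ cssCode V₁ V₂ ↔ ∀ p ∈ ({p | ∃ v ∈ V₁, p = fun e => (v e, 0)} ∪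
      {p | ∃ w ∈ V₂, p = fun e => (0, w e)} : Set (ι → ZMod 2 × ZMod 2)), pauliOp p ψ = ψ := Iff.rfl
  rw [h]
  constructor
  · intro h
    constructor
    · intro v hv x
      have := congrArg (fun φ : QubitSpace ι => φ x) (h _ (Or.inl ⟨v, hv, rfl⟩))
      rw [← this, pauliOp_apply]
      simp
    · intro x hx
      obtain ⟨w, hw, hwx⟩ : ∃ w ∈ V₂, w ⬝ᵥ x ≠ 0 := by
        simpa [mem_perp] using hx
      have := congrArg (fun φ : QubitSpace ι => φ x) (h _ (Or.inr ⟨w, hw, rfl⟩))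
      simp only [pauliOp_apply, (zmod_two_cases _).resolve_left hwx, signChar_one] at this
      rw [show (fun _ : ι => (0 : ZMod 2)) = 0 from rfl, add_zero] at this
      linear_combination (-1 / 2 : ℂ) * this
  · rintro ⟨h1, h2⟩ p (⟨v, hv, rfl⟩ | ⟨w, hw, rfl⟩)
    · ext x
      rw [pauliOp_apply]
      simpa using h1 v hv x
    · ext x
      rw [pauliOp_apply, show (fun e => ((0, w e) : ZMod 2 × ZMod 2).1) = 0 from rfl, add_zero]
      by_cases hx : x ∈ perp V₂
      · simp [hx w hw]
      · simp [h2 x hx]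

/-- The code is the space of functions on a quotient of spaces of bit strings. -/
def cssCodeEquiv (h : V₁ ≤ perp V₂) :
    cssCode V₁ V₂ ≃ₗ[ℂ] ((perp V₂ ⧸ V₁.submoduleOf (perp V₂)) → ℂ) := by
  classical
  exact
  { toFun := fun ψ q => Quotient.liftOn' q (fun x => ψ.1 x.1) fun x y hxy => by
      have hxy' : -x + y ∈ V₁.submoduleOf (perp V₂) := QuotientAddGroup.leftRel_apply.1 hxy
      have := (mem_cssCode_iff.1 ψ.2).1 _ hxy' x.1
      rw [← this]
      simp
    map_add' := fun φ ψ => by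
      funext q
      induction q using Submodule.Quotient.induction_on with | _ x => rfl
    map_smul' := fun c ψ => by
      funext q
      induction q using Submodule.Quotient.induction_on with | _ x => rfl
    invFun := fun f => ⟨WithLp.toLp 2 fun x =>
        if hx : x ∈ perp V₂ then f (Submodule.Quotient.mk ⟨x, hx⟩) else 0, mem_cssCode_iff.2 ⟨by
      intro v hv x
      by_cases hx : x ∈ perp V₂
      · have hxv : x + v ∈ perp V₂ := add_mem hx (h hv)
        simp only [hx, hxv, dif_pos]
        congr 1
        rw [Submodule.Quotient.eq]
        change x + v - x ∈ V₁
        simpa using hv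
      · have hxv : x + v ∉ perp V₂ := fun h' => hx (by simpa using sub_mem h' (h hv))
        simp only [hx, hxv, dif_neg, not_false_eq_true], fun x hx => by simp [hx]⟩⟩
    left_inv := fun ψ => by
      ext x
      by_cases hx : x ∈ perp V₂
      · simp only [hx, dif_pos]; rfl
      · simp only [hx, dif_neg, not_false_eq_true]
        exact ((mem_cssCode_iff.1 ψ.2).2 x hx).symm
    right_inv := fun f => by
      funext q
      induction q using Submodule.Quotient.induction_on with | _ x =>
      change (if hx : x.1 ∈ perp V₂ then f (Submodule.Quotient.mk ⟨x.1, hx⟩) else 0) = _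
      rw [dif_pos x.2] }

lemma finrank_cssCode (h : V₁ ≤ perp V₂) : Module.finrank ℂ (cssCode V₁ V₂) =
    2 ^ (Module.finrank (ZMod 2) (perp V₂) - Module.finrank (ZMod 2) V₁) := by
  classical
  have : Fintype (perp V₂ ⧸ V₁.submoduleOf (perp V₂)) := Fintype.ofFinite _
  rw [(cssCodeEquiv h).finrank_eq, Module.finrank_fintype_fun_eq_card,
    Module.card_eq_pow_finrank (K := ZMod 2), ZMod.card]
  congr 1
  have := Submodule.finrank_quotient_add_finrank (V₁.submoduleOf (perp V₂))
  rw [(Submodule.submoduleOfEquivOfLe h).finrank_eq] at this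
  omega

/-! ### Matrix elements of Pauli operators on a CSS code -/

open Classical in
/-- The coset state of `x₀`. -/
def cosetState (V : Submodule (ZMod 2) (ι → ZMod 2)) (x₀ : ι → ZMod 2) : QubitSpace ι :=
  WithLp.toLp 2 fun x => if x + x₀ ∈ V then 1 else 0

open Classical in
lemma cosetState_apply (V : Submodule (ZMod 2) (ι → ZMod 2)) (x₀ x : ι → ZMod 2) :
    cosetState V x₀ x = if x + x₀ ∈ V then 1 else 0 := rfl

lemma cosetState_mem (h : V₁ ≤ perp V₂) {x₀ : ι → ZMod 2} (hx₀ : x₀ ∈ perp V₂) :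
    cosetState V₁ x₀ ∈ cssCode V₁ V₂ := by
  classical
  rw [mem_cssCode_iff]
  constructor
  · intro v hv x
    rw [cosetState_apply, cosetState_apply, add_right_comm]
    simp only [V₁.add_mem_iff_left hv]
  · intro x hx
    rw [cosetState_apply, if_neg]
    exact fun h' => hx (((perp V₂).add_mem_iff_left hx₀).1 (h h'))

-- Translation by `y₀` turns the inner product into a sum over `V₁`, where the character of the
-- `Z`-part is trivial; so all terms are equal.
open Classical in
lemma inner_cosetState {p : ι → ZMod 2 × ZMod 2} (hp : (fun e => (p e).2) ∈ perp V₁)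
    (x₀ y₀ : ι → ZMod 2) : inner ℂ (cosetState V₁ y₀) (pauliOp p (cosetState V₁ x₀)) =
      if y₀ + (fun e => (p e).1) + x₀ ∈ V₁ then
        signChar ((fun e => (p e).2) ⬝ᵥ y₀) * Fintype.card V₁ else 0 := by
  rw [inner_eq_sum, ← Equiv.sum_comp (Equiv.addRight y₀)]
  simp only [pauliOp_apply, cosetState_apply, Equiv.coe_addRight, add_assoc, ZModModule.add_self,
    add_zero]
  have key : ∀ x : ι → ZMod 2, (star (if x ∈ V₁ then (1 : ℂ) else 0) *
      (signChar ((fun e => (p e).2) ⬝ᵥ (x + y₀)) *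
        if x + (y₀ + ((fun e => (p e).1) + x₀)) ∈ V₁ then 1 else 0)) =
      if x ∈ V₁ then (if y₀ + ((fun e => (p e).1) + x₀) ∈ V₁ then
        signChar ((fun e => (p e).2) ⬝ᵥ y₀) else 0) else 0 := by
    intro x
    by_cases hx : x ∈ V₁
    · have h0 : (fun e => (p e).2) ⬝ᵥ x = 0 := by rw [dotProduct_comm]; exact hp x hx
      simp only [hx, if_true, V₁.add_mem_iff_right hx, star_one, one_mul, dotProduct_add, h0,
        zero_add, mul_ite, mul_one, mul_zero]
    · simp [hx]
  simp only [key]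
  rw [← Finset.sum_filter, Finset.sum_const, nsmul_eq_mul, Fintype.card_subtype]
  split_ifs
  · rw [mul_comm]
  · rw [mul_zero]

/-- Such a translation moves `V₂^⊥`, which supports all code vectors, off itself; all matrix
elements vanish. -/
lemma actsAsScalar_of_notMem_perp {p : ι → ZMod 2 × ZMod 2}
    (hp : (fun e => (p e).1) ∉ perp V₂) : ActsAsScalar (cssCode V₁ V₂) p := by
  refine ⟨0, fun φ hφ ψ hψ => ?_⟩
  rw [inner_eq_sum, zero_mul]
  refine Finset.sum_eq_zero fun x _ => ?_
  by_cases hx : x ∈ perp V₂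
  · have : (x + fun e => (p e).1) ∉ perp V₂ := fun h => hp (((perp V₂).add_mem_iff_right hx).1 h)
    rw [pauliOp_apply, (mem_cssCode_iff.1 hψ).2 _ this, mul_zero, mul_zero]
  · rw [(mem_cssCode_iff.1 hφ).2 _ hx, star_zero, zero_mul]

/-- Some `v ∈ V₁` has odd product with the `Z`-part. Translating the sum by `v` fixes the code
vectors and flips the sign, so all matrix elements vanish. -/
lemma actsAsScalar_of_notMem_perp' {p : ι → ZMod 2 × ZMod 2}
    (hp : (fun e => (p e).2) ∉ perp V₁) : ActsAsScalar (cssCode V₁ V₂) p := by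
  refine ⟨0, fun φ hφ ψ hψ => ?_⟩
  obtain ⟨v, hv, hvp⟩ : ∃ v ∈ V₁, v ⬝ᵥ (fun e => (p e).2) ≠ 0 := by
    simpa [mem_perp] using hp
  have hvp' : (fun e => (p e).2) ⬝ᵥ v = 1 := by
    rw [dotProduct_comm]; exact (zmod_two_cases _).resolve_left hvp
  have h : inner ℂ φ (pauliOp p ψ) = -inner ℂ φ (pauliOp p ψ) := by
    conv_lhs => rw [inner_eq_sum, ← Equiv.sum_comp (Equiv.addRight v)]
    rw [inner_eq_sum, ← Finset.sum_neg_distrib]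
    refine Finset.sum_congr rfl fun x _ => ?_
    rw [Equiv.coe_addRight, (mem_cssCode_iff.1 hφ).1 v hv, pauliOp_apply, pauliOp_apply,
      add_right_comm, (mem_cssCode_iff.1 hψ).1 v hv, dotProduct_add, hvp', signChar_add,
      signChar_one]
    ring
  rw [zero_mul]
  linear_combination (1 / 2 : ℂ) * h

lemma actsAsScalar_of_mem {p : ι → ZMod 2 × ZMod 2}
    (hp₁ : (fun e => (p e).1) ∈ V₁) (hp₂ : (fun e => (p e).2) ∈ V₂) :
    ActsAsScalar (cssCode V₁ V₂) p := by
  refine ⟨1, fun φ hφ ψ hψ => ?_⟩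
  rw [one_mul]
  congr 1
  ext x
  rw [pauliOp_apply, (mem_cssCode_iff.1 hψ).1 _ hp₁]
  by_cases hx : x ∈ perp V₂
  · rw [hx _ hp₂, signChar_zero, one_mul]
  · rw [(mem_cssCode_iff.1 hψ).2 _ hx, mul_zero]

/-- The Pauli operators which do not act as a scalar on a CSS code. -/
lemma not_actsAsScalar_iff (h : V₁ ≤ perp V₂) {p : ι → ZMod 2 × ZMod 2} :
    ¬ ActsAsScalar (cssCode V₁ V₂) p ↔ (fun e => (p e).1) ∈ perp V₂ ∧ (fun e => (p e).2) ∈ perp V₁ ∧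
      ((fun e => (p e).1) ∉ V₁ ∨ (fun e => (p e).2) ∉ V₂) := by
  classical
  constructor
  · intro hp
    refine ⟨by_contra fun h => hp (actsAsScalar_of_notMem_perp h),
      by_contra fun h => hp (actsAsScalar_of_notMem_perp' h), ?_⟩
    by_contra! h'
    exact hp (actsAsScalar_of_mem h'.1 h'.2)
  · rintro ⟨ha, hb, hab⟩ ⟨c, hc⟩
    set a : ι → ZMod 2 := fun e => (p e).1 with ha'
    set b : ι → ZMod 2 := fun e => (p e).2 with hb'
    have hcard : (Fintype.card V₁ : ℂ) ≠ 0 := by exact_mod_cast Fintype.card_ne_zero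
    have hself : ∀ x, inner ℂ (cosetState V₁ x) (cosetState V₁ x) = (Fintype.card V₁ : ℂ) := by
      intro x
      have h1 : pauliOp (0 : ι → ZMod 2 × ZMod 2) (cosetState V₁ x) = cosetState V₁ x := by
        ext y
        rw [pauliOp_apply]
        change signChar ((0 : ι → ZMod 2) ⬝ᵥ y) * cosetState V₁ x (y + 0) = _
        simp
      have h2 := inner_cosetState (V₁ := V₁) (p := 0) (zero_mem _) x x
      rw [h1] at h2
      rw [h2]
      change (if x + 0 + x ∈ V₁ then signChar ((0 : ι → ZMod 2) ⬝ᵥ x) * (Fintype.card V₁ : ℂ)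
        else 0) = _
      rw [add_zero, ZModModule.add_self, if_pos (zero_mem _), zero_dotProduct, signChar_zero,
        one_mul]
    have hzero := cosetState_mem h (zero_mem (perp V₂))
    -- If `a ∈ V₁`, then `b ∉ V₂ = V₂^⊥^⊥` has odd product with some `x ∈ V₂^⊥`, and the diagonal
    -- elements at the cosets of `0` and `x` have opposite signs.
    by_cases ha₁ : a ∈ V₁
    · have hb₂ := hab.resolve_left (not_not.2 ha₁)
      rw [← perp_perp V₂] at hb₂
      obtain ⟨x, hx, hxb⟩ : ∃ x ∈ perp V₂, x ⬝ᵥ b ≠ 0 := by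
        simpa [mem_perp (V := perp V₂)] using hb₂
      have hxb' : b ⬝ᵥ x = 1 := by
        rw [dotProduct_comm]; exact (zmod_two_cases _).resolve_left hxb
      have h1 := hc _ hzero _ hzero
      rw [inner_cosetState hb, hself, if_pos (by simpa using ha₁), dotProduct_zero, signChar_zero,
        one_mul] at h1
      have hxm := cosetState_mem h hx
      have h2 := hc _ hxm _ hxm
      rw [inner_cosetState hb, hself, if_pos (by
        rw [add_right_comm, ZModModule.add_self, zero_add]; exact ha₁), hxb', signChar_one] at h2
      have : (2 : ℂ) * Fintype.card V₁ = 0 := by linear_combination h1 - h2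
      simp [hcard] at this
    -- If `a ∉ V₁`, the diagonal element at the coset of `0` vanishes and forces `c = 0`, but the
    -- element between the cosets of `0` and `a` does not vanish.
    · have h1 := hc _ hzero _ hzero
      rw [inner_cosetState hb, hself, if_neg (by simpa using ha₁)] at h1
      have hc0 : c = 0 := by
        rcases mul_eq_zero.1 h1.symm with h | h
        exacts [h, absurd h hcard]
      have h2 := hc _ (cosetState_mem h ha) _ hzero
      rw [inner_cosetState hb, if_pos (by
        rw [add_zero, ZModModule.add_self]; exact zero_mem _), hc0, zero_mul] at h2
      exact mul_ne_zero (signChar_ne_zero _) hcard h2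

/-- The distance of a CSS code. -/
lemma isLeast_weight_cssCode (h : V₁ ≤ perp V₂) {d₁ d₂ : ℕ}
    (h₁ : IsLeast {w | ∃ c ∈ perp V₁, c ∉ V₂ ∧ hammingNorm c = w} d₁)
    (h₂ : IsLeast {w | ∃ c ∈ perp V₂, c ∉ V₁ ∧ hammingNorm c = w} d₂) :
    IsLeast {w : ℕ | ∃ p : ι → ZMod 2 × ZMod 2, ¬ ActsAsScalar (cssCode V₁ V₂) p ∧
      pauliWeight p = w} (min d₁ d₂) := by
  constructor
  · rcases min_choice d₁ d₂ with hd | hd <;> rw [hd]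
    · obtain ⟨c, hc, hc', hw⟩ := h₁.1
      refine ⟨fun e => (0, c e), (not_actsAsScalar_iff h).2 ⟨zero_mem _, hc, Or.inr hc'⟩, ?_⟩
      rw [← hw, pauliWeight, hammingNorm]
      simp [Prod.ext_iff]
    · obtain ⟨c, hc, hc', hw⟩ := h₂.1
      refine ⟨fun e => (c e, 0), (not_actsAsScalar_iff h).2 ⟨hc, zero_mem _, Or.inl hc'⟩, ?_⟩
      rw [← hw, pauliWeight, hammingNorm]
      simp [Prod.ext_iff]
  · rintro _ ⟨p, hp, rfl⟩
    obtain ⟨ha, hb, hab⟩ := (not_actsAsScalar_iff h).1 hp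
    -- The offending part alone already has at most the weight of the whole operator.
    rcases hab with hab | hab
    · refine (min_le_right _ _).trans ((h₂.2 ⟨_, ha, hab, rfl⟩).trans (Finset.card_le_card ?_))
      exact Finset.monotone_filter_right _ fun e _ he h0 => he (by simp [h0])
    · refine (min_le_left _ _).trans ((h₁.2 ⟨_, hb, hab, rfl⟩).trans (Finset.card_le_card ?_))
      exact Finset.monotone_filter_right _ fun e _ he h0 => he (by simp [h0])

end Pauli

/-! ### The incidence of simplices and of dual blocks -/

/-- This is a barycentric coordinate, extended to the ambient space by completing the vertices to an
affine basis. -/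
lemma AffineIndependent.exists_affineMap_eq_one {E : Type*} [AddCommGroup E] [Module ℝ E]
    {s : Finset E} (hs : AffineIndependent ℝ ((↑) : s → E)) {v : E} (hv : v ∈ s) :
    ∃ f : E →ᵃ[ℝ] ℝ, f v = 1 ∧ ∀ w ∈ s, w ≠ v → f w = 0 := by
  obtain ⟨t, hst, ht, htop⟩ := exists_subset_affineIndependent_affineSpan_eq_top
    (s := (s : Set E)) hs
  let b : AffineBasis t ℝ E := ⟨(↑), ht, by rwa [Subtype.range_coe]⟩
  refine ⟨b.coord ⟨v, hst hv⟩, b.coord_apply_eq _, fun w hw hwv => ?_⟩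
  exact b.coord_apply_ne (i := ⟨v, hst hv⟩) (j := ⟨w, hst hw⟩)
    fun h => hwv (congrArg Subtype.val h).symm

lemma AffineMap.map_centroid_id {E : Type*} [AddCommGroup E] [Module ℝ E] (f : E →ᵃ[ℝ] ℝ)
    {s : Finset E} (hs : s.Nonempty) :
    f (s.centroid ℝ _root_.id) = (s.card : ℝ)⁻¹ * ∑ w ∈ s, f w := by
  rw [Finset.centroid_def, Finset.map_affineCombination _ _ _
    (s.sum_centroidWeights_eq_one_of_nonempty ℝ hs),
    Finset.affineCombination_eq_linear_combination _ _ _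
    (s.sum_centroidWeights_eq_one_of_nonempty ℝ hs), Finset.mul_sum]
  simp

namespace SimplicialStructure

variable {M : Type u} [TopologicalSpace M] (S : SimplicialStructure M)

lemma toM_subset_toM {A B : Set (EuclideanSpace ℝ (Fin S.N))} (hA : A ⊆ S.K.space) :
    S.toM A ⊆ S.toM B ↔ A ⊆ B := by
  rw [toM, toM, Set.image_subset_image_iff S.homeo.injective]
  exact ⟨fun h x hx => h (a := ⟨x, hA hx⟩) hx, fun h x hx => h hx⟩

lemma closedCell_simplices_subset {j k : ℕ} (τ : S.simplices.Cell j) (σ : S.simplices.Cell k) :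
    S.simplices.closedCell τ ⊆ S.simplices.closedCell σ ↔ τ.1 ⊆ σ.1 :=
  (S.toM_subset_toM (Geometry.SimplicialComplex.convexHull_subset_space τ.2.1)).trans
    (Geometry.SimplicialComplex.face_subset_face_iff τ.2.1 σ.2.1)

variable {S} in
-- Suppose the barycentre of `t` lies in the part of the block given by a chain with greatest member
-- `u`, and let `v ∈ s`. The coordinate of `v` in `u` is positive at the barycentre of each member,
-- as all contain `v`, hence also at the given point. If `v ∉ t`, it vanishes on the common face of
-- `t` and `u`, which contains that point.
lemma centroid_mem_dualBlock {s t : Finset (EuclideanSpace ℝ (Fin S.N))} (ht : t ∈ S.K.faces) :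
    t.centroid ℝ id ∈ S.dualBlock s ↔ s ⊆ t := by
  constructor
  · intro h
    obtain ⟨C, ⟨hCK, hC, hsC⟩, hx⟩ := Set.mem_iUnion₂.1 h
    have hCne : C.Nonempty := by
      rw [Set.nonempty_iff_ne_empty]
      rintro rfl
      simp at hx
    obtain ⟨u, hu⟩ := (S.finite_faces.subset hCK).exists_maximal hCne
    have hmax : ∀ c ∈ C, c ⊆ u := fun c hc => by
      rcases hC.total hc hu.prop with h | h
      exacts [h, hu.le_of_ge hc h]
    intro v hv
    by_contra hvt
    obtain ⟨f, hf1, hf0⟩ := (S.K.indep (hCK hu.prop)).exists_affineMap_eq_one (hsC u hu.prop hv)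
    have hpos : 0 < f (t.centroid ℝ id) := by
      refine convexHull_min (t := f ⁻¹' Set.Ioi 0) ?_ ((convex_Ioi 0).affine_preimage f) hx
      rintro _ ⟨c, hc, rfl⟩
      have hvc := hsC c hc hv
      rw [Set.mem_preimage, Set.mem_Ioi, f.map_centroid_id ⟨v, hvc⟩,
        Finset.sum_eq_single_of_mem v hvc fun w hw hwv => hf0 w (hmax c hc hw) hwv, hf1, mul_one]
      have : 0 < c.card := Finset.card_pos.2 ⟨v, hvc⟩
      positivity
    have hu' : t.centroid ℝ id ∈ convexHull ℝ (u : Set (EuclideanSpace ℝ (Fin S.N))) := by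
      refine convexHull_min ?_ (convex_convexHull ℝ _) hx
      rintro _ ⟨c, hc, rfl⟩
      exact convexHull_mono (by exact_mod_cast hmax c hc) (Finset.centroid_mem_convexHull c
        (Geometry.SimplicialComplex.nonempty_of_mem_faces (hCK hc)))
    have ht' := Finset.centroid_mem_convexHull t
      (Geometry.SimplicialComplex.nonempty_of_mem_faces ht) (R := ℝ)
    have hzero : f (t.centroid ℝ id) = 0 := by
      refine convexHull_min (t := f ⁻¹' {0}) ?_ ((convex_singleton 0).affine_preimage f)
        (S.K.inter_subset_convexHull ht (hCK hu.prop) ⟨ht', hu'⟩)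
      rintro w ⟨hwt, hwu⟩
      exact hf0 w hwu fun h => hvt (h ▸ hwt)
    exact hpos.ne' hzero
  · intro h
    refine Set.mem_iUnion₂.2 ⟨{t},
      ⟨by simpa using ht, Set.pairwise_singleton _ _, by simpa using h⟩,
      ?_⟩
    simp

variable {S} in
lemma dualBlock_subset_space {s : Finset (EuclideanSpace ℝ (Fin S.N))} :
    S.dualBlock s ⊆ S.K.space := by
  refine Set.iUnion₂_subset fun C hC x hx => ?_
  obtain ⟨hCK, hC, -⟩ := hC
  have hCne : C.Nonempty := by
    rw [Set.nonempty_iff_ne_empty]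
    rintro rfl
    simp at hx
  obtain ⟨u, hu⟩ := (S.finite_faces.subset hCK).exists_maximal hCne
  refine Geometry.SimplicialComplex.convexHull_subset_space (hCK hu.prop)
    (convexHull_min ?_ (convex_convexHull ℝ _) hx)
  rintro _ ⟨c, hc, rfl⟩
  have hcu : c ⊆ u := by
    rcases hC.total hc hu.prop with h | h
    exacts [h, hu.le_of_ge hc h]
  exact convexHull_mono (by exact_mod_cast hcu) (Finset.centroid_mem_convexHull c
    (Geometry.SimplicialComplex.nonempty_of_mem_faces (hCK hc)))

/-- The barycentre of `τ` lies in the block of `τ` and detects whether that block is contained in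
the block of `σ`. -/
lemma closedCell_dual_subset {n j k : ℕ} (τ : (S.dual n).Cell j) (σ : (S.dual n).Cell k) :
    (S.dual n).closedCell τ ⊆ (S.dual n).closedCell σ ↔ σ.1 ⊆ τ.1 := by
  refine (S.toM_subset_toM dualBlock_subset_space).trans ?_
  constructor
  · intro h
    exact (centroid_mem_dualBlock τ.2.1).1 (h ((centroid_mem_dualBlock τ.2.1).2 subset_rfl))
  · intro h
    exact Set.biUnion_subset_biUnion_left fun C hC =>
      ⟨hC.1, hC.2.1, fun t ht => h.trans (hC.2.2 t ht)⟩

/-! ### Incidence matrices and their duality -/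

open Classical in
/-- The incidence matrix of simplices of consecutive dimensions. -/
def incidence (j : ℕ) : Matrix (S.simplices.Cell j) (S.simplices.Cell (j + 1)) (ZMod 2) :=
  Matrix.of fun τ σ => if τ.1 ⊆ σ.1 then 1 else 0

lemma boundary_simplices (j : ℕ) : S.simplices.boundary j = (S.incidence j).mulVecLin := by
  classical
  refine LinearMap.ext fun c => funext fun τ => ?_
  simp only [CellFamily.boundary, LinearMap.coe_mk, AddHom.coe_mk, Matrix.mulVecLin_apply,
    Matrix.mulVec, dotProduct]
  refine Finset.sum_congr rfl fun σ _ => ?_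
  simp [closedCell_simplices_subset, incidence]

/-- The cells of the dual cellulation correspond to the simplices of complementary dimension. -/
def dualCellEquiv {n j k : ℕ} (h : j + k = n) : (S.dual n).Cell k ≃ S.simplices.Cell j :=
  Equiv.subtypeEquivRight fun s => by
    have : s.card + k = n + 1 ↔ s.card = j + 1 := by omega
    rw [this]

/-- Passing to dual blocks reverses incidence, so the dual boundary is the simplicial coboundary. -/
lemma boundary_dual {n j k : ℕ} (h : j + (k + 1) = n) (c : S.simplices.Chain j) :
    (S.dual n).boundary k (c ∘ S.dualCellEquiv h) =
      ((S.incidence j).transpose.mulVecLin c) ∘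
        S.dualCellEquiv (show j + 1 + k = n by omega) := by
  classical
  funext τ
  simp only [CellFamily.boundary, LinearMap.coe_mk, AddHom.coe_mk, Matrix.mulVecLin_apply,
    Matrix.mulVec, dotProduct, Function.comp_apply]
  rw [← Equiv.sum_comp (S.dualCellEquiv h)]
  refine Finset.sum_congr rfl fun σ _ => ?_
  simp only [closedCell_dual_subset, incidence, Matrix.transpose_apply, Matrix.of_apply, ite_mul,
    one_mul, zero_mul]
  rfl

lemma perp_range_mulVecLin {α β : Type*} [Fintype α] [Fintype β] (A : Matrix β α (ZMod 2)) :
    perp (LinearMap.range A.mulVecLin) = LinearMap.ker A.transpose.mulVecLin := by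
  ext w
  rw [mem_perp, LinearMap.mem_ker, Matrix.mulVecLin_apply]
  simp only [LinearMap.mem_range, forall_exists_index, forall_apply_eq_imp_iff,
    Matrix.mulVecLin_apply]
  rw [← dotProduct_eq_zero_iff]
  refine forall_congr' fun v => ?_
  rw [dotProduct_comm (A.mulVec v), Matrix.dotProduct_mulVec, Matrix.mulVec_transpose]

/-- For `k = 0` every dual chain is a cycle, so the boundaries must vanish; `hdim` is there for this
case. -/
lemma mem_cycles_dual_iff {n i k : ℕ} (h : i + k = n)
    (hdim : k = 0 → IsEmpty (S.simplices.Cell (i + 1))) (c : S.simplices.Chain i) :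
    c ∘ S.dualCellEquiv h ∈ (S.dual n).cycles k ↔ c ∈ perp (S.simplices.boundaries i) := by
  rw [CellFamily.boundaries, boundary_simplices, perp_range_mulVecLin]
  cases k with
  | zero =>
    have := hdim rfl
    refine iff_of_true trivial (LinearMap.mem_ker.2 (funext fun σ => isEmptyElim σ))
  | succ k =>
    rw [CellFamily.cycles, LinearMap.mem_ker, LinearMap.mem_ker, boundary_dual]
    exact (Equiv.surjective _).injective_comp_right.eq_iff' rfl

lemma cycles_simplices_succ (i : ℕ) :
    S.simplices.cycles (i + 1) = perp (LinearMap.range (S.incidence i).transpose.mulVecLin) := by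
  rw [perp_range_mulVecLin, CellFamily.cycles, boundary_simplices, Matrix.transpose_transpose]

/-- The cycles are the complement of the range of the coboundary, and complementing twice returns
that range. For `i = 0` both sides say that `c = 0`: a dual cell of dimension `n + 1` would come
from an empty face. -/
lemma mem_boundaries_dual_iff {n i k : ℕ} (h : i + k = n) (c : S.simplices.Chain i) :
    c ∘ S.dualCellEquiv h ∈ (S.dual n).boundaries k ↔ c ∈ perp (S.simplices.cycles i) := by
  have hinj : Function.Injective fun c : S.simplices.Chain i => c ∘ S.dualCellEquiv h :=
    (Equiv.surjective _).injective_comp_right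
  cases i with
  | zero =>
    have hempty : IsEmpty ((S.dual n).Cell (k + 1)) := ⟨fun s => by
      have h1 := s.2.2
      have h2 := Finset.card_pos.2 (Geometry.SimplicialComplex.nonempty_of_mem_faces s.2.1)
      omega⟩
    have h1 : c ∈ perp (S.simplices.cycles 0) ↔ c = 0 := by
      refine ⟨fun hc => dotProduct_eq_zero _ fun w => ?_, fun hc => hc ▸ zero_mem _⟩
      rw [dotProduct_comm]
      exact hc w trivial
    rw [h1]
    constructor
    · rintro ⟨d, hd⟩
      rw [Subsingleton.elim d 0, map_zero] at hd
      exact hinj hd.symm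
    · rintro rfl
      exact zero_mem _
  | succ i =>
    rw [cycles_simplices_succ, perp_perp]
    have h' : i + (k + 1) = n := by omega
    constructor
    · rintro ⟨d, hd⟩
      obtain ⟨d, rfl⟩ : ∃ d', d' ∘ S.dualCellEquiv h' = d :=
        ⟨d ∘ (S.dualCellEquiv h').symm, by funext x; simp⟩
      rw [boundary_dual] at hd
      exact ⟨d, hinj hd⟩
    · rintro ⟨d, rfl⟩
      exact ⟨d ∘ S.dualCellEquiv h', S.boundary_dual h' d⟩

lemma hammingNorm_comp_equiv {α β : Type*} [Fintype α] [Fintype β] (e : α ≃ β) (c : β → ZMod 2) :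
    hammingNorm (c ∘ e) = hammingNorm c := by
  rw [hammingNorm, hammingNorm]
  refine Finset.card_equiv e fun x => by simp

/-- The combinatorial systole of the dual cellulation in terms of cochains. -/
lemma csys_dual {n i : ℕ} (hi : i ≤ n) (hdim : i = n → IsEmpty (S.simplices.Cell (i + 1))) :
    (S.dual n).csys (n - i) = sInf {w | ∃ c ∈ perp (S.simplices.boundaries i),
      c ∉ perp (S.simplices.cycles i) ∧ hammingNorm c = w} := by
  have h : i + (n - i) = n := by omega
  have hdim' : n - i = 0 → IsEmpty (S.simplices.Cell (i + 1)) := fun h' => hdim (by omega)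
  rw [CellFamily.csys]
  congr 1
  ext w
  constructor
  · rintro ⟨c, hc, hc', hw⟩
    obtain ⟨c, rfl⟩ : ∃ c', c' ∘ S.dualCellEquiv h = c :=
      ⟨c ∘ (S.dualCellEquiv h).symm, by funext x; simp⟩
    rw [hammingNorm_comp_equiv] at hw
    exact ⟨c, (S.mem_cycles_dual_iff h hdim' c).1 hc,
      fun h' => hc' ((S.mem_boundaries_dual_iff h c).2 h'), hw⟩
  · rintro ⟨c, hc, hc', hw⟩
    exact ⟨c ∘ S.dualCellEquiv h, (S.mem_cycles_dual_iff h hdim' c).2 hc,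
      fun h' => hc' ((S.mem_boundaries_dual_iff h c).1 h'), by rw [hammingNorm_comp_equiv, hw]⟩

/-! ### Simplicial homology in terms of functions on simplices -/

/-- The functions on the simplices of a given dimension, as chains of finite sets. -/
def toFinsetChain (j : ℕ) :
    S.simplices.Chain j →ₗ[ZMod 2] (Finset (EuclideanSpace ℝ (Fin S.N)) →₀ ZMod 2) :=
  Finsupp.lmapDomain (ZMod 2) (ZMod 2) Subtype.val ∘ₗ
    (Finsupp.linearEquivFunOnFinite (ZMod 2) (ZMod 2) (S.simplices.Cell j)).symm.toLinearMap

lemma toFinsetChain_single {j : ℕ} (σ : S.simplices.Cell j) :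
    S.toFinsetChain j (Pi.single σ 1) = Finsupp.single σ.1 1 := by
  exact (congrArg _ (Finsupp.linearEquivFunOnFinite_symm_single (ZMod 2) (ZMod 2) _ σ 1)).trans
    Finsupp.mapDomain_single

lemma toFinsetChain_injective (j : ℕ) : Function.Injective (S.toFinsetChain j) :=
  (Finsupp.mapDomain_injective Subtype.val_injective).comp (LinearEquiv.injective _)

lemma range_toFinsetChain (j : ℕ) :
    LinearMap.range (S.toFinsetChain j) = S.K.simplicialChains (j + 1) := by
  apply le_antisymm
  · rintro _ ⟨c, rfl⟩
    refine (Finsupp.mem_supported _ _).2 fun s hs => ?_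
    classical
    obtain ⟨σ, -, rfl⟩ := Finset.mem_image.1 (Finsupp.mapDomain_support hs)
    exact ⟨fun _ => σ.2.1, σ.2.2⟩
  · intro c hc
    refine Finsupp.map_mem_of_mem_supported (f := LinearMap.id) (fun s hs => ?_) hc
    exact ⟨Pi.single ⟨s, hs.1 (Finset.card_pos.1 (by have := hs.2; omega)), hs.2⟩ 1,
      S.toFinsetChain_single _⟩

lemma boundary_toFinsetChain {j : ℕ} (c : S.simplices.Chain (j + 1)) :
    FinsetChain.boundary _ (S.toFinsetChain (j + 1) c) =
      S.toFinsetChain j (S.simplices.boundary j c) := by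
  classical
  refine LinearMap.congr_fun (f := FinsetChain.boundary _ ∘ₗ S.toFinsetChain (j + 1))
    (g := S.toFinsetChain j ∘ₗ S.simplices.boundary j)
    (LinearMap.pi_ext' fun σ => LinearMap.ext_ring ?_) c
  change FinsetChain.boundary _ (S.toFinsetChain (j + 1) (Pi.single σ 1)) =
    S.toFinsetChain j (S.simplices.boundary j (Pi.single σ 1))
  have h : S.simplices.boundary j (Pi.single σ 1) =
      ∑ τ with τ.1 ⊆ σ.1, (Pi.single τ 1 : S.simplices.Chain j) := by
    rw [boundary_simplices, Matrix.mulVecLin_apply, Matrix.mulVec_single_one]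
    funext τ
    rw [Finset.sum_apply]
    simp [Pi.single_apply, incidence, Matrix.col]
  rw [h, toFinsetChain_single, FinsetChain.boundary_single, map_sum]
  simp only [toFinsetChain_single]
  have hface {v} (hv : v ∈ σ.1) : σ.1.erase v ∈ S.K.faces ∧ (σ.1.erase v).card = j + 1 := by
    have hcard : (σ.1.erase v).card = j + 1 := by rw [Finset.card_erase_of_mem hv, σ.2.2]; rfl
    exact ⟨S.K.down_closed σ.2.1 (Finset.erase_subset _ _) (Finset.card_pos.1 (by omega)), hcard⟩
  refine Finset.sum_bij (M := Finset (EuclideanSpace ℝ (Fin S.N)) →₀ ZMod 2)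
    (fun v hv => (⟨σ.1.erase v, hface hv⟩ : S.simplices.Cell j)) ?_ ?_ ?_ ?_
  · intro v hv
    exact Finset.mem_filter.2 ⟨Finset.mem_univ _, Finset.erase_subset v σ.1⟩
  · intro v hv w hw h
    have h' : σ.1.erase v = σ.1.erase w := congrArg Subtype.val h
    exact Finset.erase_injOn σ.1 hv hw h'
  · intro τ hτ
    have hτσ : τ.1 ⊆ σ.1 := (Finset.mem_filter.1 hτ).2
    obtain ⟨v, hv⟩ := Finset.card_eq_one.1 (show (σ.1 \ τ.1).card = 1 by
      rw [Finset.card_sdiff_of_subset hτσ, σ.2.2, τ.2.2]; omega)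
    have hvσ : v ∈ σ.1 \ τ.1 := hv ▸ Finset.mem_singleton_self v
    refine ⟨v, (Finset.mem_sdiff.1 hvσ).1, Subtype.ext ?_⟩
    change σ.1.erase v = τ.1
    rw [Finset.erase_eq, ← hv, Finset.sdiff_sdiff_eq_self hτσ]
  · intro v hv
    congr!

/-- Simplicial homology in terms of functions on simplices. -/
def simplicialEquiv (i : ℕ) :
    Subquotient (S.simplices.cycles i) (S.simplices.boundaries i) ≃ₗ[ZMod 2]
    Subquotient (S.K.simplicialCycles i) (S.K.simplicialBoundaries i) :=
  have hcyc : ∀ z, z ∈ S.simplices.cycles i ↔ S.toFinsetChain i z ∈ S.K.simplicialCycles i := by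
    intro z
    have hz : S.toFinsetChain i z ∈ S.K.simplicialChains (i + 1) := by
      rw [← range_toFinsetChain]; exact ⟨z, rfl⟩
    rw [Geometry.SimplicialComplex.mem_simplicialCycles_iff]
    cases i with
    | zero => exact iff_of_true trivial ⟨hz, Or.inl rfl⟩
    | succ i =>
      rw [CellFamily.cycles, LinearMap.mem_ker, boundary_toFinsetChain,
        map_eq_zero_iff _ (S.toFinsetChain_injective i)]
      exact ⟨fun h => ⟨hz, Or.inr h⟩, fun h => h.2.resolve_left (Nat.succ_ne_zero i)⟩
  subquotientEquiv (S.toFinsetChain i) (fun z hz => (hcyc z).1 hz)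
    (by
      rintro _ ⟨c, rfl⟩
      refine ⟨S.toFinsetChain (i + 1) c, ?_, S.boundary_toFinsetChain c⟩
      rw [← range_toFinsetChain]
      exact ⟨c, rfl⟩)
    (by
      rintro z - ⟨w, hw, hwz⟩
      rw [← range_toFinsetChain] at hw
      obtain ⟨w, rfl⟩ := hw
      rw [boundary_toFinsetChain] at hwz
      exact ⟨w, S.toFinsetChain_injective i hwz⟩)
    (by
      intro z hz
      have hz' := (Geometry.SimplicialComplex.mem_simplicialCycles_iff.1 hz).1
      rw [← range_toFinsetChain] at hz'
      obtain ⟨z, rfl⟩ := hz'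
      exact ⟨z, (hcyc z).2 hz, by rw [sub_self]; exact zero_mem _⟩)

lemma boundaries_le_cycles (i : ℕ) : S.simplices.boundaries i ≤ S.simplices.cycles i := by
  cases i with
  | zero => exact le_top
  | succ i =>
    rintro _ ⟨c, rfl⟩
    refine LinearMap.mem_ker.2 (S.toFinsetChain_injective i ?_)
    rw [← boundary_toFinsetChain, ← boundary_toFinsetChain, FinsetChain.boundary_boundary, map_zero]

end SimplicialStructure

/-! ### Sperner's lemma and the dimension of a triangulated manifold -/

lemma FinsetChain.tuple_comp {α β : Type*} {n : ℕ} {f : α → β} (hf : Function.Injective f)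
    (w : Fin n → α) : FinsetChain.tuple (f ∘ w) =
      Finsupp.mapDomain (Finset.map ⟨f, hf⟩) (FinsetChain.tuple w) := by
  classical
  simp only [tuple, hf.of_comp_iff]
  split_ifs
  · rw [Finsupp.mapDomain_single, Finset.map_eq_image, Finset.image_image]
    rfl
  · rw [Finsupp.mapDomain_zero]

namespace SingularChain

variable {Y Z α β : Type*} [TopologicalSpace Y] [TopologicalSpace Z]

lemma label_comp {f : α → β} (hf : Function.Injective f) (v : Y → α) {n : ℕ}
    (c : SingularChain n Y) :
    label (f ∘ v) n c = Finsupp.mapDomain (Finset.map ⟨f, hf⟩) (label v n c) := by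
  refine LinearMap.congr_fun (f := label (f ∘ v) n)
    (g := Finsupp.lmapDomain (ZMod 2) (ZMod 2) (Finset.map ⟨f, hf⟩) ∘ₗ label v n)
    (hom_ext_single fun σ => ?_) c
  rw [LinearMap.comp_apply, label_single, label_single]
  exact FinsetChain.tuple_comp hf _

lemma label_push (v : Z → α) {n : ℕ} (g : C(Y, Z)) (c : SingularChain n Y) :
    label v n (push n g c) = label (v ∘ g) n c := by
  refine LinearMap.congr_fun (f := label v n ∘ₗ push n g) (g := label (v ∘ g) n)
    (hom_ext_single fun σ => ?_) c
  rw [LinearMap.comp_apply, push_single, label_single, label_single]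
  rfl

lemma push_iterate_sd {n : ℕ} (g : C(Y, Z)) (c : SingularChain n Y) (N : ℕ) :
    push n g ((sd n Y ^ N) c) = (sd n Z ^ N) (push n g c) := by
  induction N with
  | zero => simp
  | succ N ih => simp only [pow_succ', Module.End.mul_apply, push_sd, ih]

lemma label_mem_supported (v : Y → α) {n : ℕ} (c : SingularChain n Y) :
    label v n c ∈ Finsupp.supported (ZMod 2) (ZMod 2) {s : Finset α | s.card = n} :=
  Finsupp.map_mem_of_mem_supported (s := Set.univ) (fun σ _ => by
    rw [label_single]
    exact FinsetChain.tuple_mem_supported fun t _ ht => ht) (by simp)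

/-- A non-degenerate simplex on all `n + 1` labels contains `a`. Consequently such a chain is
determined by its boundary. -/
lemma cone_label (a : Fin (n + 1)) (v : Y → Fin (n + 1)) (c : SingularChain (n + 1) Y) :
    FinsetChain.cone a (label v (n + 1) c) = 0 := by
  rw [← Submodule.mem_bot (ZMod 2)]
  refine Finsupp.map_mem_of_mem_supported (fun s hs => ?_) (label_mem_supported v c)
  rw [FinsetChain.cone_single, if_pos, Submodule.mem_bot]
  rw [(Finset.card_eq_iff_eq_univ s).1 (by simpa using hs)]
  exact Finset.mem_univ a

/-- **Sperner's lemma** for the iterated barycentric subdivisions of a simplex. -/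
lemma label_iterate_sd_universal (N : ℕ) {n : ℕ} {v : stdSimplex ℝ (Fin n) → Fin n}
    (hv : ∀ x : stdSimplex ℝ (Fin n), 0 < x (v x)) :
    label v n ((sd n _ ^ N) (universal n)) = Finsupp.single Finset.univ 1 := by
  classical
  induction n with
  | zero =>
    have h : ∀ N : ℕ, (sd 0 _ ^ N) (universal 0) = universal 0 := fun N => by
      induction N with
      | zero => simp
      | succ N ih => rw [pow_succ', Module.End.mul_apply, ih, sd_zero]
    rw [h, universal, label_single, FinsetChain.tuple,
      if_pos (Function.injective_of_subsingleton _)]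
    rfl
  | succ n ih =>
    have hboundary : FinsetChain.boundary _
        (label v (n + 1) ((sd (n + 1) _ ^ N) (universal (n + 1)))) =
        FinsetChain.boundary _ (Finsupp.single Finset.univ 1) := by
      rw [boundary_label, boundary_iterate_sd, universal, boundary_single,
        FinsetChain.boundary_single, map_sum, map_sum]
      refine Finset.sum_congr rfl fun i _ => ?_
      -- On the face opposite `i` the label `i` does not occur, so the labelling restricts to one of
      -- the same kind on a smaller simplex.
      have hvi : ∀ t, v (face i t) ≠ i := fun t h => by
        have := hv (face i t)
        rw [h, stdSimplex.face_apply_self] at this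
        exact this.false
      choose v' hv' using fun t => Fin.exists_succAbove_eq (hvi t)
      have hcomp : v ∘ face i = i.succAbove ∘ v' := funext fun t => (hv' t).symm
      rw [ContinuousMap.id_comp, ← push_universal, ← push_iterate_sd, label_push, hcomp,
        label_comp Fin.succAbove_right_injective, ih, Finsupp.mapDomain_single]
      · congr 1
        ext j
        simp [Fin.exists_succAbove_eq_iff]
      · intro t
        have := hv (face i t)
        rwa [← hv' t, stdSimplex.face_apply_succAbove] at this
    have h := FinsetChain.boundary_cone 0 (label v (n + 1) ((sd (n + 1) _ ^ N) (universal (n + 1))))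
    have h' := FinsetChain.boundary_cone (0 : Fin (n + 1)) (Finsupp.single Finset.univ 1)
    rw [cone_label, map_zero, hboundary] at h
    rw [FinsetChain.cone_single, if_pos (Finset.mem_univ _), map_zero] at h'
    exact add_right_cancel (h.symm.trans h')

end SingularChain

/-! ### From Sperner's lemma to invariance of dimension -/

namespace stdSimplex

open SingularChain in
/-- The lemma of Knaster, Kuratowski and Mazurkiewicz. -/
lemma exists_mem_of_forall_exists_mem {n : ℕ} {A : Fin (n + 1) → Set (stdSimplex ℝ (Fin (n + 1)))}
    (hA : ∀ i, IsClosed (A i)) (hcover : ∀ x, ∃ i, 0 < x i ∧ x ∈ A i) : ∃ x, ∀ i, x ∈ A i := by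
  classical
  choose v hv hvA using hcover
  have hsmall : ∀ δ > 0, ∃ y : Fin (n + 1) → stdSimplex ℝ (Fin (n + 1)),
      (∀ i, y i ∈ A i) ∧ ∀ i j, dist (y i) (y j) < δ := by
    intro δ hδ
    obtain ⟨N, hN⟩ := exists_iterate_sd_small (universal (n + 1)) hδ
    by_contra! hcon
    -- If no small simplex of the subdivision carried all labels, the labelled chain would be zero,
    -- against Sperner's lemma.
    have h0 : label v (n + 1) ((sd (n + 1) _ ^ N) (universal (n + 1))) ∈
        (⊥ : Submodule (ZMod 2) _) := by
      refine Finsupp.map_mem_of_mem_supported (fun σ hσ => ?_) (hN N le_rfl)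
      rw [Submodule.mem_bot, label_single, FinsetChain.tuple, if_neg]
      intro hinj
      obtain ⟨e, he⟩ := (Finite.injective_iff_surjective.1 hinj).hasRightInverse
      obtain ⟨i, j, hij⟩ := hcon (fun i => σ (vertex (e i))) fun i => by
        have := hvA (σ (vertex (e i)))
        rwa [show v (σ (vertex (e i))) = i from he i] at this
      exact (hσ (vertex (e i)) (vertex (e j))).not_ge hij
    rw [label_iterate_sd_universal N hv, Submodule.mem_bot, Finsupp.single_eq_zero] at h0
    exact one_ne_zero h0
  -- Without a common point, the sum of the distances to the sets has a positive minimum; points `y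
  -- i ∈ A i` closer together than this minimum divided by `n + 1` contradict it.
  by_contra! hcon
  have hcont : Continuous fun x => ∑ i, Metric.infDist x (A i) :=
    continuous_finsetSum _ fun i _ => Metric.continuous_infDist_pt _
  obtain ⟨x, -, hx⟩ := isCompact_univ.exists_isMinOn Set.univ_nonempty hcont.continuousOn
  have hne : ∀ i, (A i).Nonempty := fun i => by
    obtain ⟨y, hy, -⟩ := hsmall 1 one_pos
    exact ⟨y i, hy i⟩
  have hpos : 0 < ∑ i, Metric.infDist x (A i) := by
    obtain ⟨i, hi⟩ := hcon x
    exact (((hA i).notMem_iff_infDist_pos (hne i)).1 hi).trans_le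
      (Finset.single_le_sum (fun _ _ => Metric.infDist_nonneg) (Finset.mem_univ i))
  obtain ⟨y, hy, hyd⟩ := hsmall ((∑ i, Metric.infDist x (A i)) / (n + 1)) (by positivity)
  have h1 : ∑ i, Metric.infDist x (A i) ≤ ∑ i, Metric.infDist (y 0) (A i) := hx (Set.mem_univ _)
  have h2 : ∑ i, Metric.infDist (y 0) (A i) <
      ∑ _i : Fin (n + 1), (∑ i, Metric.infDist x (A i)) / (n + 1) :=
    Finset.sum_lt_sum_of_nonempty Finset.univ_nonempty fun i _ =>
      (Metric.infDist_le_dist_of_mem (hy i)).trans_lt (hyd 0 i)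
  rw [Finset.sum_const, Finset.card_univ, Fintype.card_fin, nsmul_eq_mul] at h2
  push_cast at h2
  rw [mul_div_cancel₀ _ (by positivity)] at h2
  exact h2.not_ge h1

/-- A continuous map from a simplex to the affine space that contains it takes a value `c` if it
does not move the faces beyond `c`. -/
lemma exists_eq_of_forall_le {n : ℕ} {g : stdSimplex ℝ (Fin (n + 1)) → Fin (n + 1) → ℝ}
    (hg : Continuous g) {c : Fin (n + 1) → ℝ} (hgc : ∀ x, ∑ i, g x i = ∑ i, c i)
    (hface : ∀ x i, x i = 0 → g x i ≤ c i) : ∃ x, g x = c := by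
  -- These sets satisfy the covering condition, since otherwise the coordinates of `g x` would sum
  -- to less than those of `c`. At a common point the equality of the sums forces equality
  -- everywhere.
  obtain ⟨x, hx⟩ := exists_mem_of_forall_exists_mem (A := fun i => {x | c i ≤ g x i})
    (fun i => isClosed_le continuous_const ((continuous_apply i).comp hg)) fun x => by
      by_contra! hcon
      obtain ⟨i, hi⟩ : ∃ i, x i ≠ 0 := by
        by_contra! h
        have := stdSimplex.sum_eq_one x
        simp [h] at this
      have hlt : ∀ i, x i ≠ 0 → g x i < c i := fun i hi =>
        not_le.1 (hcon i (lt_of_le_of_ne (stdSimplex.zero_le x i) (Ne.symm hi)))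
      refine (Finset.sum_lt_sum (fun i _ => ?_) ⟨i, Finset.mem_univ i, hlt i hi⟩).ne (hgc x)
      by_cases h : x i = 0
      exacts [hface x i h, (hlt i h).le]
  refine ⟨x, funext fun i => ?_⟩
  exact ((Finset.sum_eq_sum_iff_of_le fun i _ => hx i).1 (hgc x).symm i (Finset.mem_univ i)).symm

/-- A map from a simplex to the space of its last coordinates that is close to the identity takes
all values near the barycentre. -/
lemma exists_eq_of_dist_le {n : ℕ} {g : stdSimplex ℝ (Fin (n + 1)) → Fin n → ℝ}
    (hg : Continuous g) {ε : ℝ} (hε : 2 * (n + 1) ^ 2 * ε = 1)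
    (hgε : ∀ x i, |g x i - x i.succ| ≤ ε) {c : Fin n → ℝ} (hc : ∀ i, |c i - (n + 1 : ℝ)⁻¹| ≤ ε) :
    ∃ x, g x = c := by
  have hn : (n + 1 : ℝ)⁻¹ = 2 * (n + 1) * ε := by
    field_simp
    linarith
  have hε0 : 0 < ε := by
    by_contra! h
    have : 2 * (n + 1 : ℝ) ^ 2 * ε ≤ 0 := mul_nonpos_of_nonneg_of_nonpos (by positivity) h
    linarith
  -- A zeroth coordinate is added so that all sums are `1`. Since `1 / (n + 1) = 2 (n + 1) ε`, on
  -- face `0` that coordinate is at most `n ε` for `g` and at least `(n + 2) ε` for `c`; on the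
  -- other faces the bounds are `ε` and `(2 n + 1) ε`.
  obtain ⟨x, hx⟩ := exists_eq_of_forall_le (g := fun x => Fin.cons (1 - ∑ i, g x i) (g x))
    (c := Fin.cons (1 - ∑ i, c i) c) (continuous_pi fun i => by
      refine Fin.cases ?_ (fun i => ?_) i
      · simp only [Fin.cons_zero]
        fun_prop
      · simp only [Fin.cons_succ]
        fun_prop) (fun x => by simp [Fin.sum_univ_succ]) fun x i => by
      refine Fin.cases (fun hx => ?_) (fun i hx => ?_) i
      · have hsum : ∑ i : Fin n, x i.succ = 1 := by
          have := stdSimplex.sum_eq_one x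
          rwa [Fin.sum_univ_succ, hx, zero_add] at this
        have h1 : ∑ i : Fin n, x i.succ ≤ ∑ i : Fin n, (g x i + ε) :=
          Finset.sum_le_sum fun i _ => by have := (abs_le.1 (hgε x i)).1; linarith
        have h2 : ∑ i : Fin n, c i ≤ ∑ _i : Fin n, ((n + 1 : ℝ)⁻¹ + ε) :=
          Finset.sum_le_sum fun i _ => by have := (abs_le.1 (hc i)).2; linarith
        simp only [Finset.sum_add_distrib, Finset.sum_const, Finset.card_univ, Fintype.card_fin,
          nsmul_eq_mul, hn, hsum] at h1 h2
        simp only [Fin.cons_zero]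
        nlinarith
      · simp only [Fin.cons_succ]
        have h1 := (abs_le.1 (hgε x i)).2
        have h2 := (abs_le.1 (hc i)).1
        rw [hx] at h1
        rw [hn] at h2
        nlinarith [(Nat.cast_nonneg n : (0 : ℝ) ≤ n)]
  exact ⟨x, (Fin.cons_inj.1 hx).2⟩

open scoped Manifold ContDiff in
/-- A simplex cannot be embedded in a Euclidean space of smaller dimension. -/
lemma not_injective_of_lt {n k : ℕ} (hnk : n < k)
    (h : C(stdSimplex ℝ (Fin (k + 1)), EuclideanSpace ℝ (Fin n))) : ¬ Function.Injective h := by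
  intro hinj
  set ε : ℝ := (2 * (k + 1) ^ 2)⁻¹ with hε
  have hε0 : 0 < ε := by positivity
  let p : stdSimplex ℝ (Fin (k + 1)) → Fin k → ℝ := fun x i => x i.succ
  have hp : Continuous p := continuous_pi fun i =>
    (continuous_apply i.succ).comp continuous_subtype_val
  -- `g` is a smooth approximate inverse of `h`, glued by a partition of unity from local constants.
  obtain ⟨g, hg⟩ := exists_contMDiffMap_forall_mem_convex_of_local_const
    (𝓘(ℝ, EuclideanSpace ℝ (Fin n))) (n := ⊤) (F := Fin k → ℝ)
    (t := fun x => ⋂ y ∈ h ⁻¹' {x}, Metric.ball (p y) ε)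
    (fun x => convex_iInter₂ fun y _ => convex_ball _ _) fun x => by
      have hc : ∃ c, ∀ y, h y = x → p y = c := by
        by_cases hx : ∃ y, h y = x
        · obtain ⟨y, rfl⟩ := hx
          exact ⟨p y, fun z hz => congrArg p (hinj hz)⟩
        · exact ⟨0, fun y hy => absurd ⟨y, hy⟩ hx⟩
      obtain ⟨c, hc⟩ := hc
      -- Compactness makes `c` admissible near `x`: the image of the points where `p` is far from
      -- `c` is closed and avoids `x`.
      have hclosed : IsClosed (h '' {y | ε ≤ dist c (p y)}) :=
        ((isClosed_le continuous_const (continuous_const.dist hp)).isCompact.image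
          h.continuous).isClosed
      refine ⟨c, Filter.mem_of_superset (hclosed.isOpen_compl.mem_nhds ?_) fun z hz => ?_⟩
      · rintro ⟨y, hy, hyx⟩
        rw [Set.mem_ofPred_eq, hc y hyx, dist_self] at hy
        exact hy.not_gt hε0
      · refine Set.mem_iInter₂.2 fun y hy => ?_
        by_contra hcon
        rw [Metric.mem_ball, dist_comm, dist_comm, not_lt] at hcon
        exact hz ⟨y, hcon, hy⟩
  have hgsmooth : ContDiff ℝ 1 g := g.contMDiff.contDiff.of_le (by simp)
  have hdense := hgsmooth.dense_compl_range_of_finrank_lt_finrank (by simpa using hnk)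
  obtain ⟨c, hcball, hc⟩ := hdense.exists_mem_open (U := Metric.ball (fun _ => (k + 1 : ℝ)⁻¹) ε)
    Metric.isOpen_ball ⟨_, Metric.mem_ball_self hε0⟩
  obtain ⟨x, hx⟩ := exists_eq_of_dist_le (g := g ∘ h) (ε := ε) (c := c)
    (hgsmooth.continuous.comp h.continuous) (by rw [hε]; field_simp) (fun x i => by
      have h1 := Set.mem_iInter₂.1 (hg (h x)) x rfl
      exact ((dist_le_pi_dist _ _ i).trans_lt h1).le) fun i => by
      exact ((dist_le_pi_dist c (fun _ => (k + 1 : ℝ)⁻¹) i).trans_lt hc).le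
  exact hcball ⟨h x, hx⟩

/-- A simplex cannot be embedded in a manifold of smaller dimension. -/
lemma not_injective_of_chartedSpace {M : Type*} [TopologicalSpace M] {n k : ℕ} (hnk : n < k)
    [ChartedSpace (EuclideanSpace ℝ (Fin n)) M] (f : C(stdSimplex ℝ (Fin (k + 1)), M)) :
    ¬ Function.Injective f := by
  intro hinj
  let φ := chartAt (EuclideanSpace ℝ (Fin n)) (f (contraction k).pt)
  have hU : IsOpen (f ⁻¹' φ.source) := φ.open_source.preimage f.continuous
  -- The simplex is shrunk towards its barycentre until its image lies in one chart.
  have hev : ∀ᶠ r in nhds (0 : unitInterval), ∀ t ∈ (Set.univ : Set (stdSimplex ℝ (Fin (k + 1)))),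
      (contraction k).toMap (t, r) ∈ f ⁻¹' φ.source := by
    refine isCompact_univ.eventually_forall_of_forall_eventually fun t _ => ?_
    have hcont : Continuous fun z : unitInterval × stdSimplex ℝ (Fin (k + 1)) =>
        (contraction k).toMap (z.2, z.1) := (contraction k).toMap.continuous.comp continuous_swap
    refine hcont.continuousAt.eventually (hU.mem_nhds ?_)
    change f ((contraction k).toMap (t, 0)) ∈ φ.source
    rw [(contraction k).map_zero]
    exact mem_chart_source _ _
  obtain ⟨r, hr, hr0⟩ : ∃ r : unitInterval, (∀ t ∈ (Set.univ : Set (stdSimplex ℝ (Fin (k + 1)))),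
      (contraction k).toMap (t, r) ∈ f ⁻¹' φ.source) ∧ (r : ℝ) ≠ 0 := by
    obtain ⟨δ, hδ, h⟩ := Metric.eventually_nhds_iff.1 hev
    have h0 : 0 < min (δ / 2) 1 := by positivity
    refine ⟨⟨min (δ / 2) 1, h0.le, min_le_right _ _⟩, h ?_, h0.ne'⟩
    rw [Subtype.dist_eq, Real.dist_eq]
    change |min (δ / 2) 1 - 0| < δ
    rw [sub_zero, abs_of_pos h0]
    exact (min_le_left _ _).trans_lt (half_lt_self hδ)
  refine not_injective_of_lt hnk
    ⟨fun t => φ (f ((contraction k).toMap (t, r))), ?_⟩ fun s t hst => ?_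
  · exact φ.continuousOn.comp_continuous (f.continuous.comp
      ((contraction k).toMap.continuous.comp (by fun_prop))) fun t => hr t trivial
  · have h := hinj (φ.injOn (hr s trivial) (hr t trivial) hst)
    ext i
    have hi := congrArg (fun x : stdSimplex ℝ (Fin (k + 1)) => x i) h
    simp only [contraction_apply] at hi
    exact mul_left_cancel₀ hr0 (add_right_cancel hi)

end stdSimplex

/-- Affine independence of the vertices makes the parametrisation of such a simplex an injective map
into `M`. -/
lemma SimplicialStructure.isEmpty_cell {M : Type u} [TopologicalSpace M] {n : ℕ}
    [ChartedSpace (EuclideanSpace ℝ (Fin n)) M] (S : SimplicialStructure M) :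
    IsEmpty (S.simplices.Cell (n + 1)) := by
  refine ⟨fun s => ?_⟩
  let e : Fin (n + 2) ≃ s.1 := (Finset.equivFinOfCardEq s.2.2).symm
  have hindep : AffineIndependent ℝ fun j => (e j : EuclideanSpace ℝ (Fin S.N)) :=
    (S.K.indep s.2.1).comp_embedding e.toEmbedding
  let g : stdSimplex ℝ (Fin (n + 2)) → EuclideanSpace ℝ (Fin S.N) :=
    fun t => ∑ j, t j • (e j : EuclideanSpace ℝ (Fin S.N))
  have hg : Continuous g := continuous_finsetSum _ fun j _ =>
    ((continuous_apply j).comp continuous_subtype_val).smul continuous_const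
  have hgK : ∀ t, g t ∈ S.K.space := fun t =>
    Geometry.SimplicialComplex.convexHull_subset_space s.2.1
      ((convex_convexHull ℝ _).sum_mem (fun j _ => stdSimplex.zero_le t j)
        (stdSimplex.sum_eq_one t) fun j _ => subset_convexHull ℝ _ (e j).2)
  refine stdSimplex.not_injective_of_chartedSpace (n := n) (Nat.lt_succ_self n)
    ⟨fun t => S.homeo ⟨g t, hgK t⟩, S.homeo.continuous.comp (hg.subtype_mk hgK)⟩ fun x y hxy => ?_
  have hgxy : g x = g y := congrArg Subtype.val (S.homeo.injective hxy)
  ext j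
  refine sub_eq_zero.1 (affineIndependent_iff.1 hindep Finset.univ (fun j => x j - y j) ?_ ?_ j
    (Finset.mem_univ j))
  · rw [Finset.sum_sub_distrib, stdSimplex.sum_eq_one, stdSimplex.sum_eq_one, sub_self]
  · simp only [sub_smul, Finset.sum_sub_distrib]
    exact sub_eq_zero.2 hgxy

/-! ### The homological quantum code -/

lemma finrank_subquotient {ι : Type*} [Fintype ι] {Z B : Submodule (ZMod 2) (ι → ZMod 2)}
    (h : B ≤ Z) : Module.finrank (ZMod 2) (Subquotient Z B) =
      Module.finrank (ZMod 2) Z - Module.finrank (ZMod 2) B := by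
  have h1 := Submodule.finrank_quotient_add_finrank (B.submoduleOf Z)
  rw [(Submodule.submoduleOfEquivOfLe h).finrank_eq] at h1
  exact Nat.eq_sub_of_add_eq h1

end

theorem theorem2p5 {M : Type u} [TopologicalSpace M] [T2Space M] [CompactSpace M] (n : ℕ)
    [ChartedSpace (EuclideanSpace ℝ (Fin n)) M] (S : SimplicialStructure M)
    (i : ℕ) (hi : i ≤ n) (hH : Nontrivial (HomologyZ2 i M)) :
    (∀ v ∈ perp (S.simplices.cycles i), ∀ w ∈ S.simplices.boundaries i, v ⬝ᵥ w = 0) ∧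
    Module.Finite (ZMod 2) (HomologyZ2 i M) ∧
    IsQuantumCode (cssCode (perp (S.simplices.cycles i)) (S.simplices.boundaries i))
      (Fintype.card (S.simplices.Cell i))
      (Module.finrank (ZMod 2) (HomologyZ2 i M))
      (min (S.simplices.csys i) ((S.dual n).csys (n - i))) := by
  have hBZ := S.boundaries_le_cycles i
  let e := (S.homologyEquiv i).trans (S.simplicialEquiv i).symm
  have hperp : perp (S.simplices.cycles i) ≤ perp (S.simplices.boundaries i) := perp_anti hBZ
  have hne : ¬ S.simplices.cycles i ≤ S.simplices.boundaries i := fun h => by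
    have := e.symm.toEquiv.nontrivial
    have : Subsingleton (Subquotient (S.simplices.cycles i) (S.simplices.boundaries i)) :=
      Submodule.Quotient.subsingleton_iff.2 (Submodule.submoduleOf_eq_top.2 h)
    exact not_subsingleton _ this
  refine ⟨fun v hv w hw => ?_, Module.Finite.equiv e.symm, rfl, ?_, ?_⟩
  · rw [dotProduct_comm]
    exact hv w (hBZ hw)
  · rw [finrank_cssCode hperp, e.finrank_eq, finrank_subquotient hBZ]
    have h1 := finrank_perp_add (S.simplices.cycles i)
    have h2 := finrank_perp_add (S.simplices.boundaries i)
    congr 1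
    omega
  -- Non-zero homology gives `Z_i ⊄ B_i`, hence also `B_i^⊥ ⊄ Z_i^⊥`. So both infima are attained,
  -- rather than being the default value `0`.
  · refine isLeast_weight_cssCode hperp ?_ ?_
    · rw [perp_perp]
      obtain ⟨c, hc, hc'⟩ := SetLike.not_le_iff_exists.1 hne
      exact ⟨Nat.sInf_mem ⟨_, c, hc, hc', rfl⟩, fun w hw => Nat.sInf_le hw⟩
    -- The absence of `(n+1)`-simplices is called for only when `i = n`.
    · rw [S.csys_dual hi fun h => h ▸ S.isEmpty_cell]
      obtain ⟨c, hc, hc'⟩ := SetLike.not_le_iff_exists.1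
        fun h : perp (S.simplices.boundaries i) ≤ perp (S.simplices.cycles i) => hne (by
          have := perp_anti h
          rwa [perp_perp, perp_perp] at this)
      exact ⟨Nat.sInf_mem ⟨_, c, hc, hc', rfl⟩, fun w hw => Nat.sInf_le hw⟩
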